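/- Let $r\ge 3$ and $0\le k\le r-2$ be integers and $\theta=e^{2\pi \mathrm i/(r-1)}$. Fix $\alpha\in\mathbb R$ and use throughout the branch $\arg t\in(\alpha-\pi,\alpha+\pi]$ to define the powers of $t\neq 0$ (principal for $\alpha=0$). Put $f_t(w)=\frac{w^r}{r}-tw$ and $w_k=\theta^k t^{1/(r-1)}$, a critical point of $f_t$. A *Stokes line* from $w_k$ is a solution $z\colon\mathbb R\to\mathbb C$ of $\frac{dz}{d\tau}=-\overline{f_t'(z)}$ with $z\to w_k$ as $\tau\to-\infty$ and $z\to b$ as $\tau\to+\infty$ for another critical point $b\ne w_k$. Let $D_k$ be the set of $t\ne0$ with $\arg t\neq\alpha+\pi$ for which there is no Stokes line from $w_k$. For $t\in D_k$ let $\tilde C_k$ be the Lefschetz thimble through $w_k$, i.e. the curve consisting of $w_k$ and the two flow lines of this equation that emanate from $w_k$ and run to infinity, oriented so that its direction at $w_k$ is $e^{\mathrm i\vartheta}$, $\vartheta=\frac12\bigl(\pi-\frac{r-2}{r-1}(2\pi k+\arg t)\bigr)$. The hyper-Airy function is $$\widetilde{\mathrm{Ai}}_{r,k}(t)=\frac{\theta^{k\frac{r-2}{2}}}{2\pi\mathrm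 i}\int_{\tilde C_k}e^{\frac{w^r}{r}-tw}\,dw ,\qquad \theta^{k\frac{r-2}{2}}:=e^{\pi\mathrm i k(r-2)/(r-1)} .$$ Let $P_m(r,a)$, $m\ge0$, $0\le a\le r-1$, be the unique numbers with $P_0(r,a)=1$, $P_m(r,0)=P_m(r,r-1)$ for all $m$, and $$P_m(r,a)-P_m(r,a-1)=r\Bigl(m-\tfrac12-\tfrac ar\Bigr)P_{m-1}(r,a-1)\qquad\text{for } m\ge1,\ a=1,\dots,r-1 .$$ Then the following hold. 1. There are Stokes lines from $w_k$ only for finitely many values of $\arg t\in(\alpha-\pi,\alpha+\pi)$; the set $D_k$ is open; and for every $t\in D_k$ the thimble $\tilde C_k$ exists and the integral converges absolutely, with a value that does not depend on the regular parametrization of the oriented thimble. 2. $\widetilde{\mathrm{Ai}}_{r,k}$ is holomorphic on $D_k$ and solves $u^{(r-1)}(t)=(-1)^{r-1}\,t\,u(t)$ there. 3. For every $0\le a\le r-1$ and every closed sector $S=\{t\ne0:\varphi_1\le\arg t\le\varphi_2\}\subseteq D_k$ with $\alpha-\pi<\varphi_1$ and $\varphi_2<\alpha+\pi$, one has, as $t\to\infty$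 in $S$, the asymptotic expansion $$\widetilde{\mathrm{Ai}}^{(a)}_{r,k}(t)\sim\frac{(-\theta^k)^a}{\sqrt{2\pi(r-1)}}\,e^{-\frac{r-1}{r}\theta^k t^{\frac r{r-1}}}\,t^{-\frac{r-2a-2}{2(r-1)}}\sum_{m\ge0}P_m(r,a)\left(\theta^{-k}\,\frac{t^{-\frac r{r-1}}}{r-1}\right)^m ,$$ that is, for every $N\ge0$ the difference between the left-hand side and the right-hand side truncated to $m<N$ is $O\bigl(e^{-\frac{r-1}{r}\theta^k t^{r/(r-1)}}\,t^{-\frac{r-2a-2}{2(r-1)}}\,t^{-\frac{Nr}{r-1}}\bigr)$, uniformly in $S$. -/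

import Mathlib

open Filter Topology

noncomputable section

namespace HyperAiry

/-! ### The coefficients `P_m(r,a)` -/

/-- The defining relations of the numbers `P_m(r,a)`, `m ≥ 0`, `0 ≤ a ≤ r - 1`, for a fixed `r`:
`P_0 = 1`, `P_m(r,a) - P_m(r,a-1) = r (m - 1/2 - a/r) P_{m-1}(r,a-1)` and
`P_m(r,0) = P_m(r,r-1)`. -/
structure IsPPZ (r : ℕ) (P : ℕ → ℕ → ℚ) : Prop where
  init : ∀ a, a ≤ r - 1 → P 0 a = 1
  step : ∀ m a, 1 ≤ m → 1 ≤ a → a ≤ r - 1 →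
    P m a - P m (a - 1) = r * ((m : ℚ) - 1 / 2 - a / r) * P (m - 1) (a - 1)
  cycle : ∀ m, P m 0 = P m (r - 1)

/-- The partial sums `∑_{b=1}^{a} r (m - 1/2 - b/r) Q(b-1)`. -/
def ppzSum (r m : ℕ) (Q : ℕ → ℚ) (a : ℕ) : ℚ :=
  ∑ b ∈ Finset.range a, r * ((m : ℚ) - 1 / 2 - ((b + 1 : ℕ) : ℚ) / r) * Q b

/-- The numbers `P_m(r,a)`. The first two defining relations express `P_m(r,·)` through
`P_m(r,0)` and `P_{m-1}(r,·)`; the value `P_m(r,0)` is then the only one for which the relations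
of the next order `m + 1` sum up to `P_{m+1}(r,r-1) - P_{m+1}(r,0) = 0`.
See `ppz_isPPZ` and `IsPPZ.eq_ppz`: this is the unique solution of the defining relations. -/
def ppz (r : ℕ) : ℕ → ℕ → ℚ
  | 0, _ => 1
  | m + 1, a =>
    ppzSum r (m + 1) (ppz r m) a
      - ppzSum r (m + 2) (ppzSum r (m + 1) (ppz r m)) (r - 1) / (r * ((r : ℚ) - 1) * (m + 1))

theorem ppzSum_add (r m : ℕ) (Q Q' : ℕ → ℚ) (a : ℕ) :
    ppzSum r m (fun b => Q b + Q' b) a = ppzSum r m Q a + ppzSum r m Q' a := by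
  simp only [ppzSum, ← Finset.sum_add_distrib, mul_add]

theorem ppzSum_const (r m : ℕ) (hr : 3 ≤ r) (c : ℚ) :
    ppzSum r m (fun _ => c) (r - 1) = r * ((r : ℚ) - 1) * ((m : ℚ) - 1) * c := by
  have hr0 : (r : ℚ) ≠ 0 := by positivity
  have h : ∀ a : ℕ, ppzSum r m (fun _ => c) a
      = (r * ((m : ℚ) - 1 / 2) * a - a * (a + 1) / 2) * c := by
    intro a
    induction a with
    | zero => simp [ppzSum]
    | succ n ih =>
      unfold ppzSum at ih ⊢
      rw [Finset.sum_range_succ, ih]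
      push_cast
      field_simp
      ring
  rw [h, Nat.cast_sub (by omega)]
  push_cast
  ring

/-- Summing the relations of order `m`. -/
theorem IsPPZ.eq_sum {r : ℕ} {P : ℕ → ℕ → ℚ} (hP : IsPPZ r P) (m : ℕ) :
    ∀ a, a ≤ r - 1 → P (m + 1) a = P (m + 1) 0 + ppzSum r (m + 1) (P m) a := by
  intro a
  induction a with
  | zero => simp [ppzSum]
  | succ n ih =>
    intro hn
    have h1 := hP.step (m + 1) (n + 1) (by omega) (by omega) hn
    have h2 := ih (by omega)
    simp only [Nat.add_sub_cancel] at h1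
    unfold ppzSum at h2 ⊢
    rw [Finset.sum_range_succ]
    linarith

theorem ppzSum_congr (r m : ℕ) {Q Q' : ℕ → ℚ} {a : ℕ} (h : ∀ b, b < a → Q b = Q' b) :
    ppzSum r m Q a = ppzSum r m Q' a :=
  Finset.sum_congr rfl fun b hb => by rw [h b (Finset.mem_range.mp hb)]

theorem ppz_cycle_sum (r : ℕ) (hr : 3 ≤ r) (m : ℕ) :
    ppzSum r (m + 1) (ppz r m) (r - 1) = 0 := by
  cases m with
  | zero =>
    have : ppz r 0 = fun _ => 1 := by funext a; simp [ppz]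
    rw [this, ppzSum_const r _ hr]
    simp
  | succ m =>
    have h : ppz r (m + 1) = fun a => ppzSum r (m + 1) (ppz r m) a +
        (-(ppzSum r (m + 2) (ppzSum r (m + 1) (ppz r m)) (r - 1)
          / (r * ((r : ℚ) - 1) * (m + 1)))) := by
      funext a; rw [ppz]; ring
    rw [h, ppzSum_add, ppzSum_const r _ hr]
    have hr0 : (r : ℚ) ≠ 0 := by positivity
    have hr1 : (r : ℚ) - 1 ≠ 0 := by
      have : (3 : ℚ) ≤ r := by exact_mod_cast hr
      linarith
    have hm : (m : ℚ) + 1 ≠ 0 := by positivity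
    push_cast
    field_simp
    ring

theorem ppz_isPPZ (r : ℕ) (hr : 3 ≤ r) : IsPPZ r (ppz r) where
  init a _ := by simp [ppz]
  step m a hm ha _ := by
    obtain ⟨m, rfl⟩ : ∃ n, m = n + 1 := ⟨m - 1, by omega⟩
    obtain ⟨a, rfl⟩ : ∃ n, a = n + 1 := ⟨a - 1, by omega⟩
    simp only [Nat.add_sub_cancel]
    rw [ppz, ppz]
    conv_lhs => rw [ppzSum, Finset.sum_range_succ, ← ppzSum]
    ring
  cycle m := by
    cases m with
    | zero => simp [ppz]
    | succ m =>
      rw [ppz, ppz, ppz_cycle_sum r hr m]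
      simp [ppzSum]

theorem IsPPZ.eq_ppz {r : ℕ} (hr : 3 ≤ r) {P : ℕ → ℕ → ℚ} (hP : IsPPZ r P) (m a : ℕ)
    (ha : a ≤ r - 1) : P m a = ppz r m a := by
  have hr0 : (r : ℚ) ≠ 0 := by positivity
  have hr1 : (r : ℚ) - 1 ≠ 0 := by
    have : (3 : ℚ) ≤ r := by exact_mod_cast hr
    linarith
  induction m generalizing a with
  | zero => rw [hP.init a ha]; simp [ppz]
  | succ m ih =>
    have hm : (m : ℚ) + 1 ≠ 0 := by positivity
    have e : ∀ b, b ≤ r - 1 → ppzSum r (m + 1) (P m) b = ppzSum r (m + 1) (ppz r m) b :=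
      fun b hb => ppzSum_congr r _ fun c hc => ih c (by omega)
    have h0 : ppzSum r (m + 2) (P (m + 1)) (r - 1) = 0 := by
      have h1 := hP.eq_sum (m + 1) (r - 1) le_rfl
      have h2 := hP.cycle (m + 2)
      linarith
    rw [ppzSum_congr r (m + 2) (Q' := fun b => ppzSum r (m + 1) (ppz r m) b + P (m + 1) 0)
      (fun b hb => by rw [hP.eq_sum m b (by omega), e b (by omega), add_comm]),
      ppzSum_add, ppzSum_const r _ hr] at h0
    rw [hP.eq_sum m a ha, e a ha, ppz]
    have h3 : P (m + 1) 0 = -(ppzSum r (m + 2) (ppzSum r (m + 1) (ppz r m)) (r - 1)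
          / (r * ((r : ℚ) - 1) * (m + 1))) := by
      push_cast at h0
      field_simp
      linarith
    rw [h3]
    ring

/-! ### Stokes lines and Lefschetz thimbles -/

/-- `z` is a Stokes line of the phase `f` from the critical point `c` to the critical point `b`:
a solution of the steepest descent equation `dz/dτ = - conj (f'(z))` with `z → c` as `τ → -∞` and
`z → b` as `τ → +∞`. -/
def IsStokesLine (f : ℂ → ℂ) (c b : ℂ) (z : ℝ → ℂ) : Prop :=
  (∀ τ, HasDerivAt z (-(starRingEnd ℂ) (deriv f (z τ))) τ) ∧
    Tendsto z atBot (𝓝 c) ∧ Tendsto z atTop (𝓝 b)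

/-- `γ` is a regular parametrization of the Lefschetz thimble of the phase `f` through the critical
point `c = γ(0)`. The two halves `x > 0` and `x < 0` are the two steepest descent flow lines (the
solutions of `dz/dτ = - conj (f'(z))`) that emanate from `c`, each followed away from `c`; they are
unbounded, so that the curve is closed. Flow lines reach infinity in finite time `τ` when `f` is a
polynomial of degree at least three, so they are parametrized here with an arbitrary positive
speed: the velocity is a positive multiple of the steepest descent field, away from `c`. -/
structure IsThimble (f : ℂ → ℂ) (c : ℂ) (γ : ℝ → ℂ) : Prop where
  contDiff : ContDiff ℝ 1 γ
  base : γ 0 = c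
  regular : ∀ x, deriv γ x ≠ 0
  flow_pos : ∀ x, 0 < x → ∃ ρ : ℝ, 0 < ρ ∧ deriv γ x = -ρ * (starRingEnd ℂ) (deriv f (γ x))
  flow_neg : ∀ x, x < 0 → ∃ ρ : ℝ, 0 < ρ ∧ deriv γ x = ρ * (starRingEnd ℂ) (deriv f (γ x))
  tendsto_top : Tendsto γ atTop (Bornology.cobounded ℂ)
  tendsto_bot : Tendsto γ atBot (Bornology.cobounded ℂ)

/-! ### Branches of powers of `t` -/

/-- The argument of `t` with values in `(α - π, α + π]`. -/
def argBranch (α : ℝ) (t : ℂ) : ℝ := Complex.arg (t * Complex.exp (-(α * Complex.I))) + α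

/-- The logarithm of `t` with imaginary part in `(α - π, α + π]`; the principal one for `α = 0`. -/
def logBranch (α : ℝ) (t : ℂ) : ℂ :=
  Complex.log (t * Complex.exp (-(α * Complex.I))) + α * Complex.I

/-- The corresponding branch of the power `t ^ s`, for `t ≠ 0`. -/
def powBranch (α : ℝ) (t s : ℂ) : ℂ := Complex.exp (s * logBranch α t)

/-! ### The hyper-Airy functions -/

/-- `θ = exp (2πi / (r-1))`. -/
def theta (r : ℕ) : ℂ := Complex.exp (2 * Real.pi * Complex.I / ((r : ℂ) - 1))

/-- `θ ^ (k (r-2) / 2)`. -/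
def thetaHalf (r k : ℕ) : ℂ :=
  Complex.exp (2 * Real.pi * Complex.I / ((r : ℂ) - 1) * (k * ((r : ℂ) - 2) / 2))

/-- The phase `w ^ r / r - t w`. -/
def phase (r : ℕ) (t w : ℂ) : ℂ := w ^ r / r - t * w

/-- The critical point `θ ^ k t ^ (1/(r-1))` of the phase. -/
def critPt (r : ℕ) (α : ℝ) (k : ℕ) (t : ℂ) : ℂ :=
  theta r ^ k * powBranch α t (1 / ((r : ℂ) - 1))

/-- `t` lies on a Stokes ray of the `k`-th critical point: there is a Stokes line from this critical
point to another one. -/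
def OnStokesRay (r : ℕ) (α : ℝ) (k : ℕ) (t : ℂ) : Prop :=
  ∃ b z, b ≠ critPt r α k t ∧ deriv (phase r t) b = 0 ∧
    IsStokesLine (phase r t) (critPt r α k t) b z

/-- The `t`-plane without the branch cut and without the Stokes rays of the `k`-th critical
point. -/
def domain (r : ℕ) (α : ℝ) (k : ℕ) : Set ℂ :=
  {t | t * Complex.exp (-(α * Complex.I)) ∈ Complex.slitPlane ∧ ¬ OnStokesRay r α k t}

/-- `γ` parametrizes the thimble of `w ^ r / r - t w` through the `k`-th critical point `w_k` and
has the right orientation: its direction at `w_k` is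
`exp (i (π - arg (w_k ^ (r-2))) / 2)`, where
`arg (w_k ^ (r-2)) = (2π k + arg t) (r-2) / (r-1)` is the argument of the second derivative
`(r-1) w_k ^ (r-2)` of the phase. -/
def IsOrientedThimble (r : ℕ) (α : ℝ) (k : ℕ) (t : ℂ) (γ : ℝ → ℂ) : Prop :=
  IsThimble (phase r t) (critPt r α k t) γ ∧
    ∃ ρ : ℝ, 0 < ρ ∧ deriv γ 0 = ρ * Complex.exp (Complex.I *
      ((Real.pi - (2 * Real.pi * k + argBranch α t) * ((r : ℂ) - 2) / ((r : ℂ) - 1)) / 2))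

/-- The integrand of the contour integral of `exp (w ^ r / r - t w)` along `γ`. -/
def integrand (r : ℕ) (t : ℂ) (γ : ℝ → ℂ) (x : ℝ) : ℂ :=
  Complex.exp (phase r t (γ x)) * deriv γ x

open Classical in
/-- The `k`-th hyper-Airy function: `θ ^ (k (r-2)/2) / (2πi)` times the integral of
`exp (w ^ r / r - t w) dw` over the oriented thimble through the `k`-th critical point
(and `0` where there is no thimble). -/
def hyperAiry (r : ℕ) (α : ℝ) (k : ℕ) (t : ℂ) : ℂ :=
  if h : ∃ γ, IsOrientedThimble r α k t γ then
    thetaHalf r k / (2 * Real.pi * Complex.I) * ∫ x : ℝ, integrand r t h.choose x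
  else 0

/-! ### Asymptotic expansions -/

/-- The closed sector `φ₁ ≤ arg t ≤ φ₂`, `t ≠ 0`. -/
def sector (α φ₁ φ₂ : ℝ) : Set ℂ := {t | t ≠ 0 ∧ argBranch α t ∈ Set.Icc φ₁ φ₂}

/-- `F ∼ p ∑_{m ≥ 0} c_m u ^ m` as `t → ∞` in `S`, to all orders and uniformly in `S`. -/
def HasAsymptoticExpansion (S : Set ℂ) (F p u : ℂ → ℂ) (c : ℕ → ℂ) : Prop :=
  ∀ N : ℕ, Asymptotics.IsBigO (Bornology.cobounded ℂ ⊓ 𝓟 S)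
    (fun t => F t - p t * ∑ m ∈ Finset.range N, c m * u t ^ m)
    (fun t => p t * u t ^ N)

end HyperAiry

end

namespace HyperAiry
open Set Metric

/-! ### Local inverses, lifts and limits of lifts -/

/-! The scaling w = c u with c^(r-1) = t turns the phase into c^r g(u), g(u) = u^r/r - u, so only
the critical point 1 of g matters. Since g - g(1) has a double zero there, a square root of g(1) -
g(u) is a local coordinate ζ, and its inverse is a germ U with g(U(ζ)) = g(1) - ζ^2 and U(0) = 1
(`exists_germ`). If β^2 c^r = 1, the phase drops by exactly v^2 along v ↦ c U(vβ); this curve is the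
thimble, as soon as U continues along both rays ±β.

Continuation along a ray can stop only at a critical point (`IsGerm.ray_dichotomy`): lifts over
bounded intervals stay bounded, the fibres of g are finite, so the lift converges, and a noncritical
limit permits one more local inversion. If it does stop, the path parametrized by time is a Stokes
line, because g' has simple zeros and the time spent near them diverges logarithmically
(`exists_isStokesLine`). Off the Stokes rays U therefore exists along the whole line, and a
quantitative inversion widens the line to a double sector on which U' grows at most linearly
(`IsGerm.exists_sector_branch`). Conversely, every oriented thimble is an increasing
reparametrization of v ↦ c U(vβ), so its integral is c exp(f(c)) ∫ exp(-v^2) U'(vβ) β dv.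

The moving contour has now become a fixed function U integrated along a moving line. Let I_a be the
integral with the extra factor w^a. Eliminating U^r between the equation for U and its derivative,
and integrating by parts, gives dI_a/dt = -I_(a+1) (`IsBranch.hasDerivAt_thimbleInt`); the relation
U^(r-1) U' = U' - 2ζ gives I_(r-1) = t I_0. Together these are the differential equation. The
asymptotics are Watson's lemma for U^a U': odd Gaussian moments vanish, and the same two relations,
read on Taylor coefficients, are the recursion and the cyclic condition for P_m(r,a)
(`IsBranch.taylorCoeff_eq`). Error constants depend only on the branch, and by compactness finitely
many branches cover a closed sector.

Stokes directions are finite in number because Im f is constant along the flow: equality at two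
critical points is a sine equation in arg t. -/

theorem exists_local_inverse {f : ℂ → ℂ} {a : ℂ} (hf : AnalyticAt ℂ f a) (h : deriv f a ≠ 0) :
    ∃ G : ℂ → ℂ, G (f a) = a ∧ AnalyticAt ℂ G (f a) ∧ HasDerivAt G (deriv f a)⁻¹ (f a) ∧
      (∀ᶠ z in 𝓝 (f a), f (G z) = z) ∧ ∀ᶠ x in 𝓝 a, G (f x) = x :=
  ⟨hf.hasStrictDerivAt.localInverse _ _ _ h, HasStrictFDerivAt.localInverse_apply_image ..,
    hf.analyticAt_localInverse h, (hf.hasStrictDerivAt.to_localInverse h).hasDerivAt,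
    hf.hasStrictDerivAt.eventually_right_inverse h, hf.hasStrictDerivAt.eventually_left_inverse h⟩

/-- The map f - d·id is ‖d‖/2-Lipschitz on the ball, so f expands distances by at least ‖d‖/2. A
local inverse with explicit radius is needed in order to invert the phase uniformly along an
unbounded ray. -/
theorem injOn_and_preimage_of_deriv_close {f f' : ℂ → ℂ} {d a : ℂ} {ρ : ℝ} (hd : d ≠ 0)
    (hρ : 0 < ρ) (hf : ∀ x, HasDerivAt f (f' x) x)
    (h : ∀ x ∈ ball a ρ, ‖f' x - d‖ ≤ ‖d‖ / 2) :
    InjOn f (ball a ρ) ∧ ∀ z, ‖z - f a‖ < ‖d‖ * ρ / 8 → ∃ x ∈ ball a ρ, f x = z := by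
  have key : ∀ x ∈ ball a ρ, ∀ y ∈ ball a ρ, ‖d‖ / 2 * ‖y - x‖ ≤ ‖f y - f x‖ := by
    intro x hx y hy
    have := Convex.norm_image_sub_le_of_norm_hasDerivWithin_le (f := fun z => f z - d * z)
      (f' := fun z => f' z - d) (s := ball a ρ) (C := ‖d‖ / 2)
      (fun z _ => ((hf z).sub (by simpa using (hasDerivAt_id z).const_mul d)).hasDerivWithinAt)
      h (convex_ball _ _) hx hy
    have h2 : ‖d * (y - x)‖ ≤ ‖f y - f x‖ + ‖f y - d * y - (f x - d * x)‖ := by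
      have : d * (y - x) = (f y - f x) - (f y - d * y - (f x - d * x)) := by ring
      rw [this]; exact norm_sub_le _ _
    rw [norm_mul] at h2
    linarith
  have hd' : 0 < ‖d‖ := norm_pos_iff.mpr hd
  have hinj : InjOn f (ball a ρ) := by
    intro x hx y hy hxy
    have := key x hx y hy
    rw [hxy, sub_self, norm_zero] at this
    have h0 : ‖y - x‖ ≤ 0 := by
      by_contra hc
      push Not at hc
      nlinarith [mul_pos hd' hc]
    exact (sub_eq_zero.mp (norm_le_zero_iff.mp h0)).symm
  refine ⟨hinj, fun z hz => ?_⟩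
  have hdiff : Differentiable ℂ f := fun x => (hf x).differentiableAt
  -- On the sphere of radius ρ/2 the expansion gives ‖f x - f a‖ ≥ ‖d‖ρ/4; the quantitative open
  -- mapping theorem then covers the ball of half that radius.
  have hsub := DiffContOnCl.ball_subset_image_closedBall (f := f) (z₀ := a) (r := ρ / 2)
    (ε := ‖d‖ * ρ / 4) hdiff.diffContOnCl (by positivity) (by
      intro x hx
      have hx' : ‖x - a‖ = ρ / 2 := by simpa [dist_eq_norm] using hx
      have := key a (mem_ball_self hρ) x (by rw [mem_ball, dist_eq_norm]; linarith)
      rw [hx'] at this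
      linarith) (by
      have h1 : ∀ᶠ x in 𝓝[≠] a, f x ≠ f a := by
        have : ∀ᶠ x in 𝓝[≠] a, x ∈ ball a ρ :=
          eventually_nhdsWithin_of_eventually_nhds (ball_mem_nhds a hρ)
        filter_upwards [this, self_mem_nhdsWithin] with x hx hxa hfx
        exact hxa (hinj hx (mem_ball_self hρ) hfx)
      exact h1.frequently.filter_mono nhdsWithin_le_nhds)
  obtain ⟨x, hx, hxz⟩ := hsub (show z ∈ ball (f a) (‖d‖ * ρ / 4 / 2) by
    rw [mem_ball, dist_eq_norm]; linarith)
  exact ⟨x, closedBall_subset_ball (by linarith) hx, hxz⟩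

/-- Lifts through an entire function that avoid its critical points are unique. -/
theorem eqOn_of_lift {f : ℂ → ℂ} (hf : Differentiable ℂ f) {s : Set ℝ} (hs : IsPreconnected s)
    {a b : ℝ → ℂ} (ha : ContinuousOn a s) (hb : ContinuousOn b s)
    (hab : ∀ v ∈ s, f (a v) = f (b v)) (hd : ∀ v ∈ s, deriv f (a v) ≠ 0) {x₀ : ℝ} (hx₀ : x₀ ∈ s)
    (h₀ : a x₀ = b x₀) : EqOn a b s := by
  have hopen : IsOpen {v : s | a v = b v} := by
    rw [isOpen_iff_mem_nhds]
    rintro ⟨v, hv⟩ (hveq : a v = b v)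
    obtain ⟨G, -, -, -, -, hG⟩ := exists_local_inverse (hf.analyticAt (a v)) (hd v hv)
    have h1 : ∀ᶠ x : s in 𝓝 ⟨v, hv⟩, G (f (a x)) = a x :=
      ((continuousOn_iff_continuous_domRestrict.mp ha).continuousAt (x := ⟨v, hv⟩)).eventually hG
    have h2 : ∀ᶠ x : s in 𝓝 ⟨v, hv⟩, G (f (b x)) = b x := by
      rw [hveq] at hG
      exact ((continuousOn_iff_continuous_domRestrict.mp hb).continuousAt
        (x := ⟨v, hv⟩)).eventually hG
    filter_upwards [h1, h2] with x hx1 hx2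
    rw [← hx1, ← hx2, hab x x.2]
  have hclosed : IsClosed {v : s | a v = b v} :=
    isClosed_eq (continuousOn_iff_continuous_domRestrict.mp ha)
      (continuousOn_iff_continuous_domRestrict.mp hb)
  have : PreconnectedSpace s := isPreconnected_iff_preconnectedSpace.mp hs
  have := IsClopen.eq_univ ⟨hclosed, hopen⟩ ⟨⟨x₀, hx₀⟩, h₀⟩
  intro v hv
  have : (⟨v, hv⟩ : s) ∈ {v : s | a v = b v} := by rw [this]; trivial
  exact this

/-- A bounded path along which `f` converges to a value with finite fibre converges. -/
theorem exists_tendsto_of_finite_fibre {f : ℂ → ℂ} (hf : Continuous f) {u : ℝ → ℂ} {S T M : ℝ}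
    (hST : S < T) (hu : ContinuousOn u (Ioo S T)) (hM : ∀ v ∈ Ioo S T, ‖u v‖ ≤ M) {z : ℂ}
    (hz : Tendsto (fun v => f (u v)) (𝓝[<] T) (𝓝 z)) (hfin : {x | f x = z}.Finite) :
    ∃ b, f b = z ∧ Tendsto u (𝓝[<] T) (𝓝 b) := by
  have hmem : ∀ᶠ v in 𝓝[<] T, v ∈ Ioo S T := Ioo_mem_nhdsLT hST
  obtain ⟨b, -, hb⟩ := (isCompact_closedBall (0 : ℂ) M).exists_mapClusterPt (u := u)
    (f := 𝓝[<] T) (by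
      rw [le_principal_iff, mem_map]
      filter_upwards [hmem] with v hv
      simpa using hM v hv)
  have hfb : f b = z := by
    have h1 : MapClusterPt (f b) (𝓝[<] T) (fun v => f (u v)) :=
      hb.continuousAt_comp hf.continuousAt
    by_contra hne
    have h2 := disjoint_nhds_nhds.mpr hne
    exact (h1.clusterPt.mono hz).ne' (disjoint_iff.mp h2)
  refine ⟨b, hfb, ?_⟩
  have hiso : ∀ᶠ x in 𝓝[≠] b, f x ≠ z := by
    have hc : IsClosed ({x | f x = z} \ {b}) := (hfin.subset sdiff_subset).isClosed
    have h1 := hc.isOpen_compl.mem_nhds (show b ∈ ({x | f x = z} \ {b})ᶜ by simp)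
    filter_upwards [mem_nhdsWithin_of_mem_nhds h1, self_mem_nhdsWithin] with x hx hxb hxz
    exact hx ⟨hxz, hxb⟩
  obtain ⟨ε₀, hε₀, hball⟩ := Metric.eventually_nhds_iff_ball.mp (eventually_nhdsWithin_iff.mp hiso)
  rw [Metric.tendsto_nhds]
  intro ε hε
  -- The sphere of radius δ around the cluster point b misses the fibre, so the path eventually
  -- avoids it. Being connected and entering the ball infinitely often, the tail of the path is
  -- trapped inside.
  set δ := min (ε / 2) (ε₀ / 2) with hδ
  have hδ0 : 0 < δ := by positivity
  have hsph : IsCompact (sphere b δ) := isCompact_sphere b δ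
  have hnot : ∀ᶠ v in 𝓝[<] T, u v ∉ sphere b δ := by
    have hz' : z ∉ f '' sphere b δ := by
      rintro ⟨x, hx, hxz⟩
      have hx' : dist x b = δ := hx
      refine hball x ?_ ?_ hxz
      · rw [mem_ball, hx']; exact (min_le_right _ _).trans_lt (by linarith)
      · rintro rfl; rw [dist_self] at hx'; linarith
    have h2 := (hsph.image hf).isClosed.isOpen_compl.mem_nhds hz'
    filter_upwards [hz.eventually h2] with v hv hvs
    exact hv ⟨_, hvs, rfl⟩
  obtain ⟨v₁, hv₁, hsub⟩ := mem_nhdsLT_iff_exists_Ioo_subset.mp (inter_mem hnot hmem)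
  have hv₁T : v₁ < T := hv₁
  have hfreq : ∃ᶠ v in 𝓝[<] T, u v ∈ ball b δ := hb.frequently (ball_mem_nhds b hδ0)
  obtain ⟨v₂, hv₂b, hv₂⟩ := (hfreq.and_eventually (Ioo_mem_nhdsLT hv₁T)).exists
  have himg : IsPreconnected (u '' Ioo v₁ T) :=
    isPreconnected_Ioo.image _ (hu.mono fun v hv => (hsub hv).2)
  have hin : u '' Ioo v₁ T ⊆ ball b δ := by
    refine himg.subset_left_of_subset_union isOpen_ball (isClosed_closedBall.isOpen_compl)
      (v := (closedBall b δ)ᶜ) ?_ ?_ ⟨u v₂, mem_image_of_mem _ hv₂, hv₂b⟩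
    · exact disjoint_left.mpr fun x hx hx' => hx' (ball_subset_closedBall hx)
    · rintro _ ⟨v, hv, rfl⟩
      rcases lt_trichotomy (dist (u v) b) δ with h | h | h
      · exact Or.inl h
      · exact absurd h (hsub hv).1
      · exact Or.inr (by simpa using h)
  filter_upwards [Ioo_mem_nhdsLT hv₁T] with v hv
  have := hin (mem_image_of_mem _ hv)
  rw [mem_ball] at this
  exact this.trans_le ((min_le_left _ _).trans (by linarith))

/-! ### The normalized phase -/

/-- The phase `u ^ r / r - u`, to which `w ^ r / r - t w` reduces by scaling. -/
noncomputable def nphase (r : ℕ) (u : ℂ) : ℂ := u ^ r / r - u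

theorem phase_hasDerivAt {r : ℕ} (hr : 3 ≤ r) (t w : ℂ) :
    HasDerivAt (phase r t) (w ^ (r - 1) - t) w := by
  have h0 : (r : ℂ) ≠ 0 := by simp; omega
  have h := ((hasDerivAt_pow r w).div_const (r : ℂ)).sub ((hasDerivAt_id w).const_mul t)
  refine HasDerivAt.congr_deriv h ?_
  rw [mul_one, mul_div_cancel_left₀ _ h0]

theorem phase_deriv {r : ℕ} (hr : 3 ≤ r) (t w : ℂ) : deriv (phase r t) w = w ^ (r - 1) - t :=
  (phase_hasDerivAt hr t w).deriv

theorem phase_differentiable {r : ℕ} (hr : 3 ≤ r) (t : ℂ) : Differentiable ℂ (phase r t) :=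
  fun w => (phase_hasDerivAt hr t w).differentiableAt

theorem nphase_hasDerivAt {r : ℕ} (hr : 3 ≤ r) (u : ℂ) :
    HasDerivAt (nphase r) (u ^ (r - 1) - 1) u := by
  have : nphase r = phase r 1 := by funext u; simp [nphase, phase]
  rw [this]
  exact phase_hasDerivAt hr 1 u

theorem nphase_deriv {r : ℕ} (hr : 3 ≤ r) (u : ℂ) : deriv (nphase r) u = u ^ (r - 1) - 1 :=
  (nphase_hasDerivAt hr u).deriv

theorem nphase_differentiable {r : ℕ} (hr : 3 ≤ r) : Differentiable ℂ (nphase r) :=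
  fun w => (nphase_hasDerivAt hr w).differentiableAt

theorem phase_mul {r : ℕ} (hr : 3 ≤ r) {t c : ℂ} (hc : c ^ (r - 1) = t) (u : ℂ) :
    phase r t (c * u) = c ^ r * nphase r u := by
  have : c ^ r = t * c := by rw [← hc, ← pow_succ]; congr 1; omega
  rw [phase, nphase, mul_pow, this]; ring

/-- For ‖u‖ > 2 one has ‖u‖^r/r ≥ ‖u‖ 2^(r-1)/r ≥ (4/3)‖u‖, so the leading term beats the linear one
by ‖u‖/3. This crude properness keeps lifts bounded over bounded intervals. -/
theorem norm_le_nphase {r : ℕ} (hr : 3 ≤ r) (u : ℂ) : ‖u‖ ≤ 2 + 3 * ‖nphase r u‖ := by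
  by_cases h : ‖u‖ ≤ 2
  · linarith [norm_nonneg (nphase r u)]
  push Not at h
  have hr0 : (0 : ℝ) < r := by positivity
  have h1 : ‖u‖ ^ r / r - ‖u‖ ≤ ‖nphase r u‖ := by
    have := norm_sub_norm_le (u ^ r / (r : ℂ)) u
    simpa [nphase] using this
  have hpow : ∀ n : ℕ, 3 ≤ n → 4 / 3 * (n : ℝ) ≤ 2 ^ (n - 1) := by
    intro n hn
    induction n, hn using Nat.le_induction with
    | base => norm_num
    | succ n hn ih =>
      have : (2 : ℝ) ^ (n + 1 - 1) = 2 * 2 ^ (n - 1) := by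
        rw [← pow_succ']; congr 1; omega
      rw [this]; push_cast
      have : (3 : ℝ) ≤ n := by exact_mod_cast hn
      linarith
  have h2 : ‖u‖ * 2 ^ (r - 1) ≤ ‖u‖ ^ r := by
    have : ‖u‖ ^ r = ‖u‖ * ‖u‖ ^ (r - 1) := by rw [← pow_succ']; congr 1; omega
    rw [this]; gcongr
  have h3 : ‖u‖ * (4 / 3) ≤ ‖u‖ ^ r / r := by
    rw [le_div_iff₀ hr0]
    nlinarith [hpow r hr, norm_nonneg u]
  linarith

theorem norm_nphase_le {r : ℕ} (hr : 3 ≤ r) (u : ℂ) :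
    ‖nphase r u‖ ≤ 2 * (1 + ‖u‖) ^ r := by
  have hr0 : (1 : ℝ) ≤ r := by exact_mod_cast (by omega : 1 ≤ r)
  have h1 : ‖nphase r u‖ ≤ ‖u‖ ^ r / r + ‖u‖ := by
    have := norm_sub_le (u ^ r / (r : ℂ)) u
    simpa [nphase] using this
  have h2 : ‖u‖ ^ r / r ≤ ‖u‖ ^ r := div_le_self (by positivity) hr0
  have h3 : ‖u‖ ^ r ≤ (1 + ‖u‖) ^ r := by gcongr; linarith
  have h4 : ‖u‖ ≤ (1 + ‖u‖) ^ r := by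
    calc ‖u‖ ≤ 1 + ‖u‖ := by linarith
      _ ≤ (1 + ‖u‖) ^ r := le_self_pow₀ (by linarith [norm_nonneg u]) (by omega)
  linarith

theorem nphase_one {r : ℕ} : nphase r 1 = 1 / r - 1 := by simp [nphase]

theorem nphase_fibre_finite {r : ℕ} (hr : 3 ≤ r) (z : ℂ) : {x | nphase r x = z}.Finite := by
  have hr0 : (r : ℂ) ≠ 0 := by simp; omega
  let p : Polynomial ℂ := Polynomial.X ^ r - Polynomial.C (r : ℂ) * Polynomial.X
    - Polynomial.C (r * z)
  have hp : p ≠ 0 := by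
    intro h
    have : p.coeff r = 0 := by rw [h]; simp
    have hr1 : r ≠ 1 := by omega
    simp [p, Polynomial.coeff_X, hr1.symm, show r ≠ 0 by omega] at this
  refine (p.rootSet_finite ℂ).subset ?_
  intro x hx
  have hx' : nphase r x = z := hx
  rw [Polynomial.mem_rootSet]
  refine ⟨hp, ?_⟩
  simp only [p, map_sub, map_mul, map_pow, Polynomial.aeval_X, Polynomial.aeval_C,
    Algebra.algebraMap_self, RingHom.id_apply]
  rw [← hx', nphase]
  field_simp
  ring

/-- The double zero of the phase at its critical point `1`. -/
theorem exists_factor (r : ℕ) (hr : 2 ≤ r) : ∃ S : ℂ → ℂ, Differentiable ℂ S ∧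
    S 1 = r * ((r : ℂ) - 1) / 2 ∧ ∀ u, u ^ r - r * u + (r - 1) = (u - 1) ^ 2 * S u := by
  induction r, hr using Nat.le_induction with
  | base => exact ⟨fun _ => 1, by fun_prop, by norm_num, fun u => by push_cast; ring⟩
  | succ n hn ih =>
    obtain ⟨S, hS, h1, h2⟩ := ih
    refine ⟨fun u => S u + ∑ j ∈ Finset.range n, u ^ j, by fun_prop, ?_, fun u => ?_⟩
    · simp [h1]; ring
    · have := mul_geom_sum u n
      calc u ^ (n + 1) - ((n + 1 : ℕ) : ℂ) * u + (((n + 1 : ℕ) : ℂ) - 1)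
          = (u ^ n - n * u + (n - 1)) + (u - 1) * (u ^ n - 1) := by push_cast; ring
        _ = _ := by rw [h2, ← this]; ring

theorem nphase_factor {r : ℕ} (hr : 3 ≤ r) : ∃ h : ℂ → ℂ, Differentiable ℂ h ∧
    h 1 = ((r : ℂ) - 1) / 2 ∧ ∀ u, nphase r 1 - nphase r u = -(u - 1) ^ 2 * h u := by
  obtain ⟨S, hS, h1, h2⟩ := exists_factor r (by omega)
  have hr0 : (r : ℂ) ≠ 0 := by simp; omega
  refine ⟨fun u => S u / r, hS.div_const _, by simp only [h1]; field_simp, fun u => ?_⟩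
  have := h2 u
  rw [nphase_one, nphase]
  field_simp
  linear_combination (-1 : ℂ) * this

/-- At a nondegenerate critical point both sides vanish to second order. The estimate is what makes
the flow take infinite time to reach or leave the critical point. -/
theorem nphase_deriv_sq_le {r : ℕ} (hr : 3 ≤ r) : ∃ C : ℝ, 0 < C ∧ ∀ᶠ u in 𝓝 (1 : ℂ),
    ‖deriv (nphase r) u‖ ^ 2 ≤ C * ‖nphase r u - nphase r 1‖ := by
  obtain ⟨h, hd, h1, hfac⟩ := nphase_factor hr
  have hr1 : (r : ℝ) - 1 ≥ 2 := by
    have : (3 : ℝ) ≤ r := by exact_mod_cast hr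
    linarith
  have hgeom : Tendsto (fun u : ℂ => ‖∑ j ∈ Finset.range (r - 1), u ^ j‖ ^ 2) (𝓝 1)
      (𝓝 (‖∑ j ∈ Finset.range (r - 1), (1 : ℂ) ^ j‖ ^ 2)) := by
    apply Continuous.tendsto (by fun_prop)
  have hh : Tendsto (fun u : ℂ => ‖h u‖) (𝓝 1) (𝓝 ‖h 1‖) := (hd.continuous.norm).tendsto 1
  have hh1 : 1 / 2 < ‖h 1‖ := by
    have : h 1 = (((r : ℝ) - 1) / 2 : ℝ) := by rw [h1]; push_cast; ring
    rw [this, Complex.norm_of_nonneg (by linarith)]; linarith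
  set K := ‖∑ j ∈ Finset.range (r - 1), (1 : ℂ) ^ j‖ ^ 2 with hK
  refine ⟨2 * (K + 1), by positivity, ?_⟩
  filter_upwards [hgeom.eventually_lt_const (lt_add_one K), hh.eventually_const_lt hh1]
    with u hu1 hu2
  rw [nphase_deriv hr, ← mul_geom_sum u (r - 1), norm_mul, mul_pow]
  have : nphase r u - nphase r 1 = (u - 1) ^ 2 * h u := by linear_combination -hfac u
  rw [this, norm_mul, norm_pow]
  have h3 : 0 ≤ ‖u - 1‖ ^ 2 := by positivity
  nlinarith [mul_le_mul_of_nonneg_left hu1.le h3, mul_le_mul_of_nonneg_left hu2.le h3,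
    mul_nonneg h3 (show 0 ≤ K by positivity),
    mul_nonneg (mul_nonneg h3 (show 0 ≤ K + 1 by positivity)) (sub_nonneg.2 hu2.le)]

/-- Scaling by b sends any critical point b of the phase to 1, so the normalized estimate serves
both ends of a Stokes line. -/
theorem phase_deriv_sq_le {r : ℕ} (hr : 3 ≤ r) {t b : ℂ} (ht : t ≠ 0) (hb : b ^ (r - 1) = t) :
    ∃ C : ℝ, 0 < C ∧ ∀ᶠ w in 𝓝 b,
      ‖deriv (phase r t) w‖ ^ 2 ≤ C * ‖phase r t w - phase r t b‖ := by
  obtain ⟨C, hC, h⟩ := nphase_deriv_sq_le hr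
  have hb0 : b ≠ 0 := by
    rintro rfl
    rw [zero_pow (by omega)] at hb
    exact ht hb.symm
  have hbn : 0 < ‖b‖ := norm_pos_iff.mpr hb0
  refine ⟨C * ‖t‖ ^ 2 / ‖b ^ r‖, by
    have := norm_pos_iff.mpr ht
    have : 0 < ‖b ^ r‖ := norm_pos_iff.mpr (pow_ne_zero _ hb0)
    positivity, ?_⟩
  have htend : Tendsto (fun w : ℂ => w / b) (𝓝 b) (𝓝 1) := by
    have : Tendsto (fun w : ℂ => w / b) (𝓝 b) (𝓝 (b / b)) := tendsto_id.div_const b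
    rwa [div_self hb0] at this
  filter_upwards [htend.eventually h] with w hw
  have e1 : phase r t w - phase r t b = b ^ r * (nphase r (w / b) - nphase r 1) := by
    have h1 := phase_mul hr hb (w / b)
    have h2 := phase_mul hr hb 1
    rw [mul_div_cancel₀ _ hb0] at h1
    rw [mul_one] at h2
    rw [h1, h2]; ring
  have e2 : deriv (phase r t) w = t * deriv (nphase r) (w / b) := by
    rw [phase_deriv hr, nphase_deriv hr, div_pow, hb]; field_simp
  rw [e1, e2, norm_mul, norm_mul, mul_pow]
  calc ‖t‖ ^ 2 * ‖deriv (nphase r) (w / b)‖ ^ 2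
      ≤ ‖t‖ ^ 2 * (C * ‖nphase r (w / b) - nphase r 1‖) := by gcongr
    _ = _ := by
      have : ‖b ^ r‖ ≠ 0 := by simp [hb0]
      field_simp

/-- `U'(0)` for the branch `U` of the inverse of the phase at the critical point. -/
noncomputable def kappa (r : ℕ) : ℂ := Complex.I * (Real.sqrt (2 / ((r : ℝ) - 1)) : ℂ)

theorem kappa_sq {r : ℕ} (hr : 3 ≤ r) : kappa r ^ 2 = -2 / ((r : ℂ) - 1) := by
  have hr1 : (3 : ℝ) ≤ r := by exact_mod_cast hr
  rw [kappa, mul_pow, Complex.I_sq, ← Complex.ofReal_pow, Real.sq_sqrt (by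
    apply div_nonneg <;> linarith)]
  push_cast; ring

theorem kappa_ne_zero {r : ℕ} (hr : 3 ≤ r) : kappa r ≠ 0 := by
  intro h
  have := kappa_sq hr
  rw [h] at this
  have hr1 : (r : ℂ) - 1 ≠ 0 := by
    rw [sub_ne_zero]; exact_mod_cast (by omega : r ≠ 1)
  field_simp at this
  simp at this

/-- The germ at `0` of the branch. -/
theorem exists_germ {r : ℕ} (hr : 3 ≤ r) : ∃ (U : ℂ → ℂ) (ε : ℝ), 0 < ε ∧
    (∀ ζ ∈ ball (0 : ℂ) ε, DifferentiableAt ℂ U ζ) ∧ U 0 = 1 ∧ deriv U 0 = kappa r ∧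
    ∀ ζ ∈ ball (0 : ℂ) ε, nphase r (U ζ) = nphase r 1 - ζ ^ 2 := by
  obtain ⟨h, hd, h1, hfac⟩ := nphase_factor hr
  have hr1 : (r : ℂ) - 1 ≠ 0 := by
    rw [sub_ne_zero]; exact_mod_cast (by omega : r ≠ 1)
  have hκ := kappa_ne_zero hr
  -- Since κ^(-2) = -(r-1)/2 = -h(1), the function ψ = (u - 1) y is a holomorphic square root of -(u
  -- - 1)^2 h(u) = g(1) - g(u). The quotient h(u)/h(1) is close to 1, hence in the domain of the
  -- principal logarithm. The germ U is the local inverse of ψ.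
  let y : ℂ → ℂ := fun u => (kappa r)⁻¹ * Complex.exp (Complex.log (h u / h 1) / 2)
  let ψ : ℂ → ℂ := fun u => (u - 1) * y u
  have hh1 : h 1 ≠ 0 := by rw [h1]; simpa using hr1
  have hslit : h 1 / h 1 ∈ Complex.slitPlane := by rw [div_self hh1]; simp
  have han : AnalyticAt ℂ (fun u => h u / h 1) 1 := (hd.analyticAt 1).div_const
  have hy : AnalyticAt ℂ y 1 := by
    have := (han.clog hslit).div_const (c := 2)
    exact analyticAt_const.mul this.cexp
  have hψ : AnalyticAt ℂ ψ 1 := (analyticAt_id.sub analyticAt_const).mul hy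
  have hy1 : y 1 = (kappa r)⁻¹ := by simp [y, div_self hh1]
  have hψ' : deriv ψ 1 = (kappa r)⁻¹ := by
    have := ((hasDerivAt_id (1 : ℂ)).sub_const 1).mul hy.differentiableAt.hasDerivAt
    have h2 := this.deriv
    simp only [id, sub_self, zero_mul, add_zero, one_mul, hy1] at h2
    exact h2
  have hψ1 : ψ 1 = 0 := by simp [ψ]
  obtain ⟨U, hU1, hU2, hU3, hU4, -⟩ := exists_local_inverse hψ (by rw [hψ']; exact inv_ne_zero hκ)
  rw [hψ1] at hU1 hU2 hU3 hU4
  have hU0 : Tendsto U (𝓝 0) (𝓝 1) := by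
    have := hU2.continuousAt.tendsto
    rwa [hU1] at this
  have hne : ∀ᶠ u in 𝓝 (1 : ℂ), h u ≠ 0 := hd.continuous.continuousAt.eventually_ne hh1
  have hev : ∀ᶠ ζ in 𝓝 (0 : ℂ), DifferentiableAt ℂ U ζ ∧
      nphase r (U ζ) = nphase r 1 - ζ ^ 2 := by
    filter_upwards [hU2.eventually_analyticAt, hU4, hU0.eventually hne] with ζ ha hz hn
    refine ⟨ha.differentiableAt, ?_⟩
    have hsq : ζ ^ 2 = -(U ζ - 1) ^ 2 * h (U ζ) := by
      have hyy : y (U ζ) ^ 2 = (kappa r ^ 2)⁻¹ * (h (U ζ) / h 1) := by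
        simp only [y]
        rw [mul_pow, ← Complex.exp_nat_mul]
        congr 1
        · rw [inv_pow]
        · have : ((2 : ℕ) : ℂ) * (Complex.log (h (U ζ) / h 1) / 2)
            = Complex.log (h (U ζ) / h 1) := by push_cast; ring
          rw [this, Complex.exp_log (div_ne_zero hn hh1)]
      calc ζ ^ 2 = (ψ (U ζ)) ^ 2 := by rw [hz]
        _ = (U ζ - 1) ^ 2 * y (U ζ) ^ 2 := by simp only [ψ]; ring
        _ = _ := by
          rw [hyy, kappa_sq hr, h1]; field_simp
    rw [hsq, ← hfac]; ring
  obtain ⟨ε, hε, hball⟩ := Metric.eventually_nhds_iff_ball.mp hev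
  refine ⟨U, ε, hε, fun ζ hζ => (hball ζ hζ).1, hU1, ?_, fun ζ hζ => (hball ζ hζ).2⟩
  rw [hU3.deriv, hψ', inv_inv]

end HyperAiry

namespace HyperAiry
open Set Metric

/-! ### Continuation of the branch along a ray -/

/-- `u` continues the germ `U₀` along `[0, T) β` without meeting a critical point. -/
structure IsRayLift (r : ℕ) (U₀ : ℂ → ℂ) (ε : ℝ) (β : ℂ) (T : ℝ) (u : ℝ → ℂ) : Prop where
  cont : ContinuousOn u (Ico 0 T)
  lift : ∀ v ∈ Ico 0 T, nphase r (u v) = nphase r 1 - (v * β) ^ 2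
  germ : ∀ v ∈ Ico 0 T, ‖(v : ℂ) * β‖ < ε → u v = U₀ (v * β)
  noncrit : ∀ v ∈ Ioo 0 T, deriv (nphase r) (u v) ≠ 0

/-- `U` is holomorphic on the ball of radius `ε` and inverts the phase there. -/
structure IsGerm (r : ℕ) (U₀ : ℂ → ℂ) (ε : ℝ) : Prop where
  pos : 0 < ε
  diff : ∀ ζ ∈ ball (0 : ℂ) ε, DifferentiableAt ℂ U₀ ζ
  zero : U₀ 0 = 1
  deriv_zero : deriv U₀ 0 = kappa r
  eq : ∀ ζ ∈ ball (0 : ℂ) ε, nphase r (U₀ ζ) = nphase r 1 - ζ ^ 2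

theorem deriv_mul_of_lift {r : ℕ} (hr : 3 ≤ r) {U : ℂ → ℂ} {ζ : ℂ} (hU : DifferentiableAt ℂ U ζ)
    (h : ∀ᶠ z in 𝓝 ζ, nphase r (U z) = nphase r 1 - z ^ 2) :
    (U ζ ^ (r - 1) - 1) * deriv U ζ = -2 * ζ := by
  have h1 := (nphase_hasDerivAt hr (U ζ)).comp ζ hU.hasDerivAt
  have h2 : HasDerivAt (fun z : ℂ => nphase r 1 - z ^ 2) (-(2 * ζ)) ζ := by
    simpa using (hasDerivAt_pow 2 ζ).const_sub (nphase r 1)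
  have h3 := h1.unique (h2.congr_of_eventuallyEq h)
  rw [h3]; ring

/-- In g'(U)·U' = -2ζ the right-hand side vanishes only at ζ = 0. -/
theorem IsGerm.noncrit {r : ℕ} (hr : 3 ≤ r) {U₀ : ℂ → ℂ} {ε : ℝ} (hU : IsGerm r U₀ ε) {ζ : ℂ}
    (hζ : ζ ∈ ball 0 ε) (h0 : ζ ≠ 0) : deriv (nphase r) (U₀ ζ) ≠ 0 := by
  have := deriv_mul_of_lift hr (hU.diff ζ hζ)
    (eventually_of_mem (isOpen_ball.mem_nhds hζ) hU.eq)
  rw [nphase_deriv hr]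
  intro h
  rw [h, zero_mul] at this
  exact h0 (by simpa using this.symm)

section
variable {r : ℕ} {U₀ : ℂ → ℂ} {ε : ℝ} {β : ℂ}

theorem IsRayLift.mono {T T' : ℝ} {u : ℝ → ℂ} (h : IsRayLift r U₀ ε β T u) (hT : T' ≤ T) :
    IsRayLift r U₀ ε β T' u where
  cont := h.cont.mono (Ico_subset_Ico_right hT)
  lift v hv := h.lift v (Ico_subset_Ico_right hT hv)
  germ v hv := h.germ v (Ico_subset_Ico_right hT hv)
  noncrit v hv := h.noncrit v (Ioo_subset_Ioo_right hT hv)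

theorem IsRayLift.congr {T : ℝ} {u u' : ℝ → ℂ} (h : IsRayLift r U₀ ε β T u)
    (he : EqOn u' u (Ico 0 T)) : IsRayLift r U₀ ε β T u' where
  cont := h.cont.congr he
  lift v hv := by rw [he hv, h.lift v hv]
  germ v hv := by rw [he hv]; exact h.germ v hv
  noncrit v hv := by rw [he (Ioo_subset_Ico_self hv)]; exact h.noncrit v hv

theorem IsRayLift.of_forall_lt {T : ℝ} {u : ℝ → ℂ}
    (h : ∀ T', 0 < T' → T' < T → IsRayLift r U₀ ε β T' u) : IsRayLift r U₀ ε β T u := by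
  have key : ∀ v ∈ Ico 0 T, ∃ T', 0 < T' ∧ T' < T ∧ v < T' := fun v hv =>
    ⟨(v + T) / 2, by linarith [hv.1, hv.2], by linarith [hv.2], by linarith [hv.2]⟩
  refine ⟨fun v hv => ?_, fun v hv => ?_, fun v hv => ?_, fun v hv => ?_⟩
  · obtain ⟨T', h1, h2, h3⟩ := key v hv
    refine ((h T' h1 h2).cont v ⟨hv.1, h3⟩).mono_of_mem_nhdsWithin ?_
    rw [mem_nhdsWithin]
    exact ⟨Iio T', isOpen_Iio, h3, fun x hx => ⟨hx.2.1, hx.1⟩⟩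
  · obtain ⟨T', h1, h2, h3⟩ := key v hv
    exact (h T' h1 h2).lift v ⟨hv.1, h3⟩
  · obtain ⟨T', h1, h2, h3⟩ := key v hv
    exact (h T' h1 h2).germ v ⟨hv.1, h3⟩
  · obtain ⟨T', h1, h2, h3⟩ := key v (Ioo_subset_Ico_self hv)
    exact (h T' h1 h2).noncrit v ⟨hv.1, h3⟩

/-- Lifts are unique away from critical points, but v = 0 lies over one. There the germ condition
replaces uniqueness: both lifts agree at a small x₀ > 0, and the connected interval (0, T) carries
the equality on. -/
theorem IsRayLift.eqOn (hr : 3 ≤ r) (hβ : β ≠ 0) (hε : 0 < ε) {T T' : ℝ} {u u' : ℝ → ℂ}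
    (h : IsRayLift r U₀ ε β T u) (h' : IsRayLift r U₀ ε β T' u') (hT : T ≤ T') :
    EqOn u u' (Ico 0 T) := by
  have h' := h'.mono hT
  intro v hv
  rcases hv.1.eq_or_lt with rfl | h0
  · rw [h.germ 0 hv (by simpa using hε), h'.germ 0 hv (by simpa using hε)]
  have hβ' : 0 < ‖β‖ := norm_pos_iff.mpr hβ
  set x₀ := min (T / 2) (ε / (2 * ‖β‖)) with hx₀
  have hT0 : 0 < T := h0.trans hv.2
  have hx0 : 0 < x₀ := by positivity
  have hxT : x₀ < T := (min_le_left _ _).trans_lt (by linarith)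
  have hxε : ‖(x₀ : ℂ) * β‖ < ε := by
    rw [norm_mul, Complex.norm_of_nonneg hx0.le]
    calc x₀ * ‖β‖ ≤ ε / (2 * ‖β‖) * ‖β‖ := by gcongr; exact min_le_right _ _
      _ = ε / 2 := by field_simp
      _ < ε := by linarith
  refine eqOn_of_lift (nphase_differentiable hr) isPreconnected_Ioo
    (h.cont.mono Ioo_subset_Ico_self) (h'.cont.mono Ioo_subset_Ico_self) (fun v hv => ?_)
    h.noncrit ⟨hx0, hxT⟩ ?_ ⟨h0, hv.2⟩
  · rw [h.lift v (Ioo_subset_Ico_self hv), h'.lift v (Ioo_subset_Ico_self hv)]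
  · rw [h.germ x₀ ⟨hx0.le, hxT⟩ hxε, h'.germ x₀ ⟨hx0.le, hxT⟩ hxε]

/-- The bound ε ≤ T‖β‖ records that the germ is already used up on [0, T), so that later extensions
satisfy the germ condition vacuously. -/
theorem IsGerm.exists_isRayLift (hr : 3 ≤ r) (hβ : β ≠ 0) (hU : IsGerm r U₀ ε) :
    ∃ T > 0, ε ≤ T * ‖β‖ ∧ IsRayLift r U₀ ε β T (fun v => U₀ (v * β)) := by
  have hβ' : 0 < ‖β‖ := norm_pos_iff.mpr hβ
  have hε := hU.pos
  have hmem : ∀ v ∈ Ico 0 (ε / ‖β‖), (v : ℂ) * β ∈ ball (0 : ℂ) ε := by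
    intro v hv
    rw [mem_ball_zero_iff, norm_mul, Complex.norm_of_nonneg hv.1]
    exact (lt_div_iff₀ hβ').mp hv.2
  refine ⟨ε / ‖β‖, by positivity, (div_mul_cancel₀ _ hβ'.ne').ge, fun v hv => ?_, fun v hv => hU.eq _ (hmem v hv),
    fun v hv _ => rfl, fun v hv => hU.noncrit hr (hmem v (Ioo_subset_Ico_self hv)) ?_⟩
  · have h1 := (hU.diff _ (hmem v hv)).continuousAt
    have h2 : ContinuousAt (fun v : ℝ => (v : ℂ) * β) v := by fun_prop
    exact (h1.comp_of_eq h2 rfl).continuousWithinAt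
  · exact mul_ne_zero (by exact_mod_cast hv.1.ne') hβ

/-- A lift on `[0, T)` converging to a point that is not critical extends beyond `T`. -/
theorem IsRayLift.extend (hr : 3 ≤ r) {T : ℝ} (hT : 0 < T) {u : ℝ → ℂ}
    (h : IsRayLift r U₀ ε β T u) (hεT : ε ≤ T * ‖β‖) {b : ℂ} (hb : Tendsto u (𝓝[<] T) (𝓝 b))
    (hbT : nphase r b = nphase r 1 - (T * β) ^ 2) (hb0 : deriv (nphase r) b ≠ 0) :
    ∃ T' > T, ∃ u', IsRayLift r U₀ ε β T' u' := by
  obtain ⟨G, hG1, hG2, -, hG4, hG5⟩ :=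
    exists_local_inverse ((nphase_differentiable hr).analyticAt b) hb0
  set e : ℝ → ℂ := fun v => nphase r 1 - (v * β) ^ 2 with he
  have hec : Continuous e := by fun_prop
  have heT : e T = nphase r b := hbT.symm
  have het : Tendsto e (𝓝 T) (𝓝 (nphase r b)) := by rw [← heT]; exact hec.tendsto T
  have hGe : ContinuousAt (fun v => G (e v)) T := by
    apply ContinuousAt.comp_of_eq hG2.continuousAt hec.continuousAt heT
  have hdc : Continuous (deriv (nphase r)) := by
    have : deriv (nphase r) = fun u => u ^ (r - 1) - 1 := funext (nphase_deriv hr)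
    rw [this]; fun_prop
  have hGT : G (e T) = b := by rw [heT, hG1]
  have hev : ∀ᶠ v in 𝓝 T, ContinuousAt (fun v => G (e v)) v ∧ nphase r (G (e v)) = e v ∧
      deriv (nphase r) (G (e v)) ≠ 0 := by
    have h1 : ∀ᶠ v in 𝓝 T, ContinuousAt (fun v => G (e v)) v := by
      filter_upwards [het.eventually hG2.eventually_analyticAt] with v hv
      exact ContinuousAt.comp_of_eq hv.continuousAt hec.continuousAt rfl
    have h2 : ∀ᶠ v in 𝓝 T, deriv (nphase r) (G (e v)) ≠ 0 := by
      have : ContinuousAt (fun v => deriv (nphase r) (G (e v))) T :=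
        ContinuousAt.comp_of_eq hdc.continuousAt hGe rfl
      exact this.eventually_ne (by rw [hGT]; exact hb0)
    filter_upwards [h1, het.eventually hG4, h2] with v a b c using ⟨a, b, c⟩
  have hleft : ∀ᶠ v in 𝓝[<] T, G (e v) = u v := by
    filter_upwards [hb.eventually hG5, Ioo_mem_nhdsLT hT] with v hv hvT
    rw [← hv, h.lift v (Ioo_subset_Ico_self hvT)]
  obtain ⟨δ, hδ, hball⟩ := Metric.eventually_nhds_iff_ball.mp hev
  obtain ⟨l, hl, hlT⟩ := mem_nhdsLT_iff_exists_Ioo_subset.mp hleft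
  have hlT' : l < T := hl
  -- The two formulas coincide on (l, T), so continuity at T is inherited from the local inverse G.
  set u' : ℝ → ℂ := fun v => if v < T then u v else G (e v) with hu'
  have hu1 : ∀ v, v < T → u' v = u v := fun v hv => by simp [hu', hv]
  have hu2 : ∀ v, l < v → u' v = G (e v) := fun v hv => by
    by_cases hvT : v < T
    · rw [hu1 v hvT]; exact (hlT ⟨hv, hvT⟩).symm
    · simp [hu', hvT]
  have hin : ∀ v, T ≤ v → v < T + δ → v ∈ ball T δ := fun v h1 h2 => by
    rw [mem_ball, Real.dist_eq, abs_lt]; constructor <;> linarith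
  refine ⟨T + δ, by linarith, u', fun v hv => ?_, fun v hv => ?_, fun v hv hvε => ?_,
    fun v hv => ?_⟩
  · by_cases hvT : v < T
    · have h1 : ContinuousWithinAt u (Ico 0 T) v := h.cont v ⟨hv.1, hvT⟩
      have h2 : ContinuousWithinAt u (Ico 0 (T + δ)) v :=
        h1.mono_of_mem_nhdsWithin (mem_nhdsWithin.mpr
          ⟨Iio T, isOpen_Iio, hvT, fun x hx => ⟨hx.2.1, hx.1⟩⟩)
      refine h2.congr_of_eventuallyEq ?_ (hu1 v hvT)
      filter_upwards [mem_nhdsWithin_of_mem_nhds (Iio_mem_nhds hvT)] with x hx using hu1 x hx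
    · push Not at hvT
      refine ContinuousAt.continuousWithinAt ?_
      refine (hball v (hin v hvT hv.2)).1.congr ?_
      filter_upwards [Ioi_mem_nhds (hlT'.trans_le hvT)] with x hx using (hu2 x hx).symm
  · by_cases hvT : v < T
    · rw [hu1 v hvT]; exact h.lift v ⟨hv.1, hvT⟩
    · push Not at hvT
      rw [hu2 v (hlT'.trans_le hvT)]; exact (hball v (hin v hvT hv.2)).2.1
  · have hvT : v < T := by
      by_contra hc
      push Not at hc
      rw [norm_mul, Complex.norm_of_nonneg hv.1] at hvε
      have := mul_le_mul_of_nonneg_right hc (norm_nonneg β)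
      linarith
    rw [hu1 v hvT]; exact h.germ v ⟨hv.1, hvT⟩ hvε
  · by_cases hvT : v < T
    · rw [hu1 v hvT]; exact h.noncrit v ⟨hv.1, hvT⟩
    · push Not at hvT
      rw [hu2 v (hlT'.trans_le hvT)]; exact (hball v (hin v hvT hv.2)).2.2

/-- The branch continues along the whole ray unless it runs into a critical point. -/
theorem IsGerm.ray_dichotomy (hr : 3 ≤ r) (hβ : β ≠ 0) (hU : IsGerm r U₀ ε) :
    (∃ u, ∀ T, IsRayLift r U₀ ε β T u) ∨
      ∃ T > 0, ∃ u b, IsRayLift r U₀ ε β T u ∧ deriv (nphase r) b = 0 ∧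
        nphase r b = nphase r 1 - (T * β) ^ 2 ∧ Tendsto u (𝓝[<] T) (𝓝 b) := by
  classical
  have hε := hU.pos
  -- All lifts are glued into one function; uniqueness of lifts makes the choice irrelevant, and the
  -- value 0 outside is never used.
  let w : ℝ → ℂ := fun v =>
    if h : ∃ T u, v < T ∧ IsRayLift r U₀ ε β T u then h.choose_spec.choose v else 0
  have hw : ∀ T u, IsRayLift r U₀ ε β T u → IsRayLift r U₀ ε β T w := by
    intro T u h
    refine h.congr fun v hv => ?_
    have hex : ∃ T u, v < T ∧ IsRayLift r U₀ ε β T u := ⟨T, u, hv.2, h⟩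
    simp only [w, dif_pos hex]
    obtain ⟨h1, h2⟩ := hex.choose_spec.choose_spec
    rcases le_total T hex.choose with hle | hle
    · exact (h.eqOn hr hβ hε h2 hle hv).symm
    · exact h2.eqOn hr hβ hε h hle ⟨hv.1, h1⟩
  by_cases hall : ∀ T > 0, ∃ u, IsRayLift r U₀ ε β T u
  · left
    refine ⟨w, fun T => ?_⟩
    obtain ⟨u, hu⟩ := hall (max T 1) (by positivity)
    exact (hw _ u hu).mono (le_max_left _ _)
  right
  push Not at hall
  obtain ⟨T₁, hT₁, hno⟩ := hall
  let A : Set ℝ := {T | 0 < T ∧ IsRayLift r U₀ ε β T w}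
  obtain ⟨T₀, hT₀, hεT₀, hl₀⟩ := hU.exists_isRayLift hr hβ
  have hA₀ : T₀ ∈ A := ⟨hT₀, hw _ _ hl₀⟩
  have hbdd : BddAbove A := ⟨T₁, fun T hT => by
    by_contra hc
    push Not at hc
    exact hno w (hT.2.mono hc.le)⟩
  -- T is the maximal time of existence. The lift converges as v → T, and a noncritical limit would
  -- extend it past the supremum.
  set T := sSup A with hTdef
  have hT0 : 0 < T := hT₀.trans_le (le_csSup hbdd hA₀)
  have hlift : IsRayLift r U₀ ε β T w := by
    refine IsRayLift.of_forall_lt fun T' h0 h1 => ?_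
    obtain ⟨T'', hT'', hlt⟩ := exists_lt_of_lt_csSup ⟨T₀, hA₀⟩ h1
    exact hT''.2.mono hlt.le
  have hle : ∀ T' u, 0 < T' → IsRayLift r U₀ ε β T' u → T' ≤ T := fun T' u h0 h =>
    le_csSup hbdd ⟨h0, hw _ _ h⟩
  have hec : Continuous (fun v : ℝ => nphase r 1 - (v * β) ^ 2) := by fun_prop
  obtain ⟨b, hb1, hb2⟩ := exists_tendsto_of_finite_fibre (f := nphase r) (u := w) (T := T)
    (z := nphase r 1 - (T * β) ^ 2)
    (M := 2 + 3 * (‖nphase r 1‖ + (T * ‖β‖) ^ 2)) (nphase_differentiable hr).continuous hT0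
    (hlift.cont.mono Ioo_subset_Ico_self) (fun v hv => by
      refine (norm_le_nphase hr _).trans ?_
      rw [hlift.lift v (Ioo_subset_Ico_self hv)]
      have h1 : ‖((v : ℂ) * β) ^ 2‖ ≤ (T * ‖β‖) ^ 2 := by
        rw [norm_pow, norm_mul, Complex.norm_of_nonneg hv.1.le]
        have := hv.1
        have := hv.2.le
        gcongr
      have := norm_sub_le (nphase r 1) (((v : ℂ) * β) ^ 2)
      linarith) (by
      refine ((hec.tendsto T).mono_left nhdsWithin_le_nhds).congr' ?_
      filter_upwards [Ioo_mem_nhdsLT hT0] with v hv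
      exact (hlift.lift v (Ioo_subset_Ico_self hv)).symm) (nphase_fibre_finite hr _)
  refine ⟨T, hT0, w, b, hlift, ?_, hb1, hb2⟩
  by_contra hb0
  obtain ⟨T', hT', u', hu'⟩ := hlift.extend hr hT0 (hεT₀.trans
    (mul_le_mul_of_nonneg_right (le_csSup hbdd hA₀) (norm_nonneg β))) hb2 hb1 hb0
  exact absurd (hle T' u' (hT0.trans hT') hu') (not_le.mpr hT')

end

end HyperAiry

namespace HyperAiry
open Set Metric

/-! ### Extension of the branch to a sector -/

theorem norm_pow_sub_pow_le {x y : ℂ} {M : ℝ} (hx : ‖x‖ ≤ M) (hy : ‖y‖ ≤ M) (n : ℕ) :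
    ‖x ^ (n + 1) - y ^ (n + 1)‖ ≤ (n + 1) * M ^ n * ‖x - y‖ := by
  have hM : 0 ≤ M := (norm_nonneg x).trans hx
  induction n with
  | zero => simp
  | succ n ih =>
    have e : x ^ (n + 1 + 1) - y ^ (n + 1 + 1)
        = x * (x ^ (n + 1) - y ^ (n + 1)) + (x - y) * y ^ (n + 1) := by ring
    rw [e]
    calc _ ≤ ‖x‖ * ‖x ^ (n + 1) - y ^ (n + 1)‖ + ‖x - y‖ * ‖y‖ ^ (n + 1) := by
          refine (norm_add_le _ _).trans ?_
          rw [norm_mul, norm_mul, norm_pow]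
      _ ≤ M * ((n + 1) * M ^ n * ‖x - y‖) + ‖x - y‖ * M ^ (n + 1) := by gcongr
      _ = _ := by push_cast; ring

section
variable {r : ℕ} {U₀ : ℂ → ℂ} {ε : ℝ} {β : ℂ}

theorem norm_nphase_one_le (hr : 3 ≤ r) : ‖nphase r 1‖ ≤ 1 := by
  have h1 : (3 : ℝ) ≤ r := by exact_mod_cast hr
  have : nphase r 1 = ((1 / (r : ℝ) - 1 : ℝ) : ℂ) := by rw [nphase_one]; push_cast; ring
  rw [this, Complex.norm_real, Real.norm_eq_abs, abs_le]
  have h2 : (1 : ℝ) / r ≤ 1 := by rw [div_le_one (by positivity)]; linarith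
  have h3 : (0 : ℝ) ≤ 1 / r := by positivity
  constructor <;> linarith

/-- On a compact interval g' does not vanish along the lift; for large v the equation forces u to be
large, where u^(r-1) dominates. The bound has the natural homogeneity, which later permits an
opening angle independent of v. -/
theorem exists_noncrit_bound (hr : 3 ≤ r) (hβ : β ≠ 0) {u : ℝ → ℂ}
    (hu : ∀ T, IsRayLift r U₀ ε β T u) {v₀ : ℝ} (hv₀ : 0 < v₀) :
    ∃ m > 0, ∀ v, v₀ ≤ v → m * (1 + ‖u v‖) ^ (r - 1) ≤ ‖u v ^ (r - 1) - 1‖ := by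
  have hβ' : 0 < ‖β‖ := norm_pos_iff.mpr hβ
  -- If ‖u v‖ < 2, then ‖g(u v)‖ ≤ 2·3^r, whence (v‖β‖)^2 ≤ 2·3^r + 1; this fails for v > V.
  set V : ℝ := (2 * 3 ^ r + 2) / ‖β‖ with hV
  have hbig : ∀ v, V < v → 2 ≤ ‖u v‖ := by
    intro v hv
    by_contra hc
    push Not at hc
    have hV0 : 0 < V := by positivity
    have h1 := (hu (v + 1)).lift v ⟨(hV0.trans hv).le, by linarith⟩
    have h2 := norm_nphase_le hr (u v)
    have h3 : (1 + ‖u v‖) ^ r ≤ 3 ^ r := by gcongr; linarith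
    have h4 : ‖((v : ℂ) * β) ^ 2‖ ≤ ‖nphase r (u v)‖ + ‖nphase r 1‖ := by
      have : ((v : ℂ) * β) ^ 2 = nphase r 1 - nphase r (u v) := by rw [h1]; ring
      rw [this]
      exact (norm_sub_le _ _).trans (by linarith)
    rw [norm_pow, norm_mul, Complex.norm_of_nonneg (hV0.trans hv).le] at h4
    have h5 : 2 * 3 ^ r + 2 < v * ‖β‖ := (div_lt_iff₀ hβ').mp hv
    have h6 := norm_nphase_one_le hr
    have h7 : (1 : ℝ) ≤ 3 ^ r := one_le_pow₀ (by norm_num)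
    nlinarith
  have hcont : ContinuousOn (fun v => ‖u v ^ (r - 1) - 1‖ / (1 + ‖u v‖) ^ (r - 1)) (Icc v₀ V) := by
    have huc : ContinuousOn u (Icc v₀ V) := (hu (V + 1)).cont.mono fun v hv =>
      ⟨hv₀.le.trans hv.1, by linarith [hv.2]⟩
    refine ContinuousOn.div (by fun_prop) (by fun_prop) fun v _ => ?_
    have := norm_nonneg (u v)
    positivity
  obtain ⟨m₁, hm₁, hm₁'⟩ : ∃ m > 0, ∀ v ∈ Icc v₀ V,
      m ≤ ‖u v ^ (r - 1) - 1‖ / (1 + ‖u v‖) ^ (r - 1) := by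
    by_cases hne : (Icc v₀ V).Nonempty
    · obtain ⟨x, hx, hmin⟩ := isCompact_Icc.exists_isMinOn hne hcont
      refine ⟨_, ?_, fun v hv => hmin hv⟩
      have h1 := (hu (V + 1)).noncrit x ⟨hv₀.trans_le hx.1, by linarith [hx.2]⟩
      rw [nphase_deriv hr] at h1
      have h2 := norm_pos_iff.mpr h1
      have := norm_nonneg (u x)
      positivity
    · exact ⟨1, one_pos, fun v hv => absurd ⟨v, hv⟩ hne⟩
  -- For ‖u‖ ≥ 2 one has (2/3)(1 + ‖u‖) ≤ ‖u‖, and subtracting 1 costs at most half of ‖u‖^(r-1).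
  refine ⟨min m₁ (1 / 2 * (2 / 3) ^ (r - 1)), by positivity, fun v hv => ?_⟩
  have hR : 0 < (1 + ‖u v‖) ^ (r - 1) := by have := norm_nonneg (u v); positivity
  by_cases hvV : v ≤ V
  · calc _ ≤ m₁ * (1 + ‖u v‖) ^ (r - 1) := by gcongr; exact min_le_left _ _
      _ ≤ _ := (le_div_iff₀ hR).mp (hm₁' v ⟨hv, hvV⟩)
  · push Not at hvV
    have h2 := hbig v hvV
    have h3 : (2 : ℝ) ≤ ‖u v‖ ^ (r - 1) :=
      h2.trans (le_self_pow₀ (by linarith) (by omega))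
    have h4 : ‖u v‖ ^ (r - 1) - 1 ≤ ‖u v ^ (r - 1) - 1‖ := by
      have := norm_sub_norm_le (u v ^ (r - 1)) 1
      simpa using this
    calc _ ≤ 1 / 2 * (2 / 3) ^ (r - 1) * (1 + ‖u v‖) ^ (r - 1) := by
          gcongr; exact min_le_right _ _
      _ = 1 / 2 * (2 / 3 * (1 + ‖u v‖)) ^ (r - 1) := by rw [mul_pow]; ring
      _ ≤ 1 / 2 * ‖u v‖ ^ (r - 1) := by gcongr; linarith
      _ ≤ _ := by linarith

/-- Each ζ is compared with its projection v = Re(ζ/β) on the ray. On a ball around u(v) of radius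
proportional to R = 1 + ‖u(v)‖ the derivative of g varies by at most half, so g is injective there
and covers a disc of radius of order R^r. The value to be attained differs from g(u(v)) by at most
3δ(v‖β‖)^2, which is at most 9δ R^r. One small δ therefore works for all v. -/
theorem IsGerm.exists_sector_branch (hr : 3 ≤ r) (hβ : β ≠ 0) (hU : IsGerm r U₀ ε) {u : ℝ → ℂ}
    (hu : ∀ T, IsRayLift r U₀ ε β T u) : ∃ δ > 0, ∃ (C : ℝ) (X : ℂ → ℂ), ∀ ζ : ℂ,
      |(ζ / β).im| < δ * (ζ / β).re →
        DifferentiableAt ℂ X ζ ∧ nphase r (X ζ) = nphase r 1 - ζ ^ 2 ∧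
        (‖ζ‖ < ε / 2 → X ζ = U₀ ζ) ∧ ‖deriv X ζ‖ ≤ C * (1 + ‖ζ‖) := by
  classical
  have hε := hU.pos
  have hβ' : 0 < ‖β‖ := norm_pos_iff.mpr hβ
  -- With δ ≤ 1, a point of the sector satisfies ‖ζ/β‖ < 2 Re(ζ/β); hence ‖ζ‖ ≥ ε/2 implies Re(ζ/β)
  -- > v₀. Smaller ζ are left to the germ.
  set v₀ : ℝ := ε / (4 * ‖β‖) with hv₀
  have hv₀pos : 0 < v₀ := by positivity
  obtain ⟨m, hm, hmu⟩ := exists_noncrit_bound hr hβ hu hv₀pos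
  obtain ⟨n, rfl⟩ : ∃ n, r = n + 2 := ⟨r - 2, by omega⟩
  simp only [show n + 2 - 1 = n + 1 by omega] at hmu
  -- The bound η ≤ 1 keeps the ball inside norm 2R, and the second bound makes (n+1)(2R)^n · ηR at
  -- most m R^(n+1)/2, half of the lower bound for the derivative.
  set η : ℝ := min 1 (m / (2 * ((n + 1) * 2 ^ n))) with hη
  have hη0 : 0 < η := by positivity
  set R : ℝ → ℝ := fun v => 1 + ‖u v‖ with hRdef
  have hR1 : ∀ v, 1 ≤ R v := fun v => by simp [hRdef]
  have hd : ∀ v, v₀ ≤ v → u v ^ (n + 1) - 1 ≠ 0 := fun v hv => by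
    have h1 := hmu v hv
    have h2 : 0 < m * (1 + ‖u v‖) ^ (n + 1) := by have := norm_nonneg (u v); positivity
    exact norm_pos_iff.mp (h2.trans_le h1)
  have hclose : ∀ v, v₀ ≤ v → ∀ x ∈ ball (u v) (η * R v),
      ‖(x ^ (n + 1) - 1) - (u v ^ (n + 1) - 1)‖ ≤ ‖u v ^ (n + 1) - 1‖ / 2 := by
    intro v hv x hx
    rw [mem_ball, dist_eq_norm] at hx
    have hη1 : η * R v ≤ R v := mul_le_of_le_one_left (by linarith [hR1 v]) (min_le_left _ _)
    have hx2 : ‖x‖ ≤ 2 * R v := by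
      have := norm_sub_norm_le x (u v)
      have h3 : ‖u v‖ ≤ R v := by simp [hRdef]
      linarith
    have hu2 : ‖u v‖ ≤ 2 * R v := by simp only [hRdef]; linarith [norm_nonneg (u v)]
    have hRp : 0 < R v := by linarith [hR1 v]
    have hηm : η * (2 * ((n + 1) * 2 ^ n)) ≤ m := by
      rw [← le_div_iff₀ (by positivity)]; exact min_le_right _ _
    calc _ = ‖x ^ (n + 1) - u v ^ (n + 1)‖ := by congr 1; ring
      _ ≤ (n + 1) * (2 * R v) ^ n * ‖x - u v‖ := norm_pow_sub_pow_le hx2 hu2 n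
      _ ≤ (n + 1) * (2 * R v) ^ n * (η * R v) := by gcongr
      _ = (η * (2 * ((n + 1) * 2 ^ n))) * R v ^ (n + 1) / 2 := by rw [mul_pow]; ring
      _ ≤ m * R v ^ (n + 1) / 2 := by gcongr
      _ ≤ _ := by linarith [hmu v hv]
  have hinv := fun v (hv : v₀ ≤ v) => injOn_and_preimage_of_deriv_close (f := nphase (n + 2))
    (f' := fun u => u ^ (n + 1) - 1) (hd v hv)
    (ρ := η * R v) (by have := hR1 v; positivity) (nphase_hasDerivAt hr) (hclose v hv)
  -- The inequality required below is 9δ < mη/8.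
  set δ : ℝ := min 1 (m * η / 100) with hδ
  have hδ0 : 0 < δ := by positivity
  have hlift : ∀ v, v₀ ≤ v → nphase (n + 2) (u v) = nphase (n + 2) 1 - (v * β) ^ 2 :=
    fun v hv => (hu (v + 1)).lift v ⟨hv₀pos.le.trans hv, by linarith⟩
  let Y : ℂ → ℂ := fun ζ =>
    if h : ∃ x ∈ ball (u (ζ / β).re) (η * R (ζ / β).re),
      nphase (n + 2) x = nphase (n + 2) 1 - ζ ^ 2 then h.choose else 0
  have hY : ∀ ζ : ℂ, v₀ ≤ (ζ / β).re → |(ζ / β).im| < δ * (ζ / β).re →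
      Y ζ ∈ ball (u (ζ / β).re) (η * R (ζ / β).re) ∧
        nphase (n + 2) (Y ζ) = nphase (n + 2) 1 - ζ ^ 2 := by
    intro ζ hζ1 hζ2
    have hex : ∃ x ∈ ball (u (ζ / β).re) (η * R (ζ / β).re),
        nphase (n + 2) x = nphase (n + 2) 1 - ζ ^ 2 := by
      refine (hinv _ hζ1).2 _ ?_
      set ξ := ζ / β with hξ
      have hζ : ζ = ξ * β := by rw [hξ]; field_simp
      have hvpos : 0 < ξ.re := hv₀pos.trans_le hζ1
      have e1 : nphase (n + 2) 1 - ζ ^ 2 - nphase (n + 2) (u ξ.re)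
          = -(Complex.I * ξ.im * (2 * ξ.re + Complex.I * ξ.im)) * β ^ 2 := by
        rw [hlift _ hζ1, hζ]
        conv_lhs => rw [← Complex.re_add_im ξ]
        simp only [Complex.add_re, Complex.ofReal_re, Complex.ofReal_im,
          Complex.mul_re, Complex.I_re, Complex.I_im]
        push_cast
        ring_nf
      have e2 : ‖(2 * ξ.re + Complex.I * ξ.im : ℂ)‖ ≤ 3 * ξ.re := by
        refine (norm_add_le _ _).trans ?_
        simp only [norm_mul, Complex.norm_I, Complex.norm_real, Real.norm_eq_abs,
          Complex.norm_ofNat, one_mul]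
        have : |ξ.im| ≤ ξ.re := hζ2.le.trans
          (mul_le_of_le_one_left hvpos.le (min_le_left _ _))
        rw [abs_of_pos hvpos]; linarith
      have e3 : ‖nphase (n + 2) 1 - ζ ^ 2 - nphase (n + 2) (u ξ.re)‖
          ≤ δ * ξ.re * (3 * ξ.re) * ‖β‖ ^ 2 := by
        rw [e1, norm_mul, norm_neg, norm_mul, norm_mul, Complex.norm_I, one_mul, norm_pow,
          Complex.norm_real, Real.norm_eq_abs]
        gcongr
      have e4 : (ξ.re * ‖β‖) ^ 2 ≤ 3 * R ξ.re ^ (n + 2) := by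
        have h1 : ‖((ξ.re : ℂ) * β) ^ 2‖ ≤ ‖nphase (n + 2) (u ξ.re)‖ + ‖nphase (n + 2) 1‖ := by
          have : ((ξ.re : ℂ) * β) ^ 2 = nphase (n + 2) 1 - nphase (n + 2) (u ξ.re) := by
            rw [hlift _ hζ1]; ring
          rw [this]
          exact (norm_sub_le _ _).trans (by linarith)
        rw [norm_pow, norm_mul, Complex.norm_of_nonneg hvpos.le] at h1
        have h2 := norm_nphase_le hr (u ξ.re)
        have h3 := norm_nphase_one_le hr
        have h4 : 1 ≤ R ξ.re ^ (n + 2) := one_le_pow₀ (hR1 _)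
        linarith
      have h5 := hmu _ hζ1
      have hR := hR1 ξ.re
      have h6 : 0 < R ξ.re ^ (n + 2) := by positivity
      have h7 : δ * 100 ≤ m * η := by
        rw [← le_div_iff₀ (by norm_num)]; exact min_le_right _ _
      calc _ ≤ δ * 3 * (ξ.re * ‖β‖) ^ 2 := e3.trans (le_of_eq (by ring))
        _ ≤ δ * 3 * (3 * R ξ.re ^ (n + 2)) := by gcongr
        _ = (δ * 9) * R ξ.re ^ (n + 2) := by ring
        _ < (m * η / 8) * R ξ.re ^ (n + 2) := by
          refine mul_lt_mul_of_pos_right ?_ h6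
          linarith
        _ = m * R ξ.re ^ (n + 1) * (η * R ξ.re) / 8 := by ring
        _ ≤ _ := by gcongr
    simp only [Y, dif_pos hex]
    exact hex.choose_spec
  have hYuniq : ∀ ζ : ℂ, v₀ ≤ (ζ / β).re → |(ζ / β).im| < δ * (ζ / β).re → ∀ x,
      x ∈ ball (u (ζ / β).re) (η * R (ζ / β).re) →
      nphase (n + 2) x = nphase (n + 2) 1 - ζ ^ 2 → Y ζ = x := by
    intro ζ h1 h2 x hx hx2
    obtain ⟨h3, h4⟩ := hY ζ h1 h2
    exact (hinv _ h1).1 h3 hx (h4.trans hx2.symm)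
  have hYd : ∀ ζ : ℂ, v₀ ≤ (ζ / β).re → |(ζ / β).im| < δ * (ζ / β).re →
      m / 2 ≤ ‖Y ζ ^ (n + 1) - 1‖ := by
    intro ζ h1 h2
    have h3 := hclose _ h1 _ (hY ζ h1 h2).1
    have h4 := norm_sub_norm_le (u (ζ / β).re ^ (n + 1) - 1) (Y ζ ^ (n + 1) - 1)
    have h5 : m ≤ m * R (ζ / β).re ^ (n + 1) := le_mul_of_one_le_right hm.le (one_le_pow₀ (hR1 _))
    have h6 := hmu _ h1
    rw [norm_sub_rev] at h3
    simp only [hRdef] at h5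
    linarith
  have hopen : ∀ ζ : ℂ, v₀ < (ζ / β).re → |(ζ / β).im| < δ * (ζ / β).re →
      ∀ᶠ z : ℂ in 𝓝 ζ, v₀ < (z / β).re ∧ |(z / β).im| < δ * (z / β).re := by
    intro ζ h1 h2
    have c1 : Continuous fun z : ℂ => (z / β).re := by fun_prop
    have c2 : Continuous fun z : ℂ => δ * (z / β).re - |(z / β).im| := by fun_prop
    have h3 := c1.continuousAt.eventually_const_lt h1
    have h4 := c2.continuousAt.eventually_const_lt (sub_pos.mpr h2)
    filter_upwards [h3, h4] with z a b using ⟨a, sub_pos.mp b⟩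
  have hYdiff : ∀ ζ : ℂ, v₀ < (ζ / β).re → |(ζ / β).im| < δ * (ζ / β).re →
      DifferentiableAt ℂ Y ζ := by
    intro ζ h1 h2
    obtain ⟨hb, he⟩ := hY ζ h1.le h2
    have hd0 : deriv (nphase (n + 2)) (Y ζ) ≠ 0 := by
      rw [nphase_deriv hr]
      have := hYd ζ h1.le h2
      exact norm_pos_iff.mp (by simpa using (half_pos hm).trans_le this)
    obtain ⟨G, hG1, hG2, -, hG4, -⟩ :=
      exists_local_inverse ((nphase_differentiable hr).analyticAt (Y ζ)) hd0
    rw [he] at hG1 hG2 hG4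
    have hin : DifferentiableAt ℂ (fun z : ℂ => nphase (n + 2) 1 - z ^ 2) ζ := by fun_prop
    have hGd : DifferentiableAt ℂ (fun z : ℂ => G (nphase (n + 2) 1 - z ^ 2)) ζ :=
      DifferentiableAt.comp ζ hG2.differentiableAt hin
    -- Although Y is defined by choice, injectivity on the moving ball identifies it near ζ with the
    -- holomorphic local inverse.
    refine hGd.congr_of_eventuallyEq ?_
    have huc : ContinuousAt u (ζ / β).re := by
      refine (hu ((ζ / β).re + 1)).cont.continuousAt (Ico_mem_nhds (hv₀pos.trans h1) (by linarith))
    have c1 : ContinuousAt (fun z : ℂ => u (z / β).re) ζ :=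
      ContinuousAt.comp_of_eq huc (by fun_prop) rfl
    have c2 : ContinuousAt (fun z : ℂ => η * R (z / β).re
        - dist (G (nphase (n + 2) 1 - z ^ 2)) (u (z / β).re)) ζ := by
      refine ContinuousAt.sub ?_ (hGd.continuousAt.dist c1)
      exact continuousAt_const.mul (continuousAt_const.add c1.norm)
    have h3 := c2.eventually_const_lt (u := 0) (by beta_reduce; rw [hG1]; exact sub_pos.mpr hb)
    filter_upwards [h3, hopen ζ h1 h2, hin.continuousAt.eventually hG4] with z a b c
    exact hYuniq z b.1.le b.2 _ (sub_pos.mp a) c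
  have hre : ∀ ζ : ℂ, |(ζ / β).im| < δ * (ζ / β).re → ε / 2 ≤ ‖ζ‖ → v₀ < (ζ / β).re := by
    intro ζ h2 h3
    have h4 := Complex.norm_le_abs_re_add_abs_im (ζ / β)
    have hpos : 0 < (ζ / β).re := by
      by_contra hc
      push Not at hc
      have := mul_nonpos_of_nonneg_of_nonpos hδ0.le hc
      linarith [abs_nonneg (ζ / β).im]
    have h5 : δ * (ζ / β).re ≤ (ζ / β).re := mul_le_of_le_one_left hpos.le (min_le_left _ _)
    rw [norm_div, abs_of_pos hpos] at h4
    have h6 : ‖ζ‖ / ‖β‖ < 2 * (ζ / β).re := by linarith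
    have h7 : ε / 2 / ‖β‖ ≤ ‖ζ‖ / ‖β‖ := by gcongr
    have h8 : v₀ = ε / 2 / ‖β‖ / 2 := by rw [hv₀]; field_simp; ring
    linarith
  have hagree : ∀ ζ : ℂ, v₀ < (ζ / β).re → |(ζ / β).im| < δ * (ζ / β).re → ‖ζ‖ < ε →
      Y ζ = U₀ ζ := by
    intro ζ h1 h2 h3
    set ξ := ζ / β with hξ
    have hζ : ζ = ξ * β := by rw [hξ]; field_simp
    -- The segment at constant Re(·/β) from the ray to ζ: the germ and Y agree at its foot, since
    -- the ray lift extends the germ, and hence at ζ by uniqueness of lifts.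
    let p : ℝ → ℂ := fun s => (ξ.re + s * ξ.im * Complex.I) * β
    have hpc : Continuous p := by fun_prop
    have hpdiv : ∀ s, p s / β = ξ.re + s * ξ.im * Complex.I := fun s => by
      simp only [p]; field_simp
    have hpre : ∀ s, (p s / β).re = ξ.re := fun s => by rw [hpdiv]; simp
    have hpim : ∀ s, (p s / β).im = s * ξ.im := fun s => by rw [hpdiv]; simp
    have habs : ∀ s ∈ Icc (0 : ℝ) 1, |s * ξ.im| ≤ |ξ.im| := fun s hs => by
      rw [abs_mul, abs_of_nonneg hs.1]; exact mul_le_of_le_one_left (abs_nonneg _) hs.2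
    have hp2 : ∀ s ∈ Icc (0 : ℝ) 1, |(p s / β).im| < δ * (p s / β).re := fun s hs => by
      rw [hpre, hpim]; exact (habs s hs).trans_lt h2
    have hp1 : ∀ s, v₀ < (p s / β).re := fun s => by rw [hpre]; exact h1
    have hpn : ∀ s ∈ Icc (0 : ℝ) 1, p s ∈ ball (0 : ℂ) ε := fun s hs => by
      rw [mem_ball_zero_iff]
      refine lt_of_le_of_lt ?_ h3
      rw [hζ, norm_mul, norm_mul]
      gcongr
      rw [← sq_le_sq₀ (norm_nonneg _) (norm_nonneg _), Complex.sq_norm, Complex.sq_norm,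
        Complex.normSq_apply, Complex.normSq_apply]
      have := sq_le_sq.mpr (habs s hs)
      simp
      nlinarith
    have hp0 : ∀ s, p s ≠ 0 := fun s h => by
      have := hp1 s
      rw [h] at this
      simp at this
      linarith
    have hz : p 0 = ξ.re * β := by simp [p]
    have hone : p 1 = ζ := by
      simp only [p]
      rw [hζ]
      congr 1
      simp [Complex.re_add_im]
    have := eqOn_of_lift (nphase_differentiable hr) (s := Icc (0 : ℝ) 1) isPreconnected_Icc
      (a := fun s => U₀ (p s)) (b := fun s => Y (p s)) (x₀ := 0)
      (fun s hs => (ContinuousAt.comp_of_eq (hU.diff _ (hpn s hs)).continuousAt hpc.continuousAt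
        rfl).continuousWithinAt)
      (fun s hs => (ContinuousAt.comp_of_eq (hYdiff _ (hp1 s) (hp2 s hs)).continuousAt
        hpc.continuousAt rfl).continuousWithinAt)
      (fun s hs => by rw [hU.eq _ (hpn s hs), (hY _ (hp1 s).le (hp2 s hs)).2])
      (fun s hs => hU.noncrit hr (hpn s hs) (hp0 s)) (by simp) (by
        have hmem : (0 : ℝ) ∈ Icc (0 : ℝ) 1 := by simp
        symm
        refine hYuniq _ (hp1 0).le (hp2 0 hmem) _ ?_ (hU.eq _ (hpn 0 hmem))
        have : U₀ (p 0) = u (p 0 / β).re := by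
          rw [hpre, hz]
          have h4 := hpn 0 hmem
          rw [hz, mem_ball_zero_iff] at h4
          exact ((hu (ξ.re + 1)).germ ξ.re ⟨(hv₀pos.trans h1).le, by linarith⟩ h4).symm
        rw [this]
        exact mem_ball_self (by have := hR1 (p 0 / β).re; positivity))
    have h5 := this (show (1 : ℝ) ∈ Icc (0 : ℝ) 1 by simp)
    simp only [hone] at h5
    exact h5.symm
  have hU₀c : ContinuousOn (deriv U₀) (closedBall 0 (ε / 2)) := by
    have h1 : DifferentiableOn ℂ U₀ (ball 0 ε) := fun z hz => (hU.diff z hz).differentiableWithinAt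
    exact (h1.deriv isOpen_ball).continuousOn.mono (closedBall_subset_ball (by linarith))
  obtain ⟨C₀, hC₀⟩ := (isCompact_closedBall (0 : ℂ) (ε / 2)).exists_bound_of_continuousOn hU₀c
  let X : ℂ → ℂ := fun ζ => if ‖ζ‖ < ε / 2 then U₀ ζ else Y ζ
  have hXY : ∀ ζ : ℂ, v₀ < (ζ / β).re → |(ζ / β).im| < δ * (ζ / β).re → X ζ = Y ζ := by
    intro ζ h1 h2
    by_cases h3 : ‖ζ‖ < ε / 2
    · simp only [X, if_pos h3]
      exact (hagree ζ h1 h2 (by linarith)).symm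
    · simp only [X, if_neg h3]
  refine ⟨δ, hδ0, max C₀ (4 / m), X, fun ζ h2 => ?_⟩
  have hC0' : 0 ≤ max C₀ (4 / m) := le_max_of_le_right (by positivity)
  by_cases h3 : ‖ζ‖ < ε / 2
  · have hXU : X =ᶠ[𝓝 ζ] U₀ := by
      filter_upwards [continuous_norm.continuousAt.eventually_lt_const h3] with z hz
      simp only [X, if_pos hz]
    have hmem : ζ ∈ ball (0 : ℂ) ε := by rw [mem_ball_zero_iff]; linarith
    refine ⟨(hU.diff ζ hmem).congr_of_eventuallyEq hXU, ?_, fun _ => hXU.self_of_nhds, ?_⟩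
    · rw [hXU.self_of_nhds, hU.eq ζ hmem]
    · rw [hXU.deriv_eq]
      refine (hC₀ ζ (by simpa using h3.le)).trans ?_
      calc C₀ ≤ max C₀ (4 / m) * 1 := by rw [mul_one]; exact le_max_left _ _
        _ ≤ _ := by gcongr; linarith [norm_nonneg ζ]
  · have h1 := hre ζ h2 (not_lt.mp h3)
    have hXY' : X =ᶠ[𝓝 ζ] Y := by
      filter_upwards [hopen ζ h1 h2] with z hz using hXY z hz.1 hz.2
    refine ⟨(hYdiff ζ h1 h2).congr_of_eventuallyEq hXY', ?_, fun h => absurd h h3, ?_⟩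
    · rw [hXY ζ h1 h2, (hY ζ h1.le h2).2]
    · rw [hXY'.deriv_eq]
      -- From g'(Y)·Y' = -2ζ and ‖g'(Y)‖ ≥ m/2 the derivative is at most (4/m)‖ζ‖.
      have h4 := deriv_mul_of_lift hr (hYdiff ζ h1 h2) (by
        filter_upwards [hopen ζ h1 h2] with z hz using (hY z hz.1.le hz.2).2)
      have h5 := hYd ζ h1.le h2
      have h6 := congrArg norm h4
      rw [norm_mul, norm_mul, show n + 2 - 1 = n + 1 by omega] at h6
      simp only [norm_neg, Complex.norm_ofNat] at h6
      have h7 : m / 2 * ‖deriv Y ζ‖ ≤ 2 * ‖ζ‖ := by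
        rw [← h6]; gcongr
      calc ‖deriv Y ζ‖ ≤ 4 / m * ‖ζ‖ := by
            rw [div_mul_eq_mul_div, le_div_iff₀ hm]; linarith
        _ ≤ max C₀ (4 / m) * (1 + ‖ζ‖) := by
            gcongr
            · exact le_max_right _ _
            · linarith

end

end HyperAiry

/-! ### Holomorphic branches near a whole line through 0 -/

namespace HyperAiry
open Set Metric

/-- `U` is a holomorphic solution of `g (U ζ) = g 1 - ζ ^ 2` on `O` for the normalized phase `g`,
through its critical point `1`. -/
structure IsBranch (r : ℕ) (O : Set ℂ) (U : ℂ → ℂ) : Prop where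
  isOpen : IsOpen O
  zero_mem : (0 : ℂ) ∈ O
  diff : DifferentiableOn ℂ U O
  zero : U 0 = 1
  deriv_zero : deriv U 0 = kappa r
  eq : ∀ ζ ∈ O, nphase r (U ζ) = nphase r 1 - ζ ^ 2
  bound : ∃ C, ∀ ζ ∈ O, ‖deriv U ζ‖ ≤ C * (1 + ‖ζ‖)

/-- The sectors around β and -β are disjoint, and both extensions equal the germ on the ball of
radius ε/2, so the three pieces glue. A whole line ℝμ lies in the union as soon as μ lies in the
narrower of the two sectors. -/
theorem IsGerm.exists_isBranch {r : ℕ} {U₀ : ℂ → ℂ} {ε : ℝ} {β : ℂ} (hr : 3 ≤ r) (hβ : β ≠ 0)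
    (hU : IsGerm r U₀ ε) {u₁ u₂ : ℝ → ℂ} (hu₁ : ∀ T, IsRayLift r U₀ ε β T u₁)
    (hu₂ : ∀ T, IsRayLift r U₀ ε (-β) T u₂) :
    ∃ (M O : Set ℂ) (U : ℂ → ℂ), IsOpen M ∧ β ∈ M ∧ (∀ μ ∈ M, ∀ v : ℝ, (v : ℂ) * μ ∈ O) ∧
      IsBranch r O U := by
  classical
  have hε := hU.pos
  obtain ⟨δ₁, hδ₁, C₁, X₁, h₁⟩ := hU.exists_sector_branch hr hβ hu₁
  obtain ⟨δ₂, hδ₂, C₂, X₂, h₂⟩ := hU.exists_sector_branch hr (neg_ne_zero.mpr hβ) hu₂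
  set A : Set ℂ := {ζ | |(ζ / β).im| < δ₁ * (ζ / β).re} with hA
  set B : Set ℂ := {ζ | |(ζ / -β).im| < δ₂ * (ζ / -β).re} with hB
  have hAo : IsOpen A := isOpen_lt (by fun_prop) (by fun_prop)
  have hBo : IsOpen B := isOpen_lt (by fun_prop) (by fun_prop)
  have hdisj : ∀ ζ, ζ ∈ A → ζ ∉ B := by
    intro ζ h h'
    have h1 : 0 < (ζ / β).re := by
      have : 0 < δ₁ * (ζ / β).re := (abs_nonneg _).trans_lt h
      exact (mul_pos_iff_of_pos_left hδ₁).mp this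
    have h2 : 0 < (ζ / -β).re := by
      have : 0 < δ₂ * (ζ / -β).re := (abs_nonneg _).trans_lt h'
      exact (mul_pos_iff_of_pos_left hδ₂).mp this
    rw [div_neg, Complex.neg_re] at h2
    linarith
  let U : ℂ → ℂ := fun ζ => if ζ ∈ A then X₁ ζ else if ζ ∈ B then X₂ ζ else U₀ ζ
  have hUA : ∀ ζ ∈ A, U =ᶠ[𝓝 ζ] X₁ := fun ζ hζ => by
    filter_upwards [hAo.mem_nhds hζ] with z hz
    simp only [U, if_pos hz]
  have hUB : ∀ ζ ∈ B, U =ᶠ[𝓝 ζ] X₂ := fun ζ hζ => by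
    filter_upwards [hBo.mem_nhds hζ] with z hz
    simp only [U, if_neg (fun h => hdisj z h hz), if_pos hz]
  have hU0 : ∀ ζ ∈ ball (0 : ℂ) (ε / 2), U ζ = U₀ ζ := fun ζ hζ => by
    rw [mem_ball_zero_iff] at hζ
    by_cases ha : ζ ∈ A
    · simp only [U, if_pos ha]; exact (h₁ ζ ha).2.2.1 hζ
    by_cases hb : ζ ∈ B
    · simp only [U, if_neg ha, if_pos hb]; exact (h₂ ζ hb).2.2.1 hζ
    · simp only [U, if_neg ha, if_neg hb]
  have hU0' : ∀ ζ ∈ ball (0 : ℂ) (ε / 2), U =ᶠ[𝓝 ζ] U₀ := fun ζ hζ =>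
    eventually_of_mem (isOpen_ball.mem_nhds hζ) hU0
  have hsub : ball (0 : ℂ) (ε / 2) ⊆ ball 0 ε := ball_subset_ball (by linarith)
  have hz : (0 : ℂ) ∈ ball (0 : ℂ) (ε / 2) := mem_ball_self (by positivity)
  have hU₀c : ContinuousOn (deriv U₀) (closedBall 0 (ε / 2)) := by
    have h1 : DifferentiableOn ℂ U₀ (ball 0 ε) := fun z hz => (hU.diff z hz).differentiableWithinAt
    exact (h1.deriv isOpen_ball).continuousOn.mono (closedBall_subset_ball (by linarith))
  obtain ⟨C₀, hC₀⟩ := (isCompact_closedBall (0 : ℂ) (ε / 2)).exists_bound_of_continuousOn hU₀c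
  refine ⟨{μ | |(μ / β).im| < min δ₁ δ₂ * (μ / β).re}, ball 0 (ε / 2) ∪ (A ∪ B), U,
    isOpen_lt (by fun_prop) (by fun_prop), ?_, ?_, ?_⟩
  · simp [div_self hβ, hδ₁, hδ₂]
  · intro μ (hμ : |(μ / β).im| < min δ₁ δ₂ * (μ / β).re) v
    have hpos : 0 < (μ / β).re :=
      (mul_pos_iff_of_pos_left (lt_min hδ₁ hδ₂)).mp ((abs_nonneg _).trans_lt hμ)
    rcases lt_trichotomy v 0 with hv | rfl | hv
    · right; right
      have e : (v : ℂ) * μ / -β = ((-v : ℝ) : ℂ) * (μ / β) := by push_cast; rw [div_neg]; ring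
      change |(_ : ℂ).im| < δ₂ * (_ : ℂ).re
      rw [e, Complex.im_ofReal_mul, Complex.re_ofReal_mul, abs_mul,
          abs_of_pos (by linarith : 0 < -v)]
      have : |(μ / β).im| < δ₂ * (μ / β).re := hμ.trans_le (by gcongr; exact min_le_right _ _)
      nlinarith
    · left; simpa using hε
    · right; left
      have e : (v : ℂ) * μ / β = (v : ℂ) * (μ / β) := by ring
      change |(_ : ℂ).im| < δ₁ * (_ : ℂ).re
      rw [e, Complex.im_ofReal_mul, Complex.re_ofReal_mul, abs_mul, abs_of_pos hv]
      have : |(μ / β).im| < δ₁ * (μ / β).re := hμ.trans_le (by gcongr; exact min_le_left _ _)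
      nlinarith
  · refine ⟨isOpen_ball.union (hAo.union hBo), Or.inl hz, ?_, ?_, ?_, ?_, ?_⟩
    · rintro ζ (h | h | h)
      · exact ((hU.diff ζ (hsub h)).congr_of_eventuallyEq (hU0' ζ h)).differentiableWithinAt
      · exact ((h₁ ζ h).1.congr_of_eventuallyEq (hUA ζ h)).differentiableWithinAt
      · exact ((h₂ ζ h).1.congr_of_eventuallyEq (hUB ζ h)).differentiableWithinAt
    · rw [hU0 0 hz, hU.zero]
    · rw [(hU0' 0 hz).deriv_eq, hU.deriv_zero]
    · rintro ζ (h | h | h)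
      · rw [hU0 ζ h, hU.eq ζ (hsub h)]
      · rw [(hUA ζ h).self_of_nhds, (h₁ ζ h).2.1]
      · rw [(hUB ζ h).self_of_nhds, (h₂ ζ h).2.1]
    · refine ⟨max C₀ (max C₁ C₂), ?_⟩
      have hle : ∀ C ζ, C ≤ max C₀ (max C₁ C₂) →
          C * (1 + ‖ζ‖) ≤ max C₀ (max C₁ C₂) * (1 + ‖(ζ : ℂ)‖) := fun C ζ h => by gcongr
      rintro ζ (h | h | h)
      · rw [(hU0' ζ h).deriv_eq]
        have h1 := hC₀ ζ (ball_subset_closedBall h)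
        refine (le_trans h1 ?_).trans (hle C₀ ζ (le_max_left _ _))
        exact le_mul_of_one_le_right ((norm_nonneg _).trans h1) (by linarith [norm_nonneg ζ])
      · rw [(hUA ζ h).deriv_eq]
        exact (h₁ ζ h).2.2.2.trans (hle C₁ ζ ((le_max_left _ _).trans (le_max_right _ _)))
      · rw [(hUB ζ h).deriv_eq]
        exact (h₂ ζ h).2.2.2.trans (hle C₂ ζ ((le_max_right _ _).trans (le_max_right _ _)))

/-! ### Stokes lines from rays that run into a critical point -/

/-- A continuous lift agrees locally with the holomorphic inverse of g applied to the smooth curve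
g(1) - (vβ)^2, so it is differentiable by the chain rule. -/
theorem IsRayLift.hasDerivAt {r : ℕ} {U₀ : ℂ → ℂ} {ε : ℝ} {β : ℂ} (hr : 3 ≤ r) {T : ℝ}
    {u : ℝ → ℂ} (h : IsRayLift r U₀ ε β T u) {v : ℝ} (hv : v ∈ Ioo 0 T) :
    HasDerivAt u (-(2 * v * β ^ 2) / deriv (nphase r) (u v)) v := by
  have hd := h.noncrit v hv
  obtain ⟨G, -, -, hG3, -, hG5⟩ :=
    exists_local_inverse ((nphase_differentiable hr).analyticAt (u v)) hd
  have huc : ContinuousAt u v := h.cont.continuousAt (Ico_mem_nhds hv.1 hv.2)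
  have h1 : HasDerivAt (fun x : ℝ => nphase r 1 - ((x : ℂ) * β) ^ 2) (-(2 * v * β ^ 2)) v := by
    have := ((((hasDerivAt_id (v : ℂ)).mul_const β).pow 2).const_sub (nphase r 1)).comp_ofReal
    refine this.congr_deriv ?_
    simp only [id, Nat.cast_ofNat]; ring
  rw [h.lift v (Ioo_subset_Ico_self hv)] at hG3
  have h2 : HasDerivAt (fun x : ℝ => G (nphase r 1 - ((x : ℂ) * β) ^ 2))
      ((deriv (nphase r) (u v))⁻¹ * -(2 * v * β ^ 2)) v := HasDerivAt.comp v hG3 h1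
  refine (h2.congr_of_eventuallyEq ?_).congr_deriv (by ring)
  filter_upwards [huc.eventually hG5, Ioo_mem_nhds hv.1 hv.2] with x hx hxT
  rw [← h.lift x (Ioo_subset_Ico_self hxT), hx]

/-- Comparison principle by which the divergence of an explicit logarithm ρ passes to the time τ. -/
theorem monotoneOn_sub_of_deriv_le {τ ρ τ' ρ' : ℝ → ℝ} {a b : ℝ}
    (hτ : ∀ v ∈ Ioo a b, HasDerivAt τ (τ' v) v) (hρ : ∀ v ∈ Ioo a b, HasDerivAt ρ (ρ' v) v)
    (h : ∀ v ∈ Ioo a b, ρ' v ≤ τ' v) : MonotoneOn (fun v => τ v - ρ v) (Ioo a b) := by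
  have hd : ∀ v ∈ Ioo a b, HasDerivAt (fun v => τ v - ρ v) (τ' v - ρ' v) v := fun v hv =>
    (hτ v hv).sub (hρ v hv)
  refine monotoneOn_of_deriv_nonneg (convex_Ioo a b)
    (fun v hv => (hd v hv).continuousAt.continuousWithinAt)
    (fun v hv => (hd v (interior_subset hv)).differentiableAt.differentiableWithinAt) fun v hv => ?_
  rw [(hd v (interior_subset hv)).deriv]
  exact sub_nonneg.mpr (h v (interior_subset hv))

/-- Reparametrization by time of a path of steepest descent between two critical points. -/
theorem exists_isStokesLine {f : ℂ → ℂ} (hf : Continuous (deriv f)) {T : ℝ} (hT : 0 < T)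
    {w : ℝ → ℂ} {c b : ℂ} (hd : ∀ v ∈ Ioo 0 T, deriv f (w v) ≠ 0)
    (hw : ∀ v ∈ Ioo 0 T, HasDerivAt w (-(2 * v) / deriv f (w v)) v)
    (hc : Tendsto w (𝓝[>] 0) (𝓝 c)) (hb : Tendsto w (𝓝[<] T) (𝓝 b))
    (hc' : ∃ C > 0, ∀ᶠ v in 𝓝[>] 0, ‖deriv f (w v)‖ ^ 2 ≤ C * v ^ 2)
    (hb' : ∃ C > 0, ∀ᶠ v in 𝓝[<] T, ‖deriv f (w v)‖ ^ 2 ≤ C * (T ^ 2 - v ^ 2)) :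
    ∃ z, IsStokesLine f c b z := by
  -- The density dτ/dv. Since w' = -2v/f'(w) = -(2v/‖f'(w)‖^2) conj f'(w), dividing by φ turns the
  -- velocity into that of the flow.
  set φ : ℝ → ℝ := fun v => 2 * v / ‖deriv f (w v)‖ ^ 2 with hφ
  have hwc : ContinuousOn w (Ioo 0 T) := fun v hv => (hw v hv).continuousAt.continuousWithinAt
  have hpos : ∀ v ∈ Ioo 0 T, 0 < ‖deriv f (w v)‖ ^ 2 := fun v hv => by
    have := norm_pos_iff.mpr (hd v hv); positivity
  have hφc : ContinuousOn φ (Ioo 0 T) := by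
    refine ContinuousOn.div (by fun_prop) ?_ fun v hv => (hpos v hv).ne'
    exact ((hf.comp_continuousOn hwc).norm).pow 2
  have hφpos : ∀ v ∈ Ioo 0 T, 0 < φ v := fun v hv => div_pos (by linarith [hv.1]) (hpos v hv)
  set τ : ℝ → ℝ := fun v => ∫ x in (T / 2)..v, φ x with hτ
  have hmid : T / 2 ∈ Ioo 0 T := ⟨by linarith, by linarith⟩
  have hτd : ∀ v ∈ Ioo 0 T, HasDerivAt τ (φ v) v := fun v hv => by
    refine intervalIntegral.integral_hasDerivAt_right ?_
      (hφc.stronglyMeasurableAtFilter isOpen_Ioo v hv) (hφc.continuousAt (Ioo_mem_nhds hv.1 hv.2))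
    exact (hφc.mono (ordConnected_Ioo.uIcc_subset hmid hv)).intervalIntegrable
  have hτc : ContinuousOn τ (Ioo 0 T) := fun v hv => (hτd v hv).continuousAt.continuousWithinAt
  have hτm : StrictMonoOn τ (Ioo 0 T) := by
    refine strictMonoOn_of_deriv_pos (convex_Ioo 0 T) hτc fun v hv => ?_
    rw [(hτd v (interior_subset hv)).deriv]
    exact hφpos v (interior_subset hv)
  -- Near T the density is at least 2v/(C(T^2 - v^2)), whose primitive -log(T^2 - v^2)/C tends to
  -- +∞.
  have hunb : ∀ y, ∃ v ∈ Ioo 0 T, y ≤ τ v := by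
    obtain ⟨C, hC, hev⟩ := hb'
    obtain ⟨l, hl, hlT⟩ := mem_nhdsLT_iff_exists_Ioo_subset.mp
      (inter_mem hev (Ioo_mem_nhdsLT hT))
    have hl' : l < T := hl
    have hmono := monotoneOn_sub_of_deriv_le (τ := τ) (τ' := φ) (a := l) (b := T)
      (ρ := fun v => -C⁻¹ * Real.log (T ^ 2 - v ^ 2))
      (ρ' := fun v => -C⁻¹ * (-(2 * v) / (T ^ 2 - v ^ 2)))
      (fun v hv => hτd v (hlT hv).2) (fun v hv => by
        have h0 := (hlT hv).2
        have h1 : HasDerivAt (fun v : ℝ => T ^ 2 - v ^ 2) (-(2 * v)) v := by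
          simpa using (hasDerivAt_pow 2 v).const_sub (T ^ 2)
        exact (h1.log (by nlinarith [h0.1, h0.2])).const_mul _) (fun v hv => by
        have h0 := (hlT hv).2
        have h1 := (hlT hv).1
        have h2 : 0 < T ^ 2 - v ^ 2 := by nlinarith [h0.1, h0.2]
        have e : -C⁻¹ * (-(2 * v) / (T ^ 2 - v ^ 2)) = 2 * v / (C * (T ^ 2 - v ^ 2)) := by
          field_simp
        rw [e]
        have := hpos v h0
        have := h0.1
        have h3 : ‖deriv f (w v)‖ ^ 2 ≤ C * (T ^ 2 - v ^ 2) := h1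
        simp only [hφ]
        gcongr)
    have hlim : Tendsto (fun v => -C⁻¹ * Real.log (T ^ 2 - v ^ 2)) (𝓝[<] T) atTop := by
      refine Tendsto.const_mul_atBot_of_neg (by simpa using hC)
        (Real.tendsto_log_nhdsGT_zero.comp ?_)
      rw [tendsto_nhdsWithin_iff]
      constructor
      · have : Continuous fun v : ℝ => T ^ 2 - v ^ 2 := by fun_prop
        have h1 := this.tendsto T
        rw [sub_self] at h1
        exact h1.mono_left nhdsWithin_le_nhds
      · filter_upwards [Ioo_mem_nhdsLT hT] with v hv
        rw [mem_Ioi]; nlinarith [hv.1, hv.2]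
    intro y
    set v₁ := (l + T) / 2 with hv₁
    have hv₁m : v₁ ∈ Ioo l T := ⟨by linarith, by linarith⟩
    obtain ⟨v, hv, hvI⟩ := ((hlim.eventually_ge_atTop (y - (τ v₁ -
      (-C⁻¹ * Real.log (T ^ 2 - v₁ ^ 2))))).and (Ioo_mem_nhdsLT hv₁m.2)).exists
    have hvm : v ∈ Ioo l T := ⟨hv₁m.1.trans hvI.1, hvI.2⟩
    refine ⟨v, (hlT hvm).2, ?_⟩
    have := hmono hv₁m hvm hvI.1.le
    simp only at this
    linarith
  -- Near 0 the density is at least 2/(Cv), whose primitive 2 log v/C tends to -∞.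
  have hunb' : ∀ y, ∃ v ∈ Ioo 0 T, τ v ≤ y := by
    obtain ⟨C, hC, hev⟩ := hc'
    obtain ⟨l, hl, hlT⟩ := mem_nhdsGT_iff_exists_Ioo_subset.mp
      (inter_mem hev (Ioo_mem_nhdsGT hT))
    have hl' : 0 < l := hl
    have hmono := monotoneOn_sub_of_deriv_le (τ := τ) (τ' := φ) (a := 0) (b := l)
      (ρ := fun v => 2 * C⁻¹ * Real.log v) (ρ' := fun v => 2 * C⁻¹ * v⁻¹)
      (fun v hv => hτd v (hlT hv).2)
      (fun v hv => (Real.hasDerivAt_log hv.1.ne').const_mul _) (fun v hv => by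
        have h0 := (hlT hv).2
        have h1 := (hlT hv).1
        have hv0 := h0.1
        have e : 2 * C⁻¹ * v⁻¹ = 2 * v / (C * v ^ 2) := by field_simp
        rw [e]
        have := hpos v h0
        have h3 : ‖deriv f (w v)‖ ^ 2 ≤ C * v ^ 2 := h1
        simp only [hφ]
        gcongr)
    have hlim : Tendsto (fun v => 2 * C⁻¹ * Real.log v) (𝓝[>] 0) atBot :=
      Tendsto.const_mul_atBot (by positivity) Real.tendsto_log_nhdsGT_zero
    intro y
    set v₁ := l / 2 with hv₁
    have hv₁m : v₁ ∈ Ioo 0 l := ⟨by linarith, by linarith⟩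
    obtain ⟨v, hv, hvI⟩ := ((hlim.eventually_le_atBot (y - (τ v₁ -
      (2 * C⁻¹ * Real.log v₁)))).and (Ioo_mem_nhdsGT hv₁m.1)).exists
    have hvm : v ∈ Ioo 0 l := ⟨hvI.1, hvI.2.trans hv₁m.2⟩
    refine ⟨v, (hlT hvm).2, ?_⟩
    have := hmono hvm hv₁m hvI.2.le
    simp only at this
    linarith
  have hsurj : ∀ y, ∃ v ∈ Ioo 0 T, τ v = y := fun y => by
    obtain ⟨v₁, h₁, h₁'⟩ := hunb' y
    obtain ⟨v₂, h₂, h₂'⟩ := hunb y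
    exact (isPreconnected_Ioo.image τ hτc).ordConnected.out (mem_image_of_mem τ h₁)
      (mem_image_of_mem τ h₂) ⟨h₁', h₂'⟩
  choose V hV hτV using hsurj
  have hVτ : ∀ v ∈ Ioo 0 T, V (τ v) = v := fun v hv => hτm.injOn (hV _) hv (hτV _)
  have hVm : Monotone V := fun x y hxy => by
    by_contra hcon
    push Not at hcon
    have := hτm (hV y) (hV x) hcon
    rw [hτV, hτV] at this
    linarith
  have hrange : range V = Ioo 0 T :=
    Subset.antisymm (range_subset_iff.mpr hV) fun v hv => ⟨τ v, hVτ v hv⟩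
  have hVc : ∀ y, ContinuousAt V y := fun y =>
    continuousAt_of_monotoneOn_of_image_mem_nhds (hVm.monotoneOn univ) univ_mem (by
      rw [image_univ, hrange]; exact Ioo_mem_nhds (hV y).1 (hV y).2)
  have hVd : ∀ y, HasDerivAt V (φ (V y))⁻¹ y := fun y =>
    HasDerivAt.of_local_left_inverse (hVc y) (hτd _ (hV y)) (hφpos _ (hV y)).ne'
      (Eventually.of_forall hτV)
  refine ⟨fun y => w (V y), fun y => ?_, hc.comp ?_, hb.comp ?_⟩
  · have h1 := (hw (V y) (hV y)).scomp y (hVd y)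
    refine h1.congr_deriv ?_
    have h2 := hd _ (hV y)
    have h3 : ((V y : ℝ) : ℂ) ≠ 0 := by exact_mod_cast (hV y).1.ne'
    have h4 : (‖deriv f (w (V y))‖ : ℂ) ^ 2
        = deriv f (w (V y)) * (starRingEnd ℂ) (deriv f (w (V y))) := by
      rw [Complex.mul_conj, Complex.normSq_eq_norm_sq]; push_cast; rfl
    simp only [hφ, Complex.real_smul]
    push_cast
    rw [h4]
    field_simp
  · rw [tendsto_nhdsWithin_iff]
    exact ⟨tendsto_atBot_isGLB hVm (by rw [hrange]; exact isGLB_Ioo hT),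
      Eventually.of_forall fun y => (hV y).1⟩
  · rw [tendsto_nhdsWithin_iff]
    exact ⟨tendsto_atTop_isLUB hVm (by rw [hrange]; exact isLUB_Ioo hT),
      Eventually.of_forall fun y => (hV y).2⟩

/-- Because β^2 c^r = 1, the phase along c u(v) equals f(c) - v^2. Hence ‖f'‖^2 is bounded by a
multiple of v^2 at the start and of T^2 - v^2 at the end, as the time reparametrization demands. -/
theorem IsRayLift.exists_isStokesLine {r : ℕ} {U₀ : ℂ → ℂ} {ε : ℝ} {β : ℂ} (hr : 3 ≤ r)
    (hU : IsGerm r U₀ ε) {c t : ℂ} (ht : t ≠ 0) (hct : c ^ (r - 1) = t) (hβ : β ^ 2 * c ^ r = 1)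
    {T : ℝ} (hT : 0 < T) {u : ℝ → ℂ} {b : ℂ} (hu : IsRayLift r U₀ ε β T u)
    (hb : deriv (nphase r) b = 0) (hbT : nphase r b = nphase r 1 - (T * β) ^ 2)
    (hlim : Tendsto u (𝓝[<] T) (𝓝 b)) :
    ∃ b' z, b' ≠ c ∧ deriv (phase r t) b' = 0 ∧ IsStokesLine (phase r t) c b' z := by
  have hc0 : c ≠ 0 := by
    rintro rfl
    rw [zero_pow (by omega)] at hct
    exact ht hct.symm
  have hβ0 : β ≠ 0 := by
    rintro rfl
    simp at hβ
  have hcr : c ^ r = t * c := by rw [← hct, ← pow_succ]; congr 1; omega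
  have hb1 : b ^ (r - 1) = 1 := by
    rw [nphase_deriv hr] at hb; exact sub_eq_zero.mp hb
  have hdph : ∀ x, deriv (phase r t) (c * x) = t * deriv (nphase r) x := fun x => by
    rw [phase_deriv hr, nphase_deriv hr, mul_pow, hct]; ring
  have hph : ∀ v ∈ Ico 0 T, phase r t (c * u v) = phase r t c - v ^ 2 := fun v hv => by
    have h1 := phase_mul hr hct 1
    rw [mul_one] at h1
    rw [phase_mul hr hct, hu.lift v hv, h1]
    linear_combination -(v : ℂ) ^ 2 * hβ
  have hphb : phase r t (c * b) = phase r t c - T ^ 2 := by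
    have h1 := phase_mul hr hct 1
    rw [mul_one] at h1
    rw [phase_mul hr hct, hbT, h1]
    linear_combination -(T : ℂ) ^ 2 * hβ
  have hu0 : Tendsto u (𝓝[>] 0) (𝓝 1) := by
    have h1 := hu.cont 0 ⟨le_rfl, hT⟩
    have h2 : u 0 = 1 := by
      rw [hu.germ 0 ⟨le_rfl, hT⟩ (by simpa using hU.pos)]; simpa using hU.zero
    rw [ContinuousWithinAt, h2] at h1
    refine h1.mono_left ?_
    rw [nhdsWithin_le_iff]
    exact mem_of_superset (Ioo_mem_nhdsGT hT) Ioo_subset_Ico_self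
  have hlc : Tendsto (fun v => c * u v) (𝓝[>] 0) (𝓝 c) := by simpa using hu0.const_mul c
  have hlb : Tendsto (fun v => c * u v) (𝓝[<] T) (𝓝 (c * b)) := hlim.const_mul c
  obtain ⟨z, hz⟩ := HyperAiry.exists_isStokesLine (f := phase r t) (T := T)
    (w := fun v => c * u v) (c := c) (b := c * b)
    (by
      have : deriv (phase r t) = fun u => u ^ (r - 1) - t := funext (phase_deriv hr t)
      rw [this]; fun_prop) hT
    (fun v hv => by rw [hdph]; exact mul_ne_zero ht (hu.noncrit v hv))
    (fun v hv => by
      refine ((hu.hasDerivAt hr hv).const_mul c).congr_deriv ?_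
      rw [hdph]
      have := hu.noncrit v hv
      have h3 : β ^ 2 * (t * c) = 1 := by rw [← hcr, hβ]
      field_simp
      linear_combination (-v : ℂ) * h3) hlc hlb
    (by
      obtain ⟨C, hC, h⟩ := phase_deriv_sq_le hr ht hct
      refine ⟨C, hC, ?_⟩
      filter_upwards [hlc.eventually h, Ioo_mem_nhdsGT hT] with v hv hvT
      rw [hph v (Ioo_subset_Ico_self hvT)] at hv
      simpa [abs_of_pos hvT.1] using hv)
    (by
      obtain ⟨C, hC, h⟩ := phase_deriv_sq_le hr (b := c * b) ht (by rw [mul_pow, hct, hb1, mul_one])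
      refine ⟨C, hC, ?_⟩
      filter_upwards [hlb.eventually h, Ioo_mem_nhdsLT hT] with v hv hvT
      rw [hph v (Ioo_subset_Ico_self hvT), hphb] at hv
      have e : phase r t c - (v : ℂ) ^ 2 - (phase r t c - (T : ℂ) ^ 2)
          = ((T ^ 2 - v ^ 2 : ℝ) : ℂ) := by push_cast; ring
      rwa [e, Complex.norm_of_nonneg (by nlinarith [hvT.1, hvT.2])] at hv)
  refine ⟨c * b, z, fun h => ?_, by rw [hdph, hb, mul_zero], hz⟩
  -- The endpoints are distinct because the critical values differ by (Tβ)^2 ≠ 0.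
  have hb' : b = 1 := mul_left_cancel₀ hc0 (by rw [h, mul_one])
  rw [hb'] at hbT
  have : ((T : ℂ) * β) ^ 2 = 0 := by linear_combination hbT
  have h2 : (T : ℂ) ≠ 0 := by exact_mod_cast hT.ne'
  exact pow_ne_zero 2 (mul_ne_zero h2 hβ0) this

/-- Away from the Stokes rays, the branch extends to a neighbourhood of the line `ℝ β`. -/
theorem exists_isBranch_of_not_stokes {r : ℕ} (hr : 3 ≤ r) {c t β : ℂ} (ht : t ≠ 0)
    (hct : c ^ (r - 1) = t) (hβ : β ^ 2 * c ^ r = 1)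
    (hno : ¬ ∃ b z, b ≠ c ∧ deriv (phase r t) b = 0 ∧ IsStokesLine (phase r t) c b z) :
    ∃ (M O : Set ℂ) (U : ℂ → ℂ), IsOpen M ∧ β ∈ M ∧ (∀ μ ∈ M, ∀ v : ℝ, (v : ℂ) * μ ∈ O) ∧
      IsBranch r O U := by
  obtain ⟨U₀, ε, h1, h2, h3, h4, h5⟩ := exists_germ hr
  have hU : IsGerm r U₀ ε := ⟨h1, h2, h3, h4, h5⟩
  have hβ0 : β ≠ 0 := by
    rintro rfl
    simp at hβ
  have key : ∀ β' : ℂ, β' ≠ 0 → β' ^ 2 * c ^ r = 1 → ∃ u, ∀ T, IsRayLift r U₀ ε β' T u := by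
    intro β' h0 hβ'
    rcases hU.ray_dichotomy hr h0 with h | ⟨T, hT, u, b, hu, hb, hbT, hlim⟩
    · exact h
    · exact absurd (hu.exists_isStokesLine hr hU ht hct hβ' hT hb hbT hlim) hno
  obtain ⟨u₁, hu₁⟩ := key β hβ0 hβ
  obtain ⟨u₂, hu₂⟩ := key (-β) (neg_ne_zero.mpr hβ0) (by rw [neg_sq, hβ])
  exact hU.exists_isBranch hr hβ0 hu₁ hu₂

end HyperAiry

namespace HyperAiry
open Set Metric

/-! ### Thimbles -/

theorem hasDerivAt_re {F : ℝ → ℂ} {F' : ℂ} {x : ℝ} (h : HasDerivAt F F' x) :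
    HasDerivAt (fun y => (F y).re) F'.re x :=
  Complex.reCLM.hasFDerivAt.comp_hasDerivAt x h

theorem hasDerivAt_im {F : ℝ → ℂ} {F' : ℂ} {x : ℝ} (h : HasDerivAt F F' x) :
    HasDerivAt (fun y => (F y).im) F'.im x :=
  Complex.imCLM.hasFDerivAt.comp_hasDerivAt x h

/-- `W` solves `f (W ξ) = f c - ξ ^ 2` on a complex neighbourhood `O` of the real line, with
`W 0 = c` and `W'(0) = d`. -/
structure IsSteepBranch (f : ℂ → ℂ) (c d : ℂ) (O : Set ℂ) (W : ℂ → ℂ) : Prop where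
  isOpen : IsOpen O
  mem : ∀ v : ℝ, (v : ℂ) ∈ O
  diff : DifferentiableOn ℂ W O
  zero : W 0 = c
  deriv_zero : deriv W 0 = d
  ne_zero : d ≠ 0
  eq : ∀ ξ ∈ O, f (W ξ) = f c - ξ ^ 2

namespace IsSteepBranch

variable {f : ℂ → ℂ} {c d : ℂ} {O : Set ℂ} {W : ℂ → ℂ}

theorem analyticAt (h : IsSteepBranch f c d O W) {ξ : ℂ} (hξ : ξ ∈ O) : AnalyticAt ℂ W ξ :=
  h.diff.analyticAt (h.isOpen.mem_nhds hξ)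

theorem deriv_mul (h : IsSteepBranch f c d O W) (hf : Differentiable ℂ f) {ξ : ℂ} (hξ : ξ ∈ O) :
    deriv f (W ξ) * deriv W ξ = -2 * ξ := by
  have h1 := (hf (W ξ)).hasDerivAt.comp ξ (h.analyticAt hξ).differentiableAt.hasDerivAt
  have h2 : HasDerivAt (fun z : ℂ => f c - z ^ 2) (-(2 * ξ)) ξ := by
    simpa using (hasDerivAt_pow 2 ξ).const_sub (f c)
  rw [h1.unique (h2.congr_of_eventuallyEq (eventually_of_mem (h.isOpen.mem_nhds hξ) h.eq))]
  ring

theorem deriv_ne_zero (h : IsSteepBranch f c d O W) (hf : Differentiable ℂ f) (v : ℝ) :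
    deriv W v ≠ 0 := by
  rcases eq_or_ne v 0 with rfl | hv
  · rw [Complex.ofReal_zero, h.deriv_zero]; exact h.ne_zero
  · intro h0
    have := h.deriv_mul hf (h.mem v)
    rw [h0, mul_zero] at this
    exact hv (by simpa using this.symm)

theorem deriv_phase_base (h : IsSteepBranch f c d O W) (hf : Differentiable ℂ f) :
    deriv f c = 0 := by
  have h0 : (0 : ℂ) ∈ O := by simpa using h.mem 0
  have := h.deriv_mul hf h0
  rw [h.zero, h.deriv_zero, mul_zero] at this
  exact (mul_eq_zero.mp this).resolve_right h.ne_zero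

theorem hasDerivAt_ofReal (h : IsSteepBranch f c d O W) (v : ℝ) :
    HasDerivAt (fun v : ℝ => W v) (deriv W v) v :=
  (h.analyticAt (h.mem v)).differentiableAt.hasDerivAt.comp_ofReal

theorem continuous_deriv (h : IsSteepBranch f c d O W) : Continuous fun v : ℝ => deriv W v :=
  continuous_iff_continuousAt.mpr fun v =>
    ContinuousAt.comp_of_eq (h.analyticAt (h.mem v)).deriv.continuousAt
      Complex.continuous_ofReal.continuousAt rfl

/-- Since ξ enters only through ξ^2, the backward half of a thimble can be treated as a forward
half. -/
theorem reflect (h : IsSteepBranch f c d O W) :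
    IsSteepBranch f c (-d) {ξ | -ξ ∈ O} (fun ξ => W (-ξ)) where
  isOpen := h.isOpen.preimage continuous_neg
  mem v := by simpa using h.mem (-v)
  diff := h.diff.comp differentiable_neg.differentiableOn fun _ hx => hx
  zero := by simpa using h.zero
  deriv_zero := by rw [deriv_comp_neg]; simp [h.deriv_zero]
  ne_zero := neg_ne_zero.mpr h.ne_zero
  eq ξ hξ := by simpa using h.eq _ hξ

/-- Differentiating f(W(v)) = f(c) - v^2 gives W' = -(2v/‖f'(W)‖^2) conj f'(W), a multiple of the
descent field whose sign changes at v = 0. The ends are unbounded because f(W(v)) is, and f is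
bounded on compact sets. -/
theorem isThimble (h : IsSteepBranch f c d O W) (hf : Differentiable ℂ f) :
    IsThimble f c (fun v : ℝ => W v) := by
  have hd : deriv (fun v : ℝ => W v) = fun v : ℝ => deriv W v :=
    funext fun v => (h.hasDerivAt_ofReal v).deriv
  have hflow : ∀ v : ℝ, v ≠ 0 → deriv f (W v) ≠ 0 ∧ deriv W v
      = -((2 * v / ‖deriv f (W v)‖ ^ 2 : ℝ) : ℂ) * (starRingEnd ℂ) (deriv f (W v)) := by
    intro v hv
    have h1 := h.deriv_mul hf (h.mem v)
    have hv' : (v : ℂ) ≠ 0 := by exact_mod_cast hv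
    have h2 : deriv f (W v) ≠ 0 := by
      intro h0
      rw [h0, zero_mul] at h1
      exact hv' (by simpa using h1.symm)
    refine ⟨h2, ?_⟩
    have h4 : (‖deriv f (W v)‖ : ℂ) ^ 2
        = deriv f (W v) * (starRingEnd ℂ) (deriv f (W v)) := by
      rw [Complex.mul_conj, Complex.normSq_eq_norm_sq]; push_cast; rfl
    have h5 : (starRingEnd ℂ) (deriv f (W v)) ≠ 0 := by simpa using h2
    push_cast
    rw [h4]
    field_simp
    linear_combination h1
  have hcob : ∀ l : Filter ℝ, Tendsto (fun v : ℝ => v ^ 2) l atTop →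
      Tendsto (fun v : ℝ => W v) l (Bornology.cobounded ℂ) := by
    intro l hl
    have h1 : Tendsto (fun v : ℝ => f (W v)) l (Bornology.cobounded ℂ) := by
      rw [← tendsto_norm_atTop_iff_cobounded]
      refine tendsto_atTop_mono (f := fun v => v ^ 2 + -‖f c‖) (fun v => ?_)
        (tendsto_atTop_add_const_right _ _ hl)
      rw [h.eq v (h.mem v), norm_sub_rev]
      have := norm_sub_norm_le ((v : ℂ) ^ 2) (f c)
      simpa using this
    rw [Metric.cobounded_eq_cocompact] at h1 ⊢
    exact (tendsto_comap_iff.mpr h1).mono_right (comap_cocompact_le hf.continuous)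
  refine ⟨?_, by simpa using h.zero, fun x => ?_, fun x hx => ?_, fun x hx => ?_, ?_, ?_⟩
  · rw [contDiff_one_iff_deriv, hd]
    exact ⟨fun v => (h.hasDerivAt_ofReal v).differentiableAt, h.continuous_deriv⟩
  · rw [hd]; exact h.deriv_ne_zero hf x
  · obtain ⟨h1, h2⟩ := hflow x hx.ne'
    have := norm_pos_iff.mpr h1
    exact ⟨2 * x / ‖deriv f (W x)‖ ^ 2, by positivity, by rw [hd]; exact h2⟩
  · obtain ⟨h1, h2⟩ := hflow x hx.ne
    have := norm_pos_iff.mpr h1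
    refine ⟨-(2 * x / ‖deriv f (W x)‖ ^ 2), ?_, by rw [hd]; simpa using h2⟩
    rw [neg_pos]
    exact div_neg_of_neg_of_pos (by linarith) (by positivity)
  · exact hcob _ (tendsto_pow_atTop two_ne_zero)
  · exact hcob _ ((tendsto_pow_atTop two_ne_zero).comp tendsto_neg_atBot_atTop |>.congr
      fun v => by simp)

/-- Half of a thimble is a reparametrization of the corresponding half of the branch `W`. -/
theorem exists_half_reparam (h : IsSteepBranch f c d O W) (hf : Differentiable ℂ f)
    {γ γ' : ℝ → ℂ} {ρ₀ : ℝ} (hρ₀ : 0 < ρ₀) (hγ : ∀ x, HasDerivAt γ (γ' x) x) (h0 : γ 0 = c)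
    (h0' : γ' 0 = ρ₀ * d) (hne : ∀ x, γ' x ≠ 0)
    (hflow : ∀ x, 0 < x → ∃ ρ : ℝ, 0 < ρ ∧ γ' x = -ρ * (starRingEnd ℂ) (deriv f (γ x))) :
    ∃ s : ℝ → ℝ, Continuous s ∧ s 0 = 0 ∧ StrictMonoOn s (Ici 0) ∧ ∀ x, 0 ≤ x → γ x = W (s x) := by
  have hγc : Continuous γ := continuous_iff_continuousAt.mpr fun x => (hγ x).continuousAt
  have hF : ∀ x, HasDerivAt (fun x => f (γ x)) (deriv f (γ x) * γ' x) x := fun x =>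
    HasDerivAt.comp x (hf (γ x)).hasDerivAt (hγ x)
  have hreal : ∀ x, 0 < x → ∃ q : ℝ, 0 < q ∧ deriv f (γ x) * γ' x = -q := by
    intro x hx
    obtain ⟨ρ, hρ, he⟩ := hflow x hx
    have hfne : deriv f (γ x) ≠ 0 := fun h1 => hne x (by rw [he, h1]; simp)
    have hpos := norm_pos_iff.mpr hfne
    refine ⟨ρ * ‖deriv f (γ x)‖ ^ 2, by positivity, ?_⟩
    have h4 : (‖deriv f (γ x)‖ : ℂ) ^ 2
        = deriv f (γ x) * (starRingEnd ℂ) (deriv f (γ x)) := by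
      rw [Complex.mul_conj, Complex.normSq_eq_norm_sq]; push_cast; rfl
    push_cast
    rw [he, h4]; ring
  have hF0 : deriv f (γ 0) * γ' 0 = 0 := by rw [h0, h.deriv_phase_base hf, zero_mul]
  set S : ℝ → ℝ := fun x => (f c - f (γ x)).re with hS
  have hSd : ∀ x, HasDerivAt S (-(deriv f (γ x) * γ' x)).re x := fun x =>
    hasDerivAt_re ((hF x).const_sub (f c))
  have hSc : Continuous S := continuous_iff_continuousAt.mpr fun x => (hSd x).continuousAt
  have hSm : StrictMonoOn S (Ici 0) := by
    refine strictMonoOn_of_deriv_pos (convex_Ici 0) hSc.continuousOn fun x hx => ?_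
    rw [interior_Ici] at hx
    obtain ⟨q, hq, he⟩ := hreal x hx
    rw [(hSd x).deriv, he]; simpa using hq
  have hS0 : S 0 = 0 := by simp [hS, h0]
  have hSpos : ∀ x, 0 < x → 0 < S x := fun x hx => by
    rw [← hS0]; exact hSm (by simp) hx.le hx
  have hIm : ∀ x, 0 ≤ x → f c - f (γ x) = S x := by
    intro x hx
    have hI : ∀ y, HasDerivAt (fun y => (f c - f (γ y)).im) (-(deriv f (γ y) * γ' y)).im y :=
      fun y => hasDerivAt_im ((hF y).const_sub (f c))
    have := constant_of_has_deriv_right_zero (f := fun y => (f c - f (γ y)).im) (a := 0) (b := x)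
      (fun y _ => (hI y).continuousAt.continuousWithinAt) (fun y hy => by
        have h1 := (hI y).hasDerivWithinAt (s := Ici y)
        have h2 : (-(deriv f (γ y) * γ' y)).im = 0 := by
          rcases hy.1.eq_or_lt with rfl | hy0
          · rw [hF0]; simp
          · obtain ⟨q, -, he⟩ := hreal y hy0
            rw [he]; simp
        rwa [h2] at h1) x ⟨hx, le_rfl⟩
    apply Complex.ext
    · simp [hS]
    · rw [this, h0]; simp
  set s : ℝ → ℝ := fun x => Real.sqrt (S x) with hs
  have hsc : Continuous s := Real.continuous_sqrt.comp hSc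
  have hs0 : s 0 = 0 := by simp [hs, hS0]
  have hssq : ∀ x, 0 ≤ x → (s x : ℂ) ^ 2 = S x := fun x hx => by
    rw [← Complex.ofReal_pow, Real.sq_sqrt]
    rcases hx.eq_or_lt with rfl | hx
    · exact hS0.ge
    · exact (hSpos x hx).le
  have hO0 : (0 : ℂ) ∈ O := by simpa using h.mem 0
  obtain ⟨G, hG1, hG2, hG3, hG4, -⟩ := exists_local_inverse (h.analyticAt hO0)
    (by rw [h.deriv_zero]; exact h.ne_zero)
  rw [h.zero] at hG1 hG2 hG3 hG4
  have haG : HasDerivAt (fun x => G (γ x)) (ρ₀ : ℂ) 0 := by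
    rw [← h0] at hG3
    refine (HasDerivAt.comp (0 : ℝ) hG3 (hγ 0)).congr_deriv ?_
    rw [h0', h.deriv_zero]
    have := h.ne_zero
    field_simp
  have hγ0 : Tendsto γ (𝓝 0) (𝓝 c) := by rw [← h0]; exact hγc.tendsto 0
  -- Near c the curve is W of one of the two square roots. Its direction at c, a positive multiple
  -- of d, selects the positive one; uniqueness of lifts extends this to all x > 0.
  have hRe : ∀ᶠ x in 𝓝[>] (0 : ℝ), 0 < (G (γ x)).re := by
    have h1 : HasDerivAt (fun x => (G (γ x)).re) ρ₀ 0 := by simpa using hasDerivAt_re haG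
    have h2 := (hasDerivAt_iff_tendsto_slope.mp h1).eventually_const_lt hρ₀
    have h3 : ∀ᶠ x in 𝓝[>] (0 : ℝ), 0 < slope (fun x => (G (γ x)).re) 0 x :=
      h2.filter_mono (nhdsWithin_mono _ fun x hx => ne_of_gt hx)
    filter_upwards [h3, self_mem_nhdsWithin] with x hx hx0
    rw [slope_def_field, h0, hG1] at hx
    have hx0' : 0 < x := hx0
    have := (div_pos_iff_of_pos_right (by simpa using hx0')).mp hx
    simpa using this
  have hnear : ∀ᶠ x in 𝓝[>] (0 : ℝ), γ x = W (s x) := by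
    have hGO : ∀ᶠ z in 𝓝 c, G z ∈ O := by
      have : Tendsto G (𝓝 c) (𝓝 0) := by
        have := hG2.continuousAt.tendsto
        rwa [hG1] at this
      exact this.eventually (h.isOpen.mem_nhds hO0)
    filter_upwards [hRe, (hγ0.mono_left nhdsWithin_le_nhds).eventually hG4,
      (hγ0.mono_left nhdsWithin_le_nhds).eventually hGO, self_mem_nhdsWithin] with x h1 h2 h3 hx
    have hx : 0 < x := hx
    have h4 := h.eq _ h3
    rw [h2] at h4
    have h5 : G (γ x) ^ 2 = (s x : ℂ) ^ 2 := by
      rw [hssq x hx.le, ← hIm x hx.le, h4]; ring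
    rcases sq_eq_sq_iff_eq_or_eq_neg.mp h5 with h6 | h6
    · rw [← h6, h2]
    · rw [h6] at h1
      have : 0 ≤ s x := Real.sqrt_nonneg _
      simp at h1
      linarith
  refine ⟨s, hsc, hs0, fun x hx y hy hxy => Real.sqrt_lt_sqrt ?_ (hSm hx hy hxy), ?_⟩
  · rw [← hS0]; exact hSm.monotoneOn (by simp) hx hx
  have hWs : Continuous fun x => W (s x) :=
    (continuous_iff_continuousAt.mpr fun v => (h.hasDerivAt_ofReal v).continuousAt).comp hsc
  obtain ⟨x₀, hx₀, hx₀'⟩ := (hnear.and self_mem_nhdsWithin).exists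
  have hE := eqOn_of_lift hf (s := Ioi 0) isPreconnected_Ioi hγc.continuousOn hWs.continuousOn
    (fun x hx => by
      have hx : 0 < x := hx
      rw [h.eq _ (h.mem _), hssq x hx.le, ← hIm x hx.le]; ring)
    (fun x hx h1 => by
      obtain ⟨q, hq, he⟩ := hreal x hx
      rw [h1, zero_mul] at he
      have : q = 0 := by simpa using he.symm
      linarith) hx₀' hx₀
  intro x hx
  rcases hx.eq_or_lt with rfl | hx
  · rw [h0, hs0]; simpa using h.zero.symm
  · exact hE hx

theorem exists_reparam (h : IsSteepBranch f c d O W) (hf : Differentiable ℂ f)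
    (hcob : Tendsto f (Bornology.cobounded ℂ) (Bornology.cobounded ℂ)) {γ : ℝ → ℂ}
    (hγ : IsThimble f c γ) (hdir : ∃ ρ : ℝ, 0 < ρ ∧ deriv γ 0 = ρ * d) :
    ∃ σ σ' : ℝ → ℝ, (∀ x, HasDerivAt σ (σ' x) x) ∧ (∀ x, 0 ≤ σ' x) ∧ Function.Injective σ ∧
      range σ = univ ∧ ∀ x, γ x = W (σ x) ∧ deriv γ x = σ' x * deriv W (σ x) := by
  obtain ⟨ρ₀, hρ₀, hd0⟩ := hdir
  have hγd : ∀ x, HasDerivAt γ (deriv γ x) x := fun x =>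
    ((hγ.contDiff.differentiable one_ne_zero) x).hasDerivAt
  have hγn : ∀ x, HasDerivAt (fun x => γ (-x)) (-deriv γ (-x)) x := fun x =>
    ((hγd (-x)).scomp x (hasDerivAt_neg x)).congr_deriv (by simp)
  obtain ⟨s₁, hs₁c, hs₁0, hs₁m, hs₁⟩ := h.exists_half_reparam hf hρ₀ hγd hγ.base hd0 hγ.regular
    hγ.flow_pos
  obtain ⟨s₂, hs₂c, hs₂0, hs₂m, hs₂⟩ := h.reflect.exists_half_reparam hf hρ₀ hγn
    (by simpa using hγ.base) (by rw [neg_zero, hd0]; ring) (fun x => neg_ne_zero.mpr (hγ.regular _))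
    (fun x hx => by
      obtain ⟨ρ, hρ, he⟩ := hγ.flow_neg (-x) (by linarith)
      exact ⟨ρ, hρ, by rw [he]; ring⟩)
  set σ : ℝ → ℝ := fun x => if 0 ≤ x then s₁ x else -s₂ (-x) with hσ
  have hσ1 : ∀ x, 0 ≤ x → σ x = s₁ x := fun x hx => by simp [hσ, hx]
  have hσ2 : ∀ x, x ≤ 0 → σ x = -s₂ (-x) := fun x hx => by
    rcases hx.eq_or_lt with rfl | hx
    · simp [hσ, hs₁0, hs₂0]
    · simp [hσ, not_le.mpr hx]
  have hσc : Continuous σ := by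
    refine Continuous.if_le hs₁c (by fun_prop) continuous_const continuous_id fun x hx => ?_
    have : x = 0 := hx.symm
    simp [this, hs₁0, hs₂0]
  have hσm : StrictMono σ := by
    have h1 : StrictMonoOn σ (Ici 0) := fun x hx y hy hxy => by
      rw [hσ1 x hx, hσ1 y hy]; exact hs₁m hx hy hxy
    have h2 : StrictMonoOn σ (Iic 0) := fun x hx y hy hxy => by
      rw [hσ2 x hx, hσ2 y hy]
      have := hs₂m (show -y ∈ Ici 0 by simpa using hy) (show -x ∈ Ici 0 by simpa using hx)
        (neg_lt_neg hxy)
      linarith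
    exact h2.Iic_union_Ici h1
  have hγσ : ∀ x, γ x = W (σ x) := fun x => by
    rcases le_total 0 x with hx | hx
    · rw [hσ1 x hx]; exact hs₁ x hx
    · rw [hσ2 x hx]
      have := hs₂ (-x) (by linarith)
      simpa using this
  have hσd : ∀ x, HasDerivAt σ ((deriv W (σ x))⁻¹ * deriv γ x).re x ∧
      deriv γ x = (((deriv W (σ x))⁻¹ * deriv γ x).re : ℂ) * deriv W (σ x) := by
    intro x
    obtain ⟨G, hG1, -, hG3, -, hG5⟩ := exists_local_inverse (h.analyticAt (h.mem (σ x)))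
      (h.deriv_ne_zero hf (σ x))
    rw [← hγσ x] at hG3
    have h1 : HasDerivAt (fun y => (σ y : ℂ)) ((deriv W (σ x))⁻¹ * deriv γ x) x := by
      refine (HasDerivAt.comp x hG3 (hγd x)).congr_of_eventuallyEq ?_
      have h2 : Tendsto (fun y => (σ y : ℂ)) (𝓝 x) (𝓝 (σ x : ℂ)) :=
        (Complex.continuous_ofReal.comp hσc).tendsto x
      filter_upwards [h2.eventually hG5] with y hy
      simp only [Function.comp_apply]
      rw [hγσ y, hy]
    have h2 : HasDerivAt σ ((deriv W (σ x))⁻¹ * deriv γ x).re x := by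
      simpa using hasDerivAt_re h1
    refine ⟨h2, ?_⟩
    have h3 := h2.ofReal_comp.unique h1
    rw [h3]
    have := h.deriv_ne_zero hf (σ x)
    field_simp
  -- Surjectivity of σ: f tends to infinity along the unbounded curve, while ‖f(γ)‖ ≤ ‖f(c)‖ + σ^2.
  have hsq : ∀ l : Filter ℝ, Tendsto γ l (Bornology.cobounded ℂ) →
      Tendsto (fun x => |σ x|) l atTop := by
    intro l hl
    have h1 := tendsto_norm_atTop_iff_cobounded.mpr (hcob.comp hl)
    have h2 : Tendsto (fun x => ‖f c‖ + |σ x| ^ 2) l atTop := by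
      refine tendsto_atTop_mono (fun x => ?_) h1
      simp only [Function.comp_apply]
      rw [hγσ x, h.eq _ (h.mem _)]
      refine (norm_sub_le _ _).trans ?_
      simp
    have h3 : Tendsto (fun x => |σ x| ^ 2) l atTop := by
      have := tendsto_atTop_add_const_left l (-‖f c‖) h2
      exact this.congr fun x => by ring
    rw [Filter.tendsto_atTop] at h3 ⊢
    intro b
    filter_upwards [h3 (b ^ 2)] with x hx
    exact le_of_sq_le_sq hx (abs_nonneg _)
  have htop : Tendsto σ atTop atTop := by
    refine (hsq _ hγ.tendsto_top).congr' ?_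
    filter_upwards [eventually_ge_atTop 0] with x hx
    rw [abs_of_nonneg]
    have := hσm.monotone hx
    rwa [hσ1 0 le_rfl, hs₁0] at this
  have hbot : Tendsto σ atBot atBot := by
    refine tendsto_neg_atTop_iff.mp ((hsq _ hγ.tendsto_bot).congr' ?_)
    filter_upwards [eventually_le_atBot 0] with x hx
    rw [abs_of_nonpos]
    have := hσm.monotone hx
    rwa [hσ1 0 le_rfl, hs₁0] at this
  refine ⟨σ, _, fun x => (hσd x).1, fun x => ?_, hσm.injective,
    (hσc.surjective htop hbot).range_eq, fun x => ⟨hγσ x, (hσd x).2⟩⟩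
  rw [← (hσd x).1.deriv]
  exact hσm.monotone.deriv_nonneg

/-- Change of variables along the increasing bijection σ. Integrability and value thus depend only
on the branch, not on the parametrization of the thimble. -/
theorem integral_thimble (h : IsSteepBranch f c d O W) (hf : Differentiable ℂ f)
    (hcob : Tendsto f (Bornology.cobounded ℂ) (Bornology.cobounded ℂ)) {γ : ℝ → ℂ}
    (hγ : IsThimble f c γ) (hdir : ∃ ρ : ℝ, 0 < ρ ∧ deriv γ 0 = ρ * d) :
    (MeasureTheory.Integrable (fun x => Complex.exp (f (γ x)) * deriv γ x) ↔
      MeasureTheory.Integrable fun v : ℝ => Complex.exp (f c - v ^ 2) * deriv W v) ∧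
    ∫ x : ℝ, Complex.exp (f (γ x)) * deriv γ x
      = ∫ v : ℝ, Complex.exp (f c - v ^ 2) * deriv W v := by
  obtain ⟨σ, σ', h1, h2, h3, h4, h5⟩ := h.exists_reparam hf hcob hγ hdir
  have e : (fun x => Complex.exp (f (γ x)) * deriv γ x) = fun x => |σ' x| •
      (fun v : ℝ => Complex.exp (f c - v ^ 2) * deriv W v) (σ x) := by
    funext x
    rw [(h5 x).2, (h5 x).1, h.eq _ (h.mem _), abs_of_nonneg (h2 x), Complex.real_smul]
    ring
  have hint := MeasureTheory.integrableOn_image_iff_integrableOn_abs_deriv_smul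
    (s := univ) MeasurableSet.univ (fun x _ => (h1 x).hasDerivWithinAt) h3.injOn
    (fun v : ℝ => Complex.exp (f c - v ^ 2) * deriv W v)
  have heq := MeasureTheory.integral_image_eq_integral_abs_deriv_smul
    (s := univ) MeasurableSet.univ (fun x _ => (h1 x).hasDerivWithinAt) h3.injOn
    (fun v : ℝ => Complex.exp (f c - v ^ 2) * deriv W v)
  rw [image_univ, h4] at hint heq
  simp only [MeasureTheory.integrableOn_univ, MeasureTheory.Measure.restrict_univ] at hint heq
  rw [e]
  exact ⟨hint.symm, heq.symm⟩

end IsSteepBranch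

theorem phase_tendsto_cobounded {r : ℕ} (hr : 3 ≤ r) {c t : ℂ} (ht : t ≠ 0)
    (hct : c ^ (r - 1) = t) :
    Tendsto (phase r t) (Bornology.cobounded ℂ) (Bornology.cobounded ℂ) := by
  have hc0 : c ≠ 0 := by
    rintro rfl
    rw [zero_pow (by omega)] at hct
    exact ht hct.symm
  rw [← tendsto_norm_atTop_iff_cobounded]
  have hcn : 0 < ‖c‖ := norm_pos_iff.mpr hc0
  have h1 : Tendsto (fun w : ℂ => ‖c‖ ^ r * ((‖w‖ / ‖c‖ - 2) / 3))
      (Bornology.cobounded ℂ) atTop := by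
    refine Tendsto.const_mul_atTop (by positivity) (Tendsto.atTop_div_const (by norm_num) ?_)
    exact tendsto_atTop_add_const_right _ _ (tendsto_norm_cobounded_atTop.atTop_div_const hcn)
  refine tendsto_atTop_mono (fun w => ?_) h1
  have h2 := phase_mul hr hct (w / c)
  rw [mul_div_cancel₀ _ hc0] at h2
  rw [h2, norm_mul, norm_pow]
  have h3 := norm_le_nphase hr (w / c)
  rw [norm_div] at h3
  gcongr
  linarith

/-- The branch of the phase `w ^ r / r - t w` obtained by scaling. -/
theorem IsBranch.isSteepBranch {r : ℕ} (hr : 3 ≤ r) {O : Set ℂ} {U : ℂ → ℂ}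
    (h : IsBranch r O U) {c t μ : ℂ} (ht : t ≠ 0) (hct : c ^ (r - 1) = t)
    (hμ : μ ^ 2 * c ^ r = 1) (hO : ∀ v : ℝ, (v : ℂ) * μ ∈ O) :
    IsSteepBranch (phase r t) c (c * μ * kappa r) {ξ | ξ * μ ∈ O} (fun ξ => c * U (ξ * μ)) where
  isOpen := h.isOpen.preimage (by fun_prop)
  mem := hO
  diff := (h.diff.comp (f := fun ξ => ξ * μ) (by fun_prop) fun _ hx => hx).const_mul c
  zero := by simp [h.zero]
  deriv_zero := by
    have h1 : DifferentiableAt ℂ U 0 := (h.diff.differentiableAt (h.isOpen.mem_nhds h.zero_mem))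
    have h2 : HasDerivAt U (kappa r) ((0 : ℂ) * μ) := by
      rw [zero_mul, ← h.deriv_zero]; exact h1.hasDerivAt
    have h3 := ((h2.comp (0 : ℂ) ((hasDerivAt_id (0 : ℂ)).mul_const μ)).const_mul c).deriv
    simp only [Function.comp_def, id, one_mul] at h3
    rw [h3]; ring
  ne_zero := by
    refine mul_ne_zero (mul_ne_zero ?_ ?_) (kappa_ne_zero hr)
    · rintro rfl
      rw [zero_pow (by omega)] at hct
      exact ht hct.symm
    · rintro rfl
      simp at hμ
  eq ξ hξ := by
    have h1 := phase_mul hr hct 1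
    rw [mul_one] at h1
    rw [phase_mul hr hct, h.eq _ hξ, h1]
    linear_combination -ξ ^ 2 * hμ

end HyperAiry

namespace HyperAiry
open Set Metric MeasureTheory

/-! ### Gaussian integrals along lines -/

/-- The integral of `exp (-v ^ 2) G` over the line `ℝ μ`, where `v = ζ / μ`. -/
noncomputable def gaussInt (G : ℂ → ℂ) (μ : ℂ) : ℂ :=
  ∫ v : ℝ, Complex.exp (-(v : ℂ) ^ 2) * (G (v * μ) * μ)

/-- Polynomial growth on `O`. -/
def PolyBounded (O : Set ℂ) (G : ℂ → ℂ) : Prop :=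
  ∃ (C : ℝ) (n : ℕ), 0 ≤ C ∧ ∀ ζ ∈ O, ‖G ζ‖ ≤ C * (1 + ‖ζ‖) ^ n

theorem PolyBounded.mul {O : Set ℂ} {G H : ℂ → ℂ} (hG : PolyBounded O G) (hH : PolyBounded O H) :
    PolyBounded O (fun ζ => G ζ * H ζ) := by
  obtain ⟨C, n, hC, h⟩ := hG
  obtain ⟨D, m, hD, h'⟩ := hH
  refine ⟨C * D, n + m, by positivity, fun ζ hζ => ?_⟩
  rw [norm_mul, pow_add]
  calc _ ≤ (C * (1 + ‖ζ‖) ^ n) * (D * (1 + ‖ζ‖) ^ m) :=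
        mul_le_mul (h ζ hζ) (h' ζ hζ) (norm_nonneg _) (by positivity)
    _ = _ := by ring

theorem PolyBounded.const (O : Set ℂ) (c : ℂ) : PolyBounded O (fun _ => c) :=
  ⟨‖c‖, 0, norm_nonneg _, fun ζ _ => by simp⟩

theorem PolyBounded.id (O : Set ℂ) : PolyBounded O (fun ζ => ζ) :=
  ⟨1, 1, zero_le_one, fun ζ _ => by simp⟩

theorem PolyBounded.pow {O : Set ℂ} {G : ℂ → ℂ} (hG : PolyBounded O G) (n : ℕ) :
    PolyBounded O (fun ζ => G ζ ^ n) := by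
  induction n with
  | zero => simpa using PolyBounded.const O 1
  | succ n ih => simpa only [pow_succ] using ih.mul hG

theorem integrable_abs_pow_mul_exp (j : ℕ) :
    Integrable fun v : ℝ => |v| ^ j * Real.exp (-v ^ 2) := by
  have := (integrable_rpow_mul_exp_neg_mul_sq (b := 1) one_pos (s := j)
    (by have : (0 : ℝ) ≤ j := Nat.cast_nonneg j; linarith)).norm
  refine this.congr (Eventually.of_forall fun v => ?_)
  simp

theorem integrable_weight (K : ℝ) (n : ℕ) :
    Integrable fun v : ℝ => (1 + K * |v|) ^ n * Real.exp (-v ^ 2) := by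
  have : (fun v : ℝ => (1 + K * |v|) ^ n * Real.exp (-v ^ 2)) = fun v =>
      ∑ j ∈ Finset.range (n + 1), (n.choose j * K ^ j) * (|v| ^ j * Real.exp (-v ^ 2)) := by
    funext v
    rw [add_comm, add_pow, Finset.sum_mul]
    refine Finset.sum_congr rfl fun j _ => ?_
    rw [mul_pow]; ring
  rw [this]
  exact integrable_finsetSum _ fun j _ => (integrable_abs_pow_mul_exp j).const_mul _

theorem norm_cexp_neg_sq (v : ℝ) : ‖Complex.exp (-(v : ℂ) ^ 2)‖ = Real.exp (-v ^ 2) := by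
  have : (-(v : ℂ) ^ 2) = ((-v ^ 2 : ℝ) : ℂ) := by push_cast; ring
  rw [this, Complex.norm_exp_ofReal]

theorem continuous_cexp_neg_sq : Continuous fun v : ℝ => Complex.exp (-(v : ℂ) ^ 2) := by
  fun_prop

theorem integrable_of_norm_le {F : ℝ → ℂ} (hF : Continuous F) {C K : ℝ} {n : ℕ}
    (h : ∀ v, ‖F v‖ ≤ C * ((1 + K * |v|) ^ n * Real.exp (-v ^ 2))) : Integrable F :=
  ((integrable_weight K n).const_mul C).mono' hF.aestronglyMeasurable (Eventually.of_forall h)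

section
variable {O : Set ℂ} {G : ℂ → ℂ} {μ : ℂ}

theorem continuous_line (hO : IsOpen O) (hG : DifferentiableOn ℂ G O)
    (hμ : ∀ v : ℝ, (v : ℂ) * μ ∈ O) : Continuous fun v : ℝ => G (v * μ) :=
  continuous_iff_continuousAt.mpr fun v => ContinuousAt.comp_of_eq
    (hG.differentiableAt (hO.mem_nhds (hμ v))).continuousAt (by fun_prop) rfl

theorem integrable_gauss (hO : IsOpen O) (hG : DifferentiableOn ℂ G O) (hb : PolyBounded O G)
    (hμ : ∀ v : ℝ, (v : ℂ) * μ ∈ O) :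
    Integrable fun v : ℝ => Complex.exp (-(v : ℂ) ^ 2) * G (v * μ) := by
  obtain ⟨C, n, hC, h⟩ := hb
  have := continuous_line hO hG hμ
  refine integrable_of_norm_le (C := C) (K := ‖μ‖) (n := n)
    (continuous_cexp_neg_sq.mul this) fun v => ?_
  rw [norm_mul, norm_cexp_neg_sq]
  have h1 := h _ (hμ v)
  rw [norm_mul, Complex.norm_real, Real.norm_eq_abs, mul_comm |v|] at h1
  calc _ ≤ Real.exp (-v ^ 2) * (C * (1 + ‖μ‖ * |v|) ^ n) := by gcongr
    _ = _ := by ring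

theorem integrable_gauss_mul (hO : IsOpen O) (hG : DifferentiableOn ℂ G O) (hb : PolyBounded O G)
    (hμ : ∀ v : ℝ, (v : ℂ) * μ ∈ O) :
    Integrable fun v : ℝ => Complex.exp (-(v : ℂ) ^ 2) * (G (v * μ) * μ) := by
  refine ((integrable_gauss hO hG hb hμ).mul_const μ).congr (Eventually.of_forall fun v => ?_)
  ring

theorem hasDerivAt_cexp_neg_sq (v : ℝ) : HasDerivAt (fun v : ℝ => Complex.exp (-(v : ℂ) ^ 2))
    (Complex.exp (-(v : ℂ) ^ 2) * (-(2 * v))) v := by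
  have := ((hasDerivAt_pow 2 (v : ℂ)).neg.cexp).comp_ofReal
  simpa using this

theorem hasDerivAt_line (hO : IsOpen O) (hG : DifferentiableOn ℂ G O)
    (hμ : ∀ v : ℝ, (v : ℂ) * μ ∈ O) (v : ℝ) :
    HasDerivAt (fun v : ℝ => G (v * μ)) (deriv G (v * μ) * μ) v := by
  have h1 := (hG.differentiableAt (hO.mem_nhds (hμ v))).hasDerivAt
  have := (h1.comp (v : ℂ) ((hasDerivAt_id (v : ℂ)).mul_const μ)).comp_ofReal
  simpa using this

/-- Integration by parts. -/
theorem gaussInt_id_mul (hO : IsOpen O) (hG : DifferentiableOn ℂ G O) (hb : PolyBounded O G)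
    (hb' : PolyBounded O (deriv G)) (hμ : ∀ v : ℝ, (v : ℂ) * μ ∈ O) :
    gaussInt (fun ζ => ζ * G ζ) μ = μ ^ 2 / 2 * gaussInt (deriv G) μ := by
  have i1 := integrable_gauss_mul hO (hG.deriv hO) hb' hμ
  have i2 := integrable_gauss_mul (G := fun ζ => ζ * G ζ) hO (differentiableOn_id.mul hG)
    ((PolyBounded.id O).mul hb) hμ
  have hd : ∀ v : ℝ, HasDerivAt (fun v : ℝ => μ ^ 2 / 2 * (Complex.exp (-(v : ℂ) ^ 2) * G (v * μ)))
      (μ ^ 2 / 2 * (Complex.exp (-(v : ℂ) ^ 2) * (deriv G (v * μ) * μ)) -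
        Complex.exp (-(v : ℂ) ^ 2) * (v * μ * G (v * μ) * μ)) v := fun v => by
    refine (((hasDerivAt_cexp_neg_sq v).mul (hasDerivAt_line hO hG hμ v)).const_mul
      (μ ^ 2 / 2)).congr_deriv ?_
    ring
  have := integral_eq_zero_of_hasDerivAt_of_integrable hd ((i1.const_mul _).sub i2)
    ((integrable_gauss hO hG hb hμ).const_mul _)
  rw [integral_sub (i1.const_mul _) i2, integral_const_mul] at this
  exact (sub_eq_zero.mp this).symm

/-- The μ-derivative of G(vμ)μ equals the v-derivative of v G(vμ). Integration by parts moves it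
onto the Gaussian and leaves 2v^2 G(vμ), in which no derivative of G occurs. -/
theorem hasDerivAt_gaussInt (hO : IsOpen O) (hG : DifferentiableOn ℂ G O) (hb : PolyBounded O G)
    {M : Set ℂ} (hM : IsOpen M) (hMO : ∀ ν ∈ M, ∀ v : ℝ, (v : ℂ) * ν ∈ O) (hμ : μ ∈ M)
    (hμ0 : μ ≠ 0) :
    HasDerivAt (gaussInt G) (2 * (μ ^ 3)⁻¹ * gaussInt (fun ζ => ζ ^ 2 * G ζ) μ) μ := by
  obtain ⟨C, n, hC, h⟩ := hb
  obtain ⟨R₀, hR₀, hball⟩ := Metric.isOpen_iff.mp hM μ hμ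
  -- For ν within R of μ, the closed disc of radius R around ν stays in M, so Cauchy's estimate
  -- bounds the ν-derivative by polynomial growth of G alone; K bounds the norms of all points of
  -- these discs.
  set R := R₀ / 3 with hR
  have hRpos : 0 < R := by positivity
  set K := ‖μ‖ + 2 * R with hK
  have hK0 : 0 ≤ K := by positivity
  have hdν : ∀ v : ℝ, ∀ ν ∈ M, HasDerivAt (fun ν => G (v * ν) * ν)
      (G (v * ν) + v * ν * deriv G (v * ν)) ν := fun v ν hν => by
    have h1 := (hG.differentiableAt (hO.mem_nhds (hMO ν hν v))).hasDerivAt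
    have h2 := (h1.comp ν ((hasDerivAt_id ν).const_mul (v : ℂ))).mul (hasDerivAt_id ν)
    refine h2.congr_deriv ?_
    simp only [id, Function.comp_apply]; ring
  have hderivc : Continuous fun v : ℝ => deriv G (v * μ) :=
    continuous_line hO (hG.deriv hO) (hMO μ hμ)
  have hGc := continuous_line hO hG (hMO μ hμ)
  have hmain := hasDerivAt_integral_of_dominated_loc_of_deriv_le (μ := volume)
    (F := fun ν (v : ℝ) => Complex.exp (-(v : ℂ) ^ 2) * (G (v * ν) * ν))
    (F' := fun ν (v : ℝ) => Complex.exp (-(v : ℂ) ^ 2) * (G (v * ν) + v * ν * deriv G (v * ν)))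
    (bound := fun v => C * K / R * ((1 + K * |v|) ^ n * Real.exp (-v ^ 2)))
    (x₀ := μ) (ball_mem_nhds μ hRpos)
    (by
      filter_upwards [hM.mem_nhds hμ] with ν hν
      have := continuous_line hO hG (hMO ν hν)
      exact (continuous_cexp_neg_sq.mul (this.mul continuous_const)).aestronglyMeasurable)
    (integrable_gauss_mul hO hG ⟨C, n, hC, h⟩ (hMO μ hμ))
    (continuous_cexp_neg_sq.mul (hGc.add
      ((Complex.continuous_ofReal.mul continuous_const).mul hderivc))).aestronglyMeasurable
    (Eventually.of_forall fun v ν hν => by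
      rw [mem_ball, dist_eq_norm] at hν
      have hsub : closedBall ν R ⊆ M := fun x hx => hball (by
        rw [mem_closedBall, dist_eq_norm] at hx
        rw [mem_ball, dist_eq_norm]
        have := norm_add_le (x - ν) (ν - μ)
        rw [sub_add_sub_cancel] at this
        linarith)
      have hνM : ν ∈ M := hsub (mem_closedBall_self hRpos.le)
      rw [← (hdν v ν hνM).deriv, norm_mul, norm_cexp_neg_sq]
      have h1 := Complex.norm_deriv_le_of_forall_mem_sphere_norm_le (c := ν) (R := R)
        (f := fun ν => G (v * ν) * ν) (C := C * (1 + K * |v|) ^ n * K) hRpos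
        (DifferentiableOn.diffContOnCl fun x hx =>
          (hdν v x
          (hsub (closure_ball_subset_closedBall hx))).differentiableAt.differentiableWithinAt)
        (fun z hz => by
          have hzM := hsub (sphere_subset_closedBall hz)
          have hzK : ‖z‖ ≤ K := by
            rw [mem_sphere, dist_eq_norm] at hz
            have h2 := norm_sub_norm_le z μ
            have h3 := norm_add_le (z - ν) (ν - μ)
            rw [sub_add_sub_cancel] at h3
            linarith
          have h4 := h _ (hMO z hzM v)
          rw [norm_mul, Complex.norm_real, Real.norm_eq_abs] at h4
          rw [norm_mul]
          have : |v| * ‖z‖ ≤ K * |v| := by rw [mul_comm]; gcongr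
          refine mul_le_mul (h4.trans ?_) hzK (norm_nonneg _) (by positivity)
          gcongr)
      calc _ ≤ Real.exp (-v ^ 2) * (C * (1 + K * |v|) ^ n * K / R) := by gcongr
        _ = _ := by ring)
    ((integrable_weight K n).const_mul _)
    (Eventually.of_forall fun v ν hν => by
      rw [mem_ball, dist_eq_norm] at hν
      refine (hdν v ν (hball ?_)).const_mul _
      rw [mem_ball, dist_eq_norm]; linarith)
  obtain ⟨hint, hder⟩ := hmain
  have hb2 : PolyBounded O (fun ζ => ζ ^ 2 * G ζ) :=
    ((PolyBounded.id O).pow 2).mul ⟨C, n, hC, h⟩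
  have hd2 : DifferentiableOn ℂ (fun ζ => ζ ^ 2 * G ζ) O :=
    (differentiableOn_id.pow 2).mul hG
  have i2 := integrable_gauss_mul hO hd2 hb2 (hMO μ hμ)
  have i3 : Integrable fun v : ℝ => Complex.exp (-(v : ℂ) ^ 2) * (v * G (v * μ)) := by
    refine ((integrable_gauss hO (differentiableOn_id.mul hG)
      ((PolyBounded.id O).mul ⟨C, n, hC, h⟩) (hMO μ hμ)).const_mul μ⁻¹).congr
      (Eventually.of_forall fun v => ?_)
    simp only [Pi.mul_apply]
    field_simp
  refine hder.congr_deriv ?_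
  have hd : ∀ v : ℝ, HasDerivAt (fun v : ℝ => Complex.exp (-(v : ℂ) ^ 2) * (v * G (v * μ)))
      (Complex.exp (-(v : ℂ) ^ 2) * (G (v * μ) + v * μ * deriv G (v * μ)) -
        2 * (μ ^ 3)⁻¹ * (Complex.exp (-(v : ℂ) ^ 2) * ((v * μ) ^ 2 * G (v * μ) * μ))) v :=
      fun v => by
    have h1 : HasDerivAt (fun v : ℝ => (v : ℂ)) 1 v := Complex.ofRealCLM.hasDerivAt
    refine ((hasDerivAt_cexp_neg_sq v).mul
      (h1.mul (hasDerivAt_line hO hG (hMO μ hμ) v))).congr_deriv ?_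
    simp only [Pi.mul_apply]
    field_simp
    ring
  have := integral_eq_zero_of_hasDerivAt_of_integrable hd (hint.sub (i2.const_mul _)) i3
  rw [integral_sub hint (i2.const_mul _), integral_const_mul] at this
  exact sub_eq_zero.mp this

theorem gaussInt_congr {H : ℂ → ℂ} (h : EqOn G H O) (hμ : ∀ v : ℝ, (v : ℂ) * μ ∈ O) :
    gaussInt G μ = gaussInt H μ := by
  unfold gaussInt
  congr 1
  funext v
  rw [h (hμ v)]

theorem gaussInt_sub_mul {H : ℂ → ℂ} (a b : ℂ) (hO : IsOpen O) (hG : DifferentiableOn ℂ G O)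
    (hb : PolyBounded O G) (hH : DifferentiableOn ℂ H O) (hb' : PolyBounded O H)
    (hμ : ∀ v : ℝ, (v : ℂ) * μ ∈ O) :
    gaussInt (fun ζ => a * G ζ - b * H ζ) μ = a * gaussInt G μ - b * gaussInt H μ := by
  unfold gaussInt
  rw [← integral_const_mul, ← integral_const_mul, ← integral_sub
    ((integrable_gauss_mul hO hG hb hμ).const_mul a)
    ((integrable_gauss_mul hO hH hb' hμ).const_mul b)]
  congr 1
  funext v
  ring

end

/-! ### The integrals attached to a branch -/

namespace IsBranch

variable {r : ℕ} {O : Set ℂ} {U : ℂ → ℂ}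

theorem deriv_mul (h : IsBranch r O U) (hr : 3 ≤ r) {ζ : ℂ} (hζ : ζ ∈ O) :
    U ζ ^ (r - 1) * deriv U ζ = deriv U ζ - 2 * ζ := by
  have := deriv_mul_of_lift hr (h.diff.differentiableAt (h.isOpen.mem_nhds hζ))
    (eventually_of_mem (h.isOpen.mem_nhds hζ) h.eq)
  linear_combination this

/-- U^r is eliminated between the equation g(U) = g(1) - ζ^2 times U' and its derivative times U.
The resulting identity drives both the differential equation and the recursion for the coefficients.
-/
theorem relation (h : IsBranch r O U) (hr : 3 ≤ r) {ζ : ℂ} (hζ : ζ ∈ O) (a : ℕ) :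
    ζ ^ 2 * (U ζ ^ a * deriv U ζ) - 2 / r * (ζ * U ζ ^ (a + 1))
      = ((r : ℂ) - 1) / r * (U ζ ^ (a + 1) * deriv U ζ)
        - ((r : ℂ) - 1) / r * (U ζ ^ a * deriv U ζ) := by
  have h1 := h.deriv_mul hr hζ
  have h2 := h.eq ζ hζ
  rw [nphase_one, nphase] at h2
  have hr0 : (r : ℂ) ≠ 0 := by simp; omega
  have h3 : U ζ ^ r = U ζ * U ζ ^ (r - 1) := by rw [← pow_succ']; congr 1; omega
  rw [h3] at h2
  have e1 : (U ζ * U ζ ^ (r - 1) / r - U ζ - (1 / r - 1 - ζ ^ 2)) * (U ζ ^ a * deriv U ζ) = 0 := by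
    rw [h2]; ring
  have e2 : U ζ ^ (a + 1) / r * (U ζ ^ (r - 1) * deriv U ζ - (deriv U ζ - 2 * ζ)) = 0 := by
    rw [h1]; ring
  rw [pow_succ] at e2 ⊢
  field_simp at e1 e2 ⊢
  linear_combination e1 - e2

theorem polyBounded (h : IsBranch r O U) (hr : 3 ≤ r) : PolyBounded O U := by
  refine ⟨6, 2, by norm_num, fun ζ hζ => ?_⟩
  refine (norm_le_nphase hr _).trans ?_
  rw [h.eq ζ hζ]
  have h1 := norm_sub_le (nphase r 1) (ζ ^ 2)
  have h2 := norm_nphase_one_le hr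
  rw [norm_pow] at h1
  nlinarith [norm_nonneg ζ]

theorem polyBounded_deriv (h : IsBranch r O U) : PolyBounded O (deriv U) := by
  obtain ⟨C, hC⟩ := h.bound
  refine ⟨C, 1, ?_, by simpa using hC⟩
  have := (norm_nonneg _).trans (hC 0 h.zero_mem)
  simpa using this

theorem polyBounded_pow_mul_deriv (h : IsBranch r O U) (hr : 3 ≤ r) (a : ℕ) :
    PolyBounded O (fun ζ => U ζ ^ a * deriv U ζ) :=
  ((h.polyBounded hr).pow a).mul h.polyBounded_deriv

theorem differentiableOn_pow_mul_deriv (h : IsBranch r O U) (a : ℕ) :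
    DifferentiableOn ℂ (fun ζ => U ζ ^ a * deriv U ζ) O :=
  (h.diff.pow a).mul (h.diff.deriv h.isOpen)

theorem deriv_pow (h : IsBranch r O U) (a : ℕ) {ζ : ℂ} (hζ : ζ ∈ O) :
    deriv (fun ζ => U ζ ^ (a + 1)) ζ = (a + 1) * (U ζ ^ a * deriv U ζ) := by
  have := ((h.diff.differentiableAt (h.isOpen.mem_nhds hζ)).hasDerivAt.pow (a + 1)).deriv
  rw [show (fun ζ => U ζ ^ (a + 1)) = U ^ (a + 1) from rfl, this]
  simp
  ring

theorem polyBounded_deriv_pow (h : IsBranch r O U) (hr : 3 ≤ r) (a : ℕ) :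
    PolyBounded O (deriv fun ζ => U ζ ^ (a + 1)) := by
  obtain ⟨C, n, hC, hb⟩ := (PolyBounded.const O ((a : ℂ) + 1)).mul
    (h.polyBounded_pow_mul_deriv hr a)
  exact ⟨C, n, hC, fun ζ hζ => by rw [h.deriv_pow a hζ]; exact hb ζ hζ⟩

/-- The integral of `exp (-v ^ 2) U ^ a dU` over the line `ℝ μ`. -/
noncomputable def moment (U : ℂ → ℂ) (a : ℕ) (μ : ℂ) : ℂ :=
  gaussInt (fun ζ => U ζ ^ a * deriv U ζ) μ

theorem gaussInt_id_mul_pow (h : IsBranch r O U) (hr : 3 ≤ r) (a : ℕ) {μ : ℂ}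
    (hμ : ∀ v : ℝ, (v : ℂ) * μ ∈ O) :
    gaussInt (fun ζ => ζ * U ζ ^ (a + 1)) μ = μ ^ 2 / 2 * ((a + 1) * moment U a μ) := by
  rw [gaussInt_id_mul (G := fun ζ => U ζ ^ (a + 1)) h.isOpen (h.diff.pow _)
    ((h.polyBounded hr).pow _) (h.polyBounded_deriv_pow hr a) hμ,
    gaussInt_congr (fun ζ hζ => h.deriv_pow a hζ) hμ, moment]
  congr 1
  unfold gaussInt
  rw [← integral_const_mul]
  congr 1
  funext v
  ring_nf

theorem gaussInt_sq_mul (h : IsBranch r O U) (hr : 3 ≤ r) (a : ℕ) {μ : ℂ}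
    (hμ : ∀ v : ℝ, (v : ℂ) * μ ∈ O) :
    gaussInt (fun ζ => ζ ^ 2 * (U ζ ^ a * deriv U ζ)) μ
      = ((r : ℂ) - 1) / r * (moment U (a + 1) μ - moment U a μ)
        + μ ^ 2 * (a + 1) / r * moment U a μ := by
  have d1 := h.differentiableOn_pow_mul_deriv a
  have b1 := h.polyBounded_pow_mul_deriv hr a
  have e : gaussInt (fun ζ => 1 * (ζ ^ 2 * (U ζ ^ a * deriv U ζ)) - 2 / r * (ζ * U ζ ^ (a + 1))) μ
      = gaussInt (fun ζ => ((r : ℂ) - 1) / r * (U ζ ^ (a + 1) * deriv U ζ)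
        - ((r : ℂ) - 1) / r * (U ζ ^ a * deriv U ζ)) μ :=
    gaussInt_congr (O := O) (fun ζ hζ => by simpa only [one_mul] using h.relation hr hζ a) hμ
  rw [gaussInt_sub_mul (G := fun ζ => ζ ^ 2 * (U ζ ^ a * deriv U ζ))
    (H := fun ζ => ζ * U ζ ^ (a + 1)) 1 (2 / r) h.isOpen ((differentiableOn_id.pow 2).mul d1)
    (((PolyBounded.id O).pow 2).mul b1) (differentiableOn_id.mul (h.diff.pow (a + 1)))
    ((PolyBounded.id O).mul ((h.polyBounded hr).pow (a + 1))) hμ,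
    gaussInt_sub_mul _ _ h.isOpen (h.differentiableOn_pow_mul_deriv (a + 1))
    (h.polyBounded_pow_mul_deriv hr (a + 1)) d1 b1 hμ, ← moment, ← moment,
    h.gaussInt_id_mul_pow hr a hμ, one_mul] at e
  rw [sub_eq_iff_eq_add.mp e]
  ring

theorem hasDerivAt_moment (h : IsBranch r O U) (hr : 3 ≤ r) (a : ℕ) {M : Set ℂ} (hM : IsOpen M)
    (hMO : ∀ ν ∈ M, ∀ v : ℝ, (v : ℂ) * ν ∈ O) {μ : ℂ} (hμ : μ ∈ M) (hμ0 : μ ≠ 0) :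
    HasDerivAt (moment U a) (2 * (μ ^ 3)⁻¹ *
      (((r : ℂ) - 1) / r * (moment U (a + 1) μ - moment U a μ)
        + μ ^ 2 * (a + 1) / r * moment U a μ)) μ := by
  rw [← h.gaussInt_sq_mul hr a (hMO μ hμ)]
  exact hasDerivAt_gaussInt h.isOpen (h.differentiableOn_pow_mul_deriv a)
    (h.polyBounded_pow_mul_deriv hr a) hM hMO hμ hμ0

/-- U^(r-1) U' and U' differ by 2ζ, whose Gaussian integral over a line vanishes. -/
theorem moment_cycle (h : IsBranch r O U) (hr : 3 ≤ r) {μ : ℂ}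
    (hμ : ∀ v : ℝ, (v : ℂ) * μ ∈ O) : moment U (r - 1) μ = moment U 0 μ := by
  have h0 : gaussInt (fun ζ => ζ * (1 : ℂ)) μ = 0 := by
    rw [gaussInt_id_mul (G := fun _ => 1) h.isOpen (differentiableOn_const _)
      (PolyBounded.const O 1) (by simpa using PolyBounded.const O 0) hμ]
    simp [gaussInt]
  have e : moment U (r - 1) μ
      = gaussInt (fun ζ => 1 * (U ζ ^ 0 * deriv U ζ) - 2 * (ζ * 1)) μ :=
    gaussInt_congr (O := O) (fun ζ hζ => by
      have := h.deriv_mul hr hζ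
      simp only [this]; ring) hμ
  rw [e, gaussInt_sub_mul (G := fun ζ => U ζ ^ 0 * deriv U ζ) (H := fun ζ => ζ * 1) 1 2 h.isOpen
    (h.differentiableOn_pow_mul_deriv 0) (h.polyBounded_pow_mul_deriv hr 0)
    (differentiableOn_id.mul (differentiableOn_const 1))
    ((PolyBounded.id O).mul (PolyBounded.const O 1)) hμ, h0, moment]
  ring

/-- The integral of `w ^ a exp (w ^ r / r - t w) dw` over the thimble, for
`t = exp ((r - 1) Λ)` and the critical point `exp Λ`. -/
noncomputable def thimbleInt (r : ℕ) (U : ℂ → ℂ) (a : ℕ) (Λ : ℂ) : ℂ :=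
  Complex.exp ((a + 1) * Λ + nphase r 1 * Complex.exp (r * Λ))
    * moment U a (Complex.exp (-(r * Λ / 2)))

/-- With μ = exp(-rΛ/2), differentiating the moment contributes -(r-1) exp(rΛ) (moment (a+1) -
moment a) - (a+1) moment a. The terms in moment a cancel against the derivative of the prefactor,
because r·g(1) = 1 - r. -/
theorem hasDerivAt_thimbleInt (h : IsBranch r O U) (hr : 3 ≤ r) (a : ℕ) {M : Set ℂ}
    (hM : IsOpen M) (hMO : ∀ ν ∈ M, ∀ v : ℝ, (v : ℂ) * ν ∈ O) {Λ : ℂ}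
    (hΛ : Complex.exp (-(r * Λ / 2)) ∈ M) :
    HasDerivAt (thimbleInt r U a)
      (-(((r : ℂ) - 1) * Complex.exp ((r - 1) * Λ)) * thimbleInt r U (a + 1) Λ) Λ := by
  set μ := Complex.exp (-(r * Λ / 2)) with hμ
  have hμ0 : μ ≠ 0 := Complex.exp_ne_zero _
  have hr0 : (r : ℂ) ≠ 0 := by simp; omega
  have h1 : HasDerivAt (fun Λ : ℂ => (r : ℂ) * Λ) r Λ := by
    simpa using (hasDerivAt_id Λ).const_mul (r : ℂ)
  have h2 : HasDerivAt (fun Λ : ℂ => Complex.exp (-(r * Λ / 2))) (μ * (-(r / 2))) Λ :=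
    ((h1.div_const 2).neg).cexp
  have h3 := (h.hasDerivAt_moment hr a hM hMO hΛ hμ0).comp Λ h2
  have h4 : HasDerivAt (fun Λ : ℂ => Complex.exp ((a + 1) * Λ + nphase r 1 * Complex.exp (r * Λ)))
      (Complex.exp ((a + 1) * Λ + nphase r 1 * Complex.exp (r * Λ)) *
        ((a + 1) + nphase r 1 * (Complex.exp (r * Λ) * r))) Λ := by
    have h5 : HasDerivAt (fun Λ : ℂ => ((a : ℂ) + 1) * Λ) (a + 1) Λ := by
      simpa using (hasDerivAt_id Λ).const_mul ((a : ℂ) + 1)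
    exact (h5.add (h1.cexp.const_mul _)).cexp
  refine (h4.mul h3).congr_deriv ?_
  have hl : Complex.exp (r * Λ) = (μ ^ 2)⁻¹ := by
    rw [hμ, ← Complex.exp_nat_mul, ← Complex.exp_neg]; congr 1; push_cast; ring
  have h6 : Complex.exp ((r - 1) * Λ) * Complex.exp (((a + 1 : ℕ) + 1) * Λ +
      nphase r 1 * Complex.exp (r * Λ))
        = Complex.exp ((a + 1) * Λ + nphase r 1 * Complex.exp (r * Λ))
        * Complex.exp (r * Λ) := by
    rw [← Complex.exp_add, ← Complex.exp_add]; congr 1; push_cast; ring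
  simp only [thimbleInt, Function.comp_apply, ← hμ]
  have e : -(((r : ℂ) - 1) * Complex.exp ((r - 1) * Λ)) *
      (Complex.exp (((a + 1 : ℕ) + 1) * Λ + nphase r 1 * Complex.exp (r * Λ)) * moment U (a + 1) μ)
      = -((r : ℂ) - 1) * (Complex.exp ((a + 1) * Λ + nphase r 1 * Complex.exp (r * Λ))
        * Complex.exp (r * Λ)) * moment U (a + 1) μ := by rw [← h6]; ring
  rw [e, nphase_one]
  set E := Complex.exp ((a + 1) * Λ + (1 / r - 1) * Complex.exp (r * Λ))
  rw [hl]
  field_simp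
  ring

end IsBranch

end HyperAiry

namespace HyperAiry
open Set Metric MeasureTheory

/-! ### Taylor coefficients -/

/-- The `n`-th Taylor coefficient of `f` at `0`. -/
noncomputable def taylorCoeff (f : ℂ → ℂ) (n : ℕ) : ℂ := iteratedDeriv n f 0 / n.factorial

theorem taylorCoeff_congr {f g : ℂ → ℂ} (h : f =ᶠ[𝓝 0] g) (n : ℕ) :
    taylorCoeff f n = taylorCoeff g n := by
  rw [taylorCoeff, h.iteratedDeriv_eq, taylorCoeff]

theorem taylorCoeff_zero (f : ℂ → ℂ) : taylorCoeff f 0 = f 0 := by simp [taylorCoeff]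

theorem taylorCoeff_deriv (f : ℂ → ℂ) (n : ℕ) :
    taylorCoeff (deriv f) n = (n + 1) * taylorCoeff f (n + 1) := by
  have h : ((n.factorial : ℕ) : ℂ) ≠ 0 := by exact_mod_cast n.factorial_ne_zero
  have h' : (n : ℂ) + 1 ≠ 0 := by exact_mod_cast n.succ_ne_zero
  rw [taylorCoeff, taylorCoeff, iteratedDeriv_succ', Nat.factorial_succ]
  push_cast
  field_simp

theorem taylorCoeff_sub_mul {f g : ℂ → ℂ} (hf : AnalyticAt ℂ f 0) (hg : AnalyticAt ℂ g 0)
    (a b : ℂ) (n : ℕ) : taylorCoeff (fun z => a * f z - b * g z) n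
      = a * taylorCoeff f n - b * taylorCoeff g n := by
  have h1 : ContDiffAt ℂ n (fun z => a * f z) 0 := (analyticAt_const.mul hf).contDiffAt
  have h2 : ContDiffAt ℂ n (fun z => b * g z) 0 := (analyticAt_const.mul hg).contDiffAt
  have := iteratedDeriv_sub h1 h2
  rw [taylorCoeff, show (fun z => a * f z - b * g z)
    = (fun z => a * f z) - fun z => b * g z from rfl, this,
    iteratedDeriv_const_mul_field, iteratedDeriv_const_mul_field, taylorCoeff, taylorCoeff]
  ring

theorem taylorCoeff_id_mul {f : ℂ → ℂ} (hf : AnalyticAt ℂ f 0) (n : ℕ) :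
    taylorCoeff (fun z => z * f z) (n + 1) = taylorCoeff f n := by
  have := iteratedDeriv_mul (n := n + 1) (x := (0 : ℂ)) (f := id) (g := f)
    analyticAt_id.contDiffAt hf.contDiffAt
  rw [taylorCoeff, show (fun z => z * f z) = id * f from rfl, this,
    Finset.sum_eq_single 1]
  · have h : ((n.factorial : ℕ) : ℂ) ≠ 0 := by exact_mod_cast n.factorial_ne_zero
    have h' : (n : ℂ) + 1 ≠ 0 := by exact_mod_cast n.succ_ne_zero
    simp only [iteratedDeriv_id, taylorCoeff, Nat.choose_one_right, Nat.factorial_succ,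
      Nat.add_sub_cancel]
    push_cast
    field_simp
  · intro i _ hi
    rw [iteratedDeriv_id]
    by_cases h0 : i = 0 <;> simp [h0, hi]
  · intro h
    exact absurd (Finset.mem_range.mpr (by omega)) h

/-! ### Gaussian moments -/

/-- The `n`-th moment of `exp (-v ^ 2)`. -/
noncomputable def gaussMoment (n : ℕ) : ℂ := ∫ v : ℝ, Complex.exp (-(v : ℂ) ^ 2) * (v : ℂ) ^ n

theorem gaussInt_pow (n : ℕ) (μ : ℂ) :
    gaussInt (fun ζ => ζ ^ n) μ = gaussMoment n * μ ^ (n + 1) := by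
  rw [gaussInt, gaussMoment, ← integral_mul_const]
  congr 1
  funext v
  ring

theorem gaussMoment_one : gaussMoment 1 = 0 := by
  have h := gaussInt_id_mul (O := univ) (G := fun _ => 1) (μ := 1) isOpen_univ
    (differentiableOn_const _) (PolyBounded.const _ 1) (by simpa using PolyBounded.const univ 0)
    (fun _ => mem_univ _)
  have h1 := gaussInt_pow 1 1
  simp only [pow_one, mul_one, one_pow] at h h1
  rw [← h1, h]
  simp [gaussInt]

theorem gaussMoment_add_two (n : ℕ) : gaussMoment (n + 2) = (n + 1) / 2 * gaussMoment n := by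
  have hd : deriv (fun ζ : ℂ => ζ ^ (n + 1)) = fun ζ => ((n : ℂ) + 1) * ζ ^ n := by
    funext ζ
    simp
  have h := gaussInt_id_mul (O := univ) (G := fun ζ => ζ ^ (n + 1)) (μ := 1) isOpen_univ
    (differentiable_pow _).differentiableOn ((PolyBounded.id _).pow _) (by
      rw [hd]; exact (PolyBounded.const _ _).mul ((PolyBounded.id _).pow _))
    (fun _ => mem_univ _)
  have h1 := gaussInt_pow (n + 2) 1
  have h2 := gaussInt_pow n 1
  rw [hd] at h
  have h3 : gaussInt (fun ζ => ((n : ℂ) + 1) * ζ ^ n) 1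
      = ((n : ℂ) + 1) * gaussInt (fun ζ => ζ ^ n) 1 := by
    unfold gaussInt
    rw [← integral_const_mul]
    congr 1
    funext v
    ring
  have h4 : (fun ζ : ℂ => ζ * ζ ^ (n + 1)) = fun ζ => ζ ^ (n + 2) := by
    funext ζ; ring
  rw [h4, h1, h3, h2] at h
  simp only [one_pow, mul_one] at h
  rw [h]; ring

theorem gaussMoment_odd (n : ℕ) : gaussMoment (2 * n + 1) = 0 := by
  induction n with
  | zero => exact gaussMoment_one
  | succ n ih =>
    rw [show 2 * (n + 1) + 1 = 2 * n + 1 + 2 by ring, gaussMoment_add_two, ih, mul_zero]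

theorem gaussMoment_zero : gaussMoment 0 = (Real.sqrt Real.pi : ℂ) := by
  have h := integral_gaussian 1
  rw [div_one] at h
  rw [gaussMoment, ← h, ← integral_complex_ofReal]
  congr 1
  funext v
  push_cast
  simp

theorem gaussMoment_zero_ne : gaussMoment 0 ≠ 0 := by
  rw [gaussMoment_zero]
  exact_mod_cast (Real.sqrt_pos.mpr Real.pi_pos).ne'

/-! ### Watson's lemma -/

theorem PolyBounded.sub {O : Set ℂ} {G H : ℂ → ℂ} (hG : PolyBounded O G) (hH : PolyBounded O H) :
    PolyBounded O (fun ζ => G ζ - H ζ) := by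
  obtain ⟨C, n, hC, h⟩ := hG
  obtain ⟨D, m, hD, h'⟩ := hH
  refine ⟨C + D, n + m, by positivity, fun ζ hζ => ?_⟩
  have h1 : (1 : ℝ) ≤ 1 + ‖ζ‖ := by linarith [norm_nonneg ζ]
  calc _ ≤ C * (1 + ‖ζ‖) ^ n + D * (1 + ‖ζ‖) ^ m :=
        (norm_sub_le _ _).trans (add_le_add (h ζ hζ) (h' ζ hζ))
    _ ≤ C * (1 + ‖ζ‖) ^ (n + m) + D * (1 + ‖ζ‖) ^ (n + m) := by
        gcongr <;> first | exact h1 | omega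
    _ = _ := by ring

theorem PolyBounded.sum {O : Set ℂ} {G : ℕ → ℂ → ℂ} (hG : ∀ n, PolyBounded O (G n)) (N : ℕ) :
    PolyBounded O (fun ζ => ∑ n ∈ Finset.range N, G n ζ) := by
  induction N with
  | zero => simpa using PolyBounded.const O 0
  | succ N ih =>
    have h := ih.sub ((PolyBounded.const O (-1)).mul (hG N))
    refine (show (fun ζ => ∑ n ∈ Finset.range (N + 1), G n ζ) = _ from ?_) ▸ h
    funext ζ
    rw [Finset.sum_range_succ]; ring

/-- Near 0 this is Taylor's theorem. For ‖ζ‖ ≥ ε polynomial growth suffices, since then (‖ζ‖/ε)^N ≥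
1. -/
theorem taylor_remainder_bound {O : Set ℂ} {G : ℂ → ℂ} (hO : IsOpen O) (h0 : (0 : ℂ) ∈ O)
    (hG : DifferentiableOn ℂ G O) (hb : PolyBounded O G) (N : ℕ) :
    ∃ (C : ℝ) (m : ℕ), 0 ≤ C ∧ ∀ ζ ∈ O,
      ‖G ζ - ∑ j ∈ Finset.range N, taylorCoeff G j * ζ ^ j‖ ≤ C * ‖ζ‖ ^ N * (1 + ‖ζ‖) ^ m := by
  have han : AnalyticAt ℂ G 0 := hG.analyticAt (hO.mem_nhds h0)
  have hO1 := han.hasFPowerSeriesAt.isBigO_sub_partialSum_pow N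
  have hps : ∀ ζ : ℂ, (FormalMultilinearSeries.ofScalars ℂ
      fun n => iteratedDeriv n G 0 / n.factorial).partialSum N ζ
        = ∑ j ∈ Finset.range N, taylorCoeff G j * ζ ^ j := fun ζ => by
    simp only [FormalMultilinearSeries.partialSum, FormalMultilinearSeries.ofScalars_apply_eq,
      taylorCoeff, smul_eq_mul]
  simp only [hps, zero_add] at hO1
  obtain ⟨C₁, hC₁, hev⟩ := hO1.exists_nonneg
  rw [Asymptotics.isBigOWith_iff] at hev
  obtain ⟨ε, hε, hball⟩ := Metric.eventually_nhds_iff_ball.mp hev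
  obtain ⟨C₂, m, hC₂, h2⟩ := hb.sub (PolyBounded.sum (O := O)
    (G := fun j ζ => taylorCoeff G j * ζ ^ j)
    (fun j => (PolyBounded.const O _).mul ((PolyBounded.id O).pow j)) N)
  refine ⟨C₁ + C₂ / ε ^ N, m, by positivity, fun ζ hζ => ?_⟩
  have h1 : (1 : ℝ) ≤ (1 + ‖ζ‖) ^ m := one_le_pow₀ (by linarith [norm_nonneg ζ])
  have hn : 0 ≤ ‖ζ‖ ^ N := by positivity
  by_cases hlt : ‖ζ‖ < ε
  · have := hball ζ (by simpa using hlt)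
    rw [norm_pow, norm_norm] at this
    calc _ ≤ C₁ * ‖ζ‖ ^ N := this
      _ ≤ C₁ * ‖ζ‖ ^ N * (1 + ‖ζ‖) ^ m := le_mul_of_one_le_right (by positivity) h1
      _ ≤ _ := by gcongr; exact le_add_of_nonneg_right (by positivity)
  · push Not at hlt
    have h3 : 1 ≤ ‖ζ‖ ^ N / ε ^ N := by
      rw [le_div_iff₀ (by positivity), one_mul]; gcongr
    calc _ ≤ C₂ * (1 + ‖ζ‖) ^ m := h2 ζ hζ
      _ ≤ C₂ * (1 + ‖ζ‖) ^ m * (‖ζ‖ ^ N / ε ^ N) := le_mul_of_one_le_right (by positivity) h3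
      _ = C₂ / ε ^ N * ‖ζ‖ ^ N * (1 + ‖ζ‖) ^ m := by ring
      _ ≤ _ := by gcongr; exact le_add_of_nonneg_left hC₁

/-- The Taylor polynomial integrates to Gaussian moments. As ‖μ‖ ≤ 1, the remainder is dominated by
‖μ‖^(N+1) times a fixed integrable weight, so C depends neither on ‖μ‖ nor on the direction of the
line. -/
theorem gaussInt_expansion {O : Set ℂ} {G : ℂ → ℂ} (hO : IsOpen O) (h0 : (0 : ℂ) ∈ O)
    (hG : DifferentiableOn ℂ G O) (hb : PolyBounded O G) (N : ℕ) :
    ∃ C : ℝ, ∀ μ : ℂ, ‖μ‖ ≤ 1 → (∀ v : ℝ, (v : ℂ) * μ ∈ O) →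
      ‖gaussInt G μ - ∑ j ∈ Finset.range N, taylorCoeff G j * gaussMoment j * μ ^ (j + 1)‖
        ≤ C * ‖μ‖ ^ (N + 1) := by
  obtain ⟨C, m, hC, h⟩ := taylor_remainder_bound hO h0 hG hb N
  refine ⟨C * ∫ v : ℝ, (1 + 1 * |v|) ^ (N + m) * Real.exp (-v ^ 2), fun μ hμ1 hμ => ?_⟩
  have hint : ∀ j, Integrable fun v : ℝ =>
      Complex.exp (-(v : ℂ) ^ 2) * (taylorCoeff G j * (v * μ) ^ j * μ) := fun j =>
    integrable_gauss_mul (G := fun ζ => taylorCoeff G j * ζ ^ j) hO (by fun_prop)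
      ((PolyBounded.const O _).mul ((PolyBounded.id O).pow j)) hμ
  have e : gaussInt G μ - ∑ j ∈ Finset.range N, taylorCoeff G j * gaussMoment j * μ ^ (j + 1)
      = ∫ v : ℝ, Complex.exp (-(v : ℂ) ^ 2) *
        ((G (v * μ) - ∑ j ∈ Finset.range N, taylorCoeff G j * (v * μ) ^ j) * μ) := by
    have h1 : ∀ j, taylorCoeff G j * gaussMoment j * μ ^ (j + 1)
        = ∫ v : ℝ, Complex.exp (-(v : ℂ) ^ 2) * (taylorCoeff G j * (v * μ) ^ j * μ) := fun j => by
      rw [mul_assoc, ← gaussInt_pow, gaussInt, ← integral_const_mul]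
      congr 1
      funext v
      ring
    simp only [h1]
    rw [← integral_finsetSum _ fun j _ => hint j, gaussInt,
      ← integral_sub (integrable_gauss_mul hO hG hb hμ) (integrable_finsetSum _ fun j _ => hint j)]
    congr 1
    funext v
    rw [sub_mul, mul_sub, Finset.sum_mul, Finset.mul_sum]
  rw [e]
  refine (norm_integral_le_of_norm_le (((integrable_weight 1 (N + m)).const_mul
    (C * ‖μ‖ ^ (N + 1)))) (Eventually.of_forall fun v => ?_)).trans ?_
  · have h1 := h _ (hμ v)
    have h2 : ‖(v : ℂ) * μ‖ = |v| * ‖μ‖ := by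
      rw [norm_mul, Complex.norm_real, Real.norm_eq_abs]
    have h3 : |v| * ‖μ‖ ≤ |v| := mul_le_of_le_one_right (abs_nonneg _) hμ1
    rw [norm_mul, norm_mul, norm_cexp_neg_sq]
    rw [h2] at h1
    calc _ ≤ Real.exp (-v ^ 2) * (C * (|v| * ‖μ‖) ^ N * (1 + |v| * ‖μ‖) ^ m * ‖μ‖) := by gcongr
      _ ≤ Real.exp (-v ^ 2) * (C * ((1 + |v|) ^ N * ‖μ‖ ^ N) * (1 + |v|) ^ m * ‖μ‖) := by
        rw [mul_pow]
        gcongr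
        linarith
      _ = _ := by rw [one_mul]; ring
  · rw [integral_const_mul]
    exact le_of_eq (by ring)

theorem gaussInt_even_expansion {O : Set ℂ} {G : ℂ → ℂ} (hO : IsOpen O) (h0 : (0 : ℂ) ∈ O)
    (hG : DifferentiableOn ℂ G O) (hb : PolyBounded O G) (N : ℕ) :
    ∃ C : ℝ, ∀ μ : ℂ, ‖μ‖ ≤ 1 → (∀ v : ℝ, (v : ℂ) * μ ∈ O) →
      ‖gaussInt G μ - μ * ∑ m ∈ Finset.range N,
        taylorCoeff G (2 * m) * gaussMoment (2 * m) * (μ ^ 2) ^ m‖ ≤ C * ‖μ * (μ ^ 2) ^ N‖ := by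
  obtain ⟨C, h⟩ := gaussInt_expansion hO h0 hG hb (2 * N)
  refine ⟨C, fun μ hμ1 hμ => ?_⟩
  have e : ∀ N : ℕ, ∑ j ∈ Finset.range (2 * N), taylorCoeff G j * gaussMoment j * μ ^ (j + 1)
      = μ * ∑ m ∈ Finset.range N, taylorCoeff G (2 * m) * gaussMoment (2 * m) * (μ ^ 2) ^ m := by
    intro N
    induction N with
    | zero => simp
    | succ N ih =>
      rw [show 2 * (N + 1) = 2 * N + 1 + 1 by ring, Finset.sum_range_succ,
        Finset.sum_range_succ, ih,
        Finset.sum_range_succ, gaussMoment_odd]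
      ring
  have := h μ hμ1 hμ
  rw [e] at this
  refine this.trans (le_of_eq ?_)
  rw [norm_mul, norm_pow, norm_pow]
  ring

/-! ### The coefficients of the expansions -/

/-- Uniqueness of the numbers `P_m(r,a)` among complex numbers. -/
theorem eq_ppz_of_relations {r : ℕ} (hr : 3 ≤ r) {Q : ℕ → ℕ → ℂ}
    (init : ∀ a, a ≤ r - 1 → Q 0 a = 1)
    (step : ∀ m a, a + 1 ≤ r - 1 → Q (m + 1) (a + 1) - Q (m + 1) a
      = r * ((m : ℂ) + 1 / 2 - (a + 1) / r) * Q m a)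
    (cycle : ∀ m, Q m 0 = Q m (r - 1)) (m a : ℕ) (ha : a ≤ r - 1) : Q m a = (ppz r m a : ℂ) := by
  have hP := ppz_isPPZ r hr
  have hr0 : (r : ℂ) ≠ 0 := by simp; omega
  set D : ℕ → ℕ → ℂ := fun m a => Q m a - (ppz r m a : ℂ) with hD
  have hstep : ∀ m a, a + 1 ≤ r - 1 → D (m + 1) (a + 1) - D (m + 1) a
      = r * ((m : ℂ) + 1 / 2 - (a + 1) / r) * D m a := by
    intro m a ha
    have h1 := step m a ha
    have h2 := congrArg (fun q : ℚ => (q : ℂ)) (hP.step (m + 1) (a + 1) (by omega) (by omega) ha)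
    simp only [Nat.add_sub_cancel] at h2
    push_cast at h2
    simp only [hD]
    linear_combination h1 - h2
  have hcyc : ∀ m, D m 0 = D m (r - 1) := fun m => by
    simp only [hD]; rw [cycle m, hP.cycle m]
  suffices h : ∀ m a, a ≤ r - 1 → D m a = 0 from sub_eq_zero.mp (h m a ha)
  intro m
  induction m with
  | zero => intro a ha; simp [hD, init a ha, hP.init a ha]
  | succ m ih =>
    -- Vanishing at order m makes the difference at order m + 1 independent of a. Summing the
    -- relations of order m + 2 over a full cycle then gives r(r-1)(m+1) times that constant, which
    -- must be 0.
    have hconst : ∀ a, a ≤ r - 1 → D (m + 1) a = D (m + 1) 0 := by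
      intro a
      induction a with
      | zero => simp
      | succ a iha =>
        intro ha
        have := hstep m a ha
        rw [ih a (by omega), mul_zero, iha (by omega)] at this
        exact sub_eq_zero.mp this
    have hsum : ∀ a, a ≤ r - 1 → D (m + 2) a - D (m + 2) 0
        = (ppzSum r (m + 2) (fun _ => 1) a : ℂ) * D (m + 1) 0 := by
      intro a
      induction a with
      | zero => simp [ppzSum]
      | succ a iha =>
        intro ha
        have h1 := hstep (m + 1) a ha
        have h2 := iha (by omega)
        rw [hconst a (by omega)] at h1
        simp only [ppzSum] at h2 ⊢
        rw [Finset.sum_range_succ]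
        push_cast at h1 h2 ⊢
        linear_combination h1 + h2
    have h1 := hsum (r - 1) le_rfl
    rw [← hcyc, sub_self, ppzSum_const r _ hr] at h1
    have h2 : ((r * ((r : ℚ) - 1) * (((m + 2 : ℕ) : ℚ) - 1) * 1 : ℚ) : ℂ) ≠ 0 := by
      rw [Rat.cast_ne_zero]
      have h3 : (3 : ℚ) ≤ r := by exact_mod_cast hr
      have h4 : (0 : ℚ) ≤ m := Nat.cast_nonneg m
      have h5 : (0 : ℚ) < r - 1 := by linarith
      have h6 : (0 : ℚ) < ((m + 2 : ℕ) : ℚ) - 1 := by push_cast; linarith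
      positivity
    have h3 : D (m + 1) 0 = 0 := (mul_eq_zero.mp h1.symm).resolve_left h2
    intro a ha
    rw [hconst a ha, h3]

namespace IsBranch

variable {r : ℕ} {O : Set ℂ} {U : ℂ → ℂ}

theorem analyticAt_zero (h : IsBranch r O U) : AnalyticAt ℂ U 0 :=
  h.diff.analyticAt (h.isOpen.mem_nhds h.zero_mem)

/-- Comparing Taylor coefficients in `relation` relates orders 2m + 2 and 2m; the moment ratio
(2m+1)/2 converts this into the factor r(m + 1/2 - (a+1)/r) of the recursion. The cyclic condition
holds because 2ζ has no even coefficients. -/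
theorem taylorCoeff_eq (h : IsBranch r O U) (hr : 3 ≤ r) (m a : ℕ) (ha : a ≤ r - 1) :
    taylorCoeff (fun ζ => U ζ ^ a * deriv U ζ) (2 * m) * gaussMoment (2 * m)
      = kappa r * (Real.sqrt Real.pi : ℂ) * (ppz r m a : ℂ) * (((r : ℂ) - 1) ^ m)⁻¹ := by
  have hr0 : (r : ℂ) ≠ 0 := by simp; omega
  have hr1 : (r : ℂ) - 1 ≠ 0 := by
    rw [sub_ne_zero]; exact_mod_cast (by omega : r ≠ 1)
  have hκ := kappa_ne_zero hr
  have hg := gaussMoment_zero_ne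
  have hO := h.isOpen.mem_nhds h.zero_mem
  have hU := h.analyticAt_zero
  have hF : ∀ a, AnalyticAt ℂ (fun ζ => U ζ ^ a * deriv U ζ) 0 := fun a =>
    (hU.pow a).mul hU.deriv
  set E : ℕ → ℕ → ℂ := fun a j => taylorCoeff (fun ζ => U ζ ^ a * deriv U ζ) j with hE
  have hE0 : ∀ a, E a 0 = kappa r := fun a => by
    simp only [hE]
    rw [taylorCoeff_zero, h.zero, h.deriv_zero, one_pow, one_mul]
  have hEc : ∀ m, E (r - 1) (2 * m) = E 0 (2 * m) := fun m => by
    have h1 : (fun ζ => U ζ ^ (r - 1) * deriv U ζ) =ᶠ[𝓝 0]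
        fun ζ => 1 * (U ζ ^ 0 * deriv U ζ) - 2 * ζ := by
      filter_upwards [hO] with ζ hζ
      rw [h.deriv_mul hr hζ]; ring
    simp only [hE]
    rw [taylorCoeff_congr h1, taylorCoeff_sub_mul (g := fun ζ => ζ) (hF 0) analyticAt_id, one_mul]
    have h2 : taylorCoeff (fun ζ : ℂ => ζ) (2 * m) = 0 := by
      have := iteratedDeriv_id (n := 2 * m) (x := (0 : ℂ))
      rw [taylorCoeff, show (fun ζ : ℂ => ζ) = id from rfl, this]
      have : ¬ 2 * m = 1 := by omega
      simp [this]
    rw [h2]; ring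
  have hEs : ∀ m a, ((r : ℂ) - 1) / r * (E (a + 1) (2 * m + 2) - E a (2 * m + 2))
      = E a (2 * m) - 2 / r * ((a + 1) * E a (2 * m) / (2 * m + 1)) := fun m a => by
    have h1 : (fun ζ => 1 * (ζ * (ζ * (U ζ ^ a * deriv U ζ))) - 2 / r * (ζ * U ζ ^ (a + 1)))
        =ᶠ[𝓝 0] fun ζ => ((r : ℂ) - 1) / r * (U ζ ^ (a + 1) * deriv U ζ)
        - ((r : ℂ) - 1) / r * (U ζ ^ a * deriv U ζ) := by
      filter_upwards [hO] with ζ hζ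
      rw [← h.relation hr hζ a]; ring
    have h2 := taylorCoeff_congr h1 (2 * m + 2)
    have h3 : AnalyticAt ℂ (fun ζ => ζ * (U ζ ^ a * deriv U ζ)) 0 := analyticAt_id.mul (hF a)
    have h4 : AnalyticAt ℂ (fun ζ => U ζ ^ (a + 1)) 0 := hU.pow _
    rw [taylorCoeff_sub_mul (hF (a + 1)) (hF a),
      taylorCoeff_sub_mul (f := fun ζ => ζ * (ζ * (U ζ ^ a * deriv U ζ)))
        (g := fun ζ => ζ * U ζ ^ (a + 1)) (analyticAt_id.mul h3) (analyticAt_id.mul h4),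
      taylorCoeff_id_mul h3 (2 * m + 1), taylorCoeff_id_mul (hF a) (2 * m),
      taylorCoeff_id_mul h4 (2 * m + 1)] at h2
    have h5 := taylorCoeff_deriv (fun ζ => U ζ ^ (a + 1)) (2 * m)
    have h6 : deriv (fun ζ => U ζ ^ (a + 1)) =ᶠ[𝓝 0]
        fun ζ => ((a : ℂ) + 1) * (U ζ ^ a * deriv U ζ) - 0 * (U ζ ^ a * deriv U ζ) := by
      filter_upwards [hO] with ζ hζ
      rw [h.deriv_pow a hζ]; ring
    rw [taylorCoeff_congr h6, taylorCoeff_sub_mul (hF a) (hF a)] at h5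
    have h7 : (2 * (m : ℂ) + 1) ≠ 0 := by exact_mod_cast (2 * m).succ_ne_zero
    push_cast at h5
    simp only [hE]
    have h8 : taylorCoeff (fun ζ => U ζ ^ (a + 1)) (2 * m + 1)
        = ((a : ℂ) + 1) * taylorCoeff (fun ζ => U ζ ^ a * deriv U ζ) (2 * m) / (2 * m + 1) := by
      rw [eq_div_iff h7]; linear_combination -h5
    rw [h8] at h2
    linear_combination -h2
  -- The normalization divides by the order-zero term κ√π and absorbs the factor 1/(r-1) produced at
  -- each step.
  have hmain := eq_ppz_of_relations hr
    (Q := fun m a => E a (2 * m) * gaussMoment (2 * m) * ((r : ℂ) - 1) ^ m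
      / (kappa r * gaussMoment 0))
    (fun a _ => by simp only [mul_zero, pow_zero, hE0]; field_simp)
    (fun m a _ => by
      have h1 := hEs m a
      have h7 : (2 * (m : ℂ) + 1) ≠ 0 := by exact_mod_cast (2 * m).succ_ne_zero
      have h2 : E (a + 1) (2 * m + 2) = E a (2 * m + 2) + r / ((r : ℂ) - 1) *
          (E a (2 * m) - 2 / r * ((a + 1) * E a (2 * m) / (2 * m + 1))) := by
        rw [← h1]; field_simp; ring
      simp only [show 2 * (m + 1) = 2 * m + 2 by ring]
      rw [gaussMoment_add_two, h2]
      push_cast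
      field_simp
      ring)
    (fun m => by simp only [hEc]) m a ha
  simp only [hE] at hmain
  rw [← hmain, ← gaussMoment_zero]
  have : ((r : ℂ) - 1) ^ m ≠ 0 := pow_ne_zero _ hr1
  field_simp

/-- The asymptotic expansion of the moments of the branch. -/
theorem moment_expansion (h : IsBranch r O U) (hr : 3 ≤ r) (a : ℕ) (ha : a ≤ r - 1) (N : ℕ) :
    ∃ C : ℝ, ∀ μ : ℂ, ‖μ‖ ≤ 1 → (∀ v : ℝ, (v : ℂ) * μ ∈ O) →
      ‖moment U a μ - kappa r * (Real.sqrt Real.pi : ℂ) * μ *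
        ∑ m ∈ Finset.range N, (ppz r m a : ℂ) * (μ ^ 2 / ((r : ℂ) - 1)) ^ m‖
        ≤ C * ‖μ * (μ ^ 2) ^ N‖ := by
  obtain ⟨C, hC⟩ := gaussInt_even_expansion h.isOpen h.zero_mem
    (h.differentiableOn_pow_mul_deriv a) (h.polyBounded_pow_mul_deriv hr a) N
  refine ⟨C, fun μ h1 h2 => ?_⟩
  have := hC μ h1 h2
  rw [moment]
  have e : kappa r * (Real.sqrt Real.pi : ℂ) * μ *
      ∑ m ∈ Finset.range N, (ppz r m a : ℂ) * (μ ^ 2 / ((r : ℂ) - 1)) ^ m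
      = μ * ∑ m ∈ Finset.range N, taylorCoeff (fun ζ => U ζ ^ a * deriv U ζ) (2 * m) *
        gaussMoment (2 * m) * (μ ^ 2) ^ m := by
    rw [Finset.mul_sum, Finset.mul_sum]
    refine Finset.sum_congr rfl fun m _ => ?_
    rw [h.taylorCoeff_eq hr m a ha, div_pow]
    ring
  rwa [e]

end IsBranch

end HyperAiry

namespace HyperAiry
open Set Metric

/-! ### Logarithmic coordinates -/

/-- A logarithm of the `k`-th critical point. -/
noncomputable def logCrit (r : ℕ) (α : ℝ) (k : ℕ) (t : ℂ) : ℂ :=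
  (2 * Real.pi * Complex.I * k + logBranch α t) / ((r : ℂ) - 1)

/-- The direction in which the branch of the inverse of the phase is integrated. -/
noncomputable def direction (r : ℕ) (α : ℝ) (k : ℕ) (t : ℂ) : ℂ :=
  Complex.exp (-(r * logCrit r α k t / 2))

/-- The plane without the branch cut. -/
def cutPlane (α : ℝ) : Set ℂ := {t | t * Complex.exp (-(α * Complex.I)) ∈ Complex.slitPlane}

section
variable {r : ℕ} {α : ℝ} {k : ℕ} {t : ℂ}

theorem cast_sub_one_ne_zero (hr : 3 ≤ r) : (r : ℂ) - 1 ≠ 0 := by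
  rw [sub_ne_zero]; exact_mod_cast (by omega : r ≠ 1)

theorem isOpen_cutPlane (α : ℝ) : IsOpen (cutPlane α) :=
  Complex.isOpen_slitPlane.preimage (by fun_prop)

theorem ne_zero_of_mem_cutPlane (ht : t ∈ cutPlane α) : t ≠ 0 := by
  rintro rfl
  have : (0 : ℂ) * Complex.exp (-(α * Complex.I)) ∈ Complex.slitPlane := ht
  rw [zero_mul] at this
  exact Complex.zero_notMem_slitPlane this

theorem exp_logBranch (α : ℝ) (ht : t ≠ 0) : Complex.exp (logBranch α t) = t := by
  rw [logBranch, Complex.exp_add, Complex.exp_log (mul_ne_zero ht (Complex.exp_ne_zero _)),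
    mul_assoc, ← Complex.exp_add]
  simp

theorem norm_mul_exp_neg (α : ℝ) (t : ℂ) : ‖t * Complex.exp (-(α * Complex.I))‖ = ‖t‖ := by
  have : -(α * Complex.I) = ((-α : ℝ) : ℂ) * Complex.I := by push_cast; ring
  rw [norm_mul, this, Complex.norm_exp_ofReal_mul_I, mul_one]

theorem logBranch_eq (α : ℝ) (t : ℂ) :
    logBranch α t = (Real.log ‖t‖ : ℂ) + argBranch α t * Complex.I := by
  rw [logBranch, Complex.log, norm_mul_exp_neg, argBranch]
  push_cast; ring

theorem critPt_eq (hr : 3 ≤ r) : critPt r α k t = Complex.exp (logCrit r α k t) := by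
  have := cast_sub_one_ne_zero hr
  rw [critPt, theta, powBranch, ← Complex.exp_nat_mul, ← Complex.exp_add, logCrit]
  congr 1
  field_simp

theorem exp_sub_one_mul_logCrit (hr : 3 ≤ r) (ht : t ≠ 0) :
    Complex.exp (((r : ℂ) - 1) * logCrit r α k t) = t := by
  have := cast_sub_one_ne_zero hr
  rw [logCrit, mul_div_cancel₀ _ this, Complex.exp_add, exp_logBranch α ht,
    show 2 * (Real.pi : ℂ) * Complex.I * k = (k : ℂ) * (2 * Real.pi * Complex.I) by ring,
    Complex.exp_nat_mul, Complex.exp_two_pi_mul_I, one_pow, one_mul]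

theorem critPt_pow (hr : 3 ≤ r) (ht : t ≠ 0) : critPt r α k t ^ (r - 1) = t := by
  rw [critPt_eq hr, ← Complex.exp_nat_mul, Nat.cast_sub (by omega), Nat.cast_one,
    exp_sub_one_mul_logCrit hr ht]

theorem direction_sq_mul (hr : 3 ≤ r) : direction r α k t ^ 2 * critPt r α k t ^ r = 1 := by
  rw [direction, critPt_eq hr, ← Complex.exp_nat_mul, ← Complex.exp_nat_mul, ← Complex.exp_add,
    ← Complex.exp_zero]
  congr 1
  push_cast; ring

theorem hasDerivAt_logCrit (ht : t ∈ cutPlane α) :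
    HasDerivAt (logCrit r α k) (t⁻¹ / ((r : ℂ) - 1)) t := by
  have h1 : HasDerivAt (fun t : ℂ => t * Complex.exp (-(α * Complex.I)))
      (Complex.exp (-(α * Complex.I))) t := by
    simpa using (hasDerivAt_id t).mul_const (Complex.exp (-(α * Complex.I)))
  have h2 := (((h1.clog ht).add_const (α * Complex.I)).const_add
    (2 * Real.pi * Complex.I * k : ℂ)).div_const ((r : ℂ) - 1)
  refine h2.congr_deriv ?_
  have := ne_zero_of_mem_cutPlane ht
  have := Complex.exp_ne_zero (-(α * Complex.I))
  field_simp

theorem continuousAt_argBranch (ht : t ∈ cutPlane α) : ContinuousAt (argBranch α) t := by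
  have h : ContinuousAt (fun x : ℂ => Complex.arg (x * Complex.exp (-(α * Complex.I)))) t :=
    ContinuousAt.comp_of_eq (g := Complex.arg)
      (f := fun x : ℂ => x * Complex.exp (-(α * Complex.I))) (Complex.continuousAt_arg ht)
      (by fun_prop) rfl
  exact h.add continuousAt_const

theorem argBranch_mem (ht : t ∈ cutPlane α) :
    argBranch α t ∈ Ioo (α - Real.pi) (α + Real.pi) := by
  have h1 := Complex.neg_pi_lt_arg (t * Complex.exp (-(α * Complex.I)))
  have h2 := Complex.arg_le_pi (t * Complex.exp (-(α * Complex.I)))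
  have h3 := (Complex.mem_slitPlane_iff_arg.mp ht).1
  have h4 := lt_of_le_of_ne h2 h3
  rw [argBranch]
  constructor <;> linarith

theorem mem_cutPlane_of_argBranch_lt (ht : t ≠ 0) (h : argBranch α t < α + Real.pi) :
    t ∈ cutPlane α := by
  refine Complex.mem_slitPlane_iff_arg.mpr ⟨?_, mul_ne_zero ht (Complex.exp_ne_zero _)⟩
  rw [argBranch] at h
  linarith

theorem logBranch_exp {φ : ℝ} (hφ : φ ∈ Ioo (α - Real.pi) (α + Real.pi)) :
    logBranch α (Complex.exp (φ * Complex.I)) = φ * Complex.I := by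
  rw [logBranch, ← Complex.exp_add, show φ * Complex.I + -(α * Complex.I)
    = ((φ - α : ℝ) : ℂ) * Complex.I by push_cast; ring, Complex.log_exp]
  · push_cast; ring
  · simp; linarith [hφ.1]
  · simp; linarith [hφ.2]

theorem argBranch_exp {φ : ℝ} (hφ : φ ∈ Ioo (α - Real.pi) (α + Real.pi)) :
    argBranch α (Complex.exp (φ * Complex.I)) = φ := by
  have h := logBranch_eq α (Complex.exp (φ * Complex.I))
  rw [logBranch_exp hφ, Complex.norm_exp_ofReal_mul_I, Real.log_one, Complex.ofReal_zero,
    zero_add] at h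
  exact_mod_cast (mul_right_cancel₀ Complex.I_ne_zero h).symm

theorem eq_norm_mul_exp (α : ℝ) (ht : t ≠ 0) :
    t = (‖t‖ : ℂ) * Complex.exp (argBranch α t * Complex.I) := by
  conv_lhs => rw [← exp_logBranch α ht, logBranch_eq, Complex.exp_add, ← Complex.ofReal_exp,
    Real.exp_log (norm_pos_iff.mpr ht)]

theorem logCrit_mul (hs : 0 < ‖t‖) {s : ℝ} (hs0 : 0 < s) :
    logCrit r α k (s * t) = logCrit r α k t + (Real.log s / ((r : ℝ) - 1) : ℝ) := by
  have ht : t ≠ 0 := norm_pos_iff.mp hs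
  rw [logCrit, logCrit, logBranch, logBranch, mul_assoc (s : ℂ) t _, Complex.log_ofReal_mul hs0
    (mul_ne_zero ht (Complex.exp_ne_zero _))]
  push_cast
  ring

/-! ### Stokes rays -/

/-- Along the flow the derivative of f is -‖f'‖^2, which is real. -/
theorem IsStokesLine.im_eq {f : ℂ → ℂ} (hf : Differentiable ℂ f) {c b : ℂ} {z : ℝ → ℂ}
    (h : IsStokesLine f c b z) : (f c).im = (f b).im := by
  obtain ⟨hz, hc, hb⟩ := h
  have hd : ∀ τ, HasDerivAt (fun τ => (f (z τ)).im) 0 τ := fun τ => by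
    have h1 : HasDerivAt (fun τ => f (z τ)) _ τ := HasDerivAt.comp τ (hf (z τ)).hasDerivAt (hz τ)
    refine (hasDerivAt_im h1).congr_deriv ?_
    rw [mul_neg, Complex.mul_conj]
    simp
  have hconst := is_const_of_deriv_eq_zero (fun τ => (hd τ).differentiableAt)
    (fun τ => (hd τ).deriv)
  have hfc : Tendsto (fun τ => (f (z τ)).im) atBot (𝓝 (f c).im) :=
    (Complex.continuous_im.comp hf.continuous).continuousAt.tendsto.comp hc
  have hfb : Tendsto (fun τ => (f (z τ)).im) atTop (𝓝 (f b).im) :=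
    (Complex.continuous_im.comp hf.continuous).continuousAt.tendsto.comp hb
  have e : (fun τ => (f (z τ)).im) = fun _ => (f (z 0)).im := funext fun τ => hconst τ 0
  rw [e] at hfc hfb
  rw [tendsto_nhds_unique hfc tendsto_const_nhds, tendsto_nhds_unique hfb tendsto_const_nhds]

/-- With ρ^(r-1) = s, the curve ρ z(ρ^(r-2) τ) solves the flow equation for s t, so the condition
depends on arg t only. -/
theorem OnStokesRay.mul (hr : 3 ≤ r) (ht : t ≠ 0) (h : OnStokesRay r α k t) {s : ℝ} (hs : 0 < s) :
    OnStokesRay r α k (s * t) := by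
  obtain ⟨b, z, hb, hb', hz, hz1, hz2⟩ := h
  have hr1 : (r : ℝ) - 1 ≠ 0 := by
    rw [sub_ne_zero]; exact_mod_cast (by omega : r ≠ 1)
  set ρ : ℝ := Real.exp (Real.log s / ((r : ℝ) - 1)) with hρ
  have hρ0 : 0 < ρ := Real.exp_pos _
  have hρs : ρ ^ (r - 1) = s := by
    rw [hρ, ← Real.exp_nat_mul, Nat.cast_sub (by omega), Nat.cast_one, mul_div_cancel₀ _ hr1,
      Real.exp_log hs]
  have hρs' : (ρ : ℂ) ^ (r - 1) = s := by exact_mod_cast hρs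
  have hcrit : critPt r α k (s * t) = ρ * critPt r α k t := by
    rw [critPt_eq hr, critPt_eq hr, logCrit_mul (norm_pos_iff.mpr ht) hs, Complex.exp_add, hρ,
      Complex.ofReal_exp, mul_comm]
  have hd : ∀ w, deriv (phase r (s * t)) (ρ * w) = s * deriv (phase r t) w := fun w => by
    rw [phase_deriv hr, phase_deriv hr, mul_pow, hρs']; ring
  have hpos : 0 < ρ ^ (r - 2) := by positivity
  refine ⟨ρ * b, fun τ => ρ * z (ρ ^ (r - 2) * τ), ?_, ?_, ?_, ?_, ?_⟩
  · rw [hcrit]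
    intro h
    exact hb (mul_left_cancel₀ (by exact_mod_cast hρ0.ne') h)
  · rw [hd, hb', mul_zero]
  · intro τ
    have h1 : HasDerivAt (fun τ : ℝ => ρ ^ (r - 2) * τ) (ρ ^ (r - 2)) τ := by
      simpa using (hasDerivAt_id τ).const_mul (ρ ^ (r - 2))
    refine (((hz (ρ ^ (r - 2) * τ)).scomp τ h1).const_mul (ρ : ℂ)).congr_deriv ?_
    rw [hd, Complex.real_smul, map_mul, Complex.conj_ofReal, ← hρs',
      show r - 1 = r - 2 + 1 by omega, pow_succ]
    push_cast; ring
  · rw [hcrit]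
    exact (hz1.comp (tendsto_id.const_mul_atBot hpos)).const_mul _
  · exact (hz2.comp (tendsto_id.const_mul_atTop hpos)).const_mul _

theorem onStokesRay_iff (hr : 3 ≤ r) (ht : t ≠ 0) :
    OnStokesRay r α k t ↔ OnStokesRay r α k (Complex.exp (argBranch α t * Complex.I)) := by
  have hn : 0 < ‖t‖ := norm_pos_iff.mpr ht
  constructor
  · intro h
    have := h.mul hr ht (inv_pos.mpr hn)
    have e : ((‖t‖⁻¹ : ℝ) : ℂ) * t = Complex.exp (argBranch α t * Complex.I) := by
      conv_lhs => rw [eq_norm_mul_exp α ht]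
      have : (‖t‖ : ℂ) ≠ 0 := by exact_mod_cast hn.ne'
      simp [Complex.norm_exp_ofReal_mul_I]
      field_simp
    rwa [e] at this
  · intro h
    have := h.mul hr (Complex.exp_ne_zero _) hn
    rwa [← eq_norm_mul_exp α ht] at this

theorem finite_im_exp_eq_zero {A B p q : ℝ} (hp : 0 < p) {z : ℂ} (hz : z ≠ 0) :
    {φ : ℝ | φ ∈ Ioo A B ∧ (Complex.exp ((p * φ + q : ℝ) * Complex.I) * z).im = 0}.Finite := by
  have hpi := Real.pi_pos
  refine ((finite_Icc ⌊(p * A + q + z.arg) / Real.pi⌋ ⌈(p * B + q + z.arg) / Real.pi⌉).image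
    (fun n : ℤ => (n * Real.pi - q - z.arg) / p)).subset ?_
  rintro φ ⟨hφ, him⟩
  have e : Complex.exp ((p * φ + q : ℝ) * Complex.I) * z
      = (‖z‖ : ℂ) * Complex.exp ((p * φ + q + z.arg : ℝ) * Complex.I) := by
    conv_lhs => rw [← Complex.norm_mul_exp_arg_mul_I z]
    rw [mul_left_comm, ← Complex.exp_add]
    congr 2
    push_cast; ring
  rw [e, Complex.im_ofReal_mul, Complex.exp_ofReal_mul_I_im] at him
  have hsin := (mul_eq_zero.mp him).resolve_left (norm_ne_zero_iff.mpr hz)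
  obtain ⟨n, hn⟩ := Real.sin_eq_zero_iff.mp hsin
  refine ⟨n, ⟨?_, ?_⟩, ?_⟩
  · rw [← Int.cast_le (R := ℝ)]
    refine (Int.floor_le _).trans ?_
    rw [div_le_iff₀ hpi, hn]
    nlinarith [hφ.1]
  · rw [← Int.cast_le (R := ℝ)]
    refine le_trans ?_ (Int.le_ceil _)
    rw [le_div_iff₀ hpi, hn]
    nlinarith [hφ.2]
  · simp only
    rw [hn]
    field_simp
    ring

/-- A critical point x has value (1/r - 1) t x. Equal imaginary parts at c and b = ωc, with ω ≠ 1
and ω^(r-1) = 1, mean Im(t c (1 - ω)) = 0. For t = exp(iφ) the argument of t c is affine in φ with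
slope r/(r-1), so each of the finitely many ω allows finitely many φ. -/
theorem finite_stokes (hr : 3 ≤ r) (α : ℝ) (k : ℕ) :
    {φ : ℝ | φ ∈ Ioo (α - Real.pi) (α + Real.pi) ∧
      OnStokesRay r α k (Complex.exp (φ * Complex.I))}.Finite := by
  have hr1 : (3 : ℝ) ≤ r := by exact_mod_cast hr
  have hr0 : (r : ℂ) ≠ 0 := by simp; omega
  have hrc := cast_sub_one_ne_zero hr
  have hroots : {ω : ℂ | ω ^ (r - 1) = 1 ∧ ω ≠ 1}.Finite := by
    refine (Polynomial.nthRootsFinset (r - 1) (1 : ℂ)).finite_toSet.subset fun ω hω => ?_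
    exact (Polynomial.mem_nthRootsFinset (by omega) _).mpr hω.1
  refine (hroots.biUnion fun ω hω => finite_im_exp_eq_zero (A := α - Real.pi) (B := α + Real.pi)
    (p := r / ((r : ℝ) - 1)) (q := 2 * Real.pi * k / ((r : ℝ) - 1))
    (div_pos (by linarith) (by linarith)) (z := 1 - ω) (sub_ne_zero.mpr (Ne.symm hω.2))).subset ?_
  rintro φ ⟨hφ, b, z, hb, hb', hz⟩
  set t := Complex.exp (φ * Complex.I) with htdef
  have ht : t ≠ 0 := Complex.exp_ne_zero _
  set c := critPt r α k t with hc
  have hct : c ^ (r - 1) = t := critPt_pow hr ht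
  have hbt : b ^ (r - 1) = t := by rw [phase_deriv hr] at hb'; exact sub_eq_zero.mp hb'
  have hc0 : c ≠ 0 := by rw [hc, critPt_eq hr]; exact Complex.exp_ne_zero _
  simp only [mem_iUnion]
  refine ⟨b / c, ⟨by rw [div_pow, hbt, hct, div_self ht], fun h => hb ?_⟩, hφ, ?_⟩
  · rw [div_eq_one_iff_eq hc0] at h; exact h
  have him := hz.im_eq (phase_differentiable hr t)
  have e1 : ∀ x : ℂ, x ^ (r - 1) = t → phase r t x = ((1 / (r : ℝ) - 1 : ℝ) : ℂ) * (t * x) := by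
    intro x hx
    have : x ^ r = t * x := by rw [← hx, ← pow_succ]; congr 1; omega
    rw [phase, this]; push_cast; ring
  rw [e1 c hct, e1 b hbt, Complex.im_ofReal_mul, Complex.im_ofReal_mul] at him
  have hne : 1 / (r : ℝ) - 1 ≠ 0 := by
    have : 1 / (r : ℝ) < 1 := by rw [div_lt_one (by linarith)]; linarith
    linarith
  have him' := mul_left_cancel₀ hne him
  have e2 : Complex.exp ((r / ((r : ℝ) - 1) * φ + 2 * Real.pi * k / ((r : ℝ) - 1) : ℝ) * Complex.I)
      = t * c := by
    rw [hc, critPt_eq hr, htdef, ← Complex.exp_add, logCrit, logBranch_exp hφ]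
    congr 1
    push_cast
    field_simp
    ring
  have e3 : t * c * (1 - b / c) = t * c - t * b := by field_simp
  rw [e2, e3, Complex.sub_im, him', sub_self]

theorem isOpen_domain (hr : 3 ≤ r) (α : ℝ) (k : ℕ) : IsOpen (domain r α k) := by
  rw [isOpen_iff_mem_nhds]
  rintro t ⟨ht, hst⟩
  have ht : t ∈ cutPlane α := ht
  have hc := (finite_stokes hr α k).isClosed.isOpen_compl
  have hmem : argBranch α t ∈ {φ : ℝ | φ ∈ Ioo (α - Real.pi) (α + Real.pi) ∧
      OnStokesRay r α k (Complex.exp (φ * Complex.I))}ᶜ := fun h =>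
    hst ((onStokesRay_iff hr (ne_zero_of_mem_cutPlane ht)).mpr h.2)
  filter_upwards [(isOpen_cutPlane α).mem_nhds ht,
    (continuousAt_argBranch ht).eventually (hc.mem_nhds hmem)] with x hx hx'
  exact ⟨hx, fun h => hx' ⟨argBranch_mem hx,
    (onStokesRay_iff hr (ne_zero_of_mem_cutPlane hx)).mp h⟩⟩

/-! ### The hyper-Airy function near a point of its domain -/

/-- A positive multiple of μ spans the same line ℝμ, so M may be saturated under positive scaling.
One branch then serves all t on a ray, as t → ∞ requires. -/
theorem exists_conic_branch (hr : 3 ≤ r) (ht : t ∈ domain r α k) :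
    ∃ (M O : Set ℂ) (U : ℂ → ℂ), IsOpen M ∧ (∀ s : ℝ, 0 < s → ∀ μ, (s : ℂ) * μ ∈ M → μ ∈ M) ∧
      direction r α k t ∈ M ∧ (∀ μ ∈ M, ∀ v : ℝ, (v : ℂ) * μ ∈ O) ∧ IsBranch r O U := by
  have ht0 : t ≠ 0 := ne_zero_of_mem_cutPlane (α := α) ht.1
  obtain ⟨M, O, U, h1, h2, h3, h4⟩ := exists_isBranch_of_not_stokes hr ht0
    (critPt_pow (α := α) (k := k) hr ht0) (direction_sq_mul hr) ht.2
  refine ⟨⋃ s : {s : ℝ // 0 < s}, {μ | ((s : ℝ) : ℂ) * μ ∈ M}, O, U,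
    isOpen_iUnion fun s => h1.preimage (by fun_prop), ?_, ?_, ?_, h4⟩
  · intro s hs μ hμ
    obtain ⟨⟨s', hs'⟩, h⟩ := mem_iUnion.mp hμ
    refine mem_iUnion.mpr ⟨⟨s' * s, mul_pos hs' hs⟩, ?_⟩
    simpa [mul_assoc] using h
  · exact mem_iUnion.mpr ⟨⟨1, one_pos⟩, by simpa using h2⟩
  · intro μ hμ v
    obtain ⟨⟨s', hs'⟩, h⟩ := mem_iUnion.mp hμ
    have hs0 : (s' : ℂ) ≠ 0 := by exact_mod_cast hs'.ne'
    have := h3 _ h (v / s')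
    have e : ((v / s' : ℝ) : ℂ) * (s' * μ) = v * μ := by push_cast; field_simp
    rwa [e] at this

/-- With Λ = log c, the product is i exp(-(r-2)Λ/2) times a positive number; its argument is read
off from Im Λ = (2πk + arg t)/(r-1). -/
theorem orientation (hr : 3 ≤ r) : ∃ ρ : ℝ, 0 < ρ ∧
    critPt r α k t * direction r α k t * kappa r = ρ * Complex.exp (Complex.I *
      ((Real.pi - (2 * Real.pi * k + argBranch α t) * ((r : ℂ) - 2) / ((r : ℂ) - 1)) / 2)) := by
  have hr1 : (3 : ℝ) ≤ r := by exact_mod_cast hr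
  have hrc := cast_sub_one_ne_zero hr
  refine ⟨Real.exp (-((r : ℝ) - 2) / 2 * (Real.log ‖t‖ / ((r : ℝ) - 1))) *
    Real.sqrt (2 / ((r : ℝ) - 1)), mul_pos (Real.exp_pos _) (Real.sqrt_pos.mpr
      (div_pos two_pos (by linarith))), ?_⟩
  rw [critPt_eq hr, direction, kappa, ← Complex.exp_add, logCrit, logBranch_eq]
  have hI : Complex.I = Complex.exp (Real.pi / 2 * Complex.I) := (Complex.exp_pi_div_two_mul_I).symm
  push_cast
  have e : ∀ a s : ℂ, Complex.exp a * (Complex.I * s)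
      = Complex.exp (a + Real.pi / 2 * Complex.I) * s := by
    intro a s
    rw [Complex.exp_add, ← hI]; ring
  rw [e]
  conv_rhs => rw [mul_right_comm, ← Complex.exp_add]
  congr 2
  field_simp
  ring

section
variable {O : Set ℂ} {U : ℂ → ℂ}

theorem IsBranch.isOrientedThimble (h : IsBranch r O U) (hr : 3 ≤ r) (ht : t ≠ 0)
    (hO : ∀ v : ℝ, (v : ℂ) * direction r α k t ∈ O) :
    IsOrientedThimble r α k t
      (fun v : ℝ => critPt r α k t * U (v * direction r α k t)) := by
  have hs := h.isSteepBranch hr ht (critPt_pow (α := α) (k := k) hr ht) (direction_sq_mul hr) hO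
  refine ⟨hs.isThimble (phase_differentiable hr t), ?_⟩
  have hd := (hs.hasDerivAt_ofReal 0).deriv
  rw [Complex.ofReal_zero, hs.deriv_zero] at hd
  obtain ⟨ρ, hρ, e⟩ := orientation (α := α) (k := k) (t := t) hr
  exact ⟨ρ, hρ, by rw [← e]; exact hd⟩

theorem IsBranch.integral_thimble (h : IsBranch r O U) (hr : 3 ≤ r) (ht : t ≠ 0)
    (hO : ∀ v : ℝ, (v : ℂ) * direction r α k t ∈ O) {γ : ℝ → ℂ}
    (hγ : IsOrientedThimble r α k t γ) :
    MeasureTheory.Integrable (integrand r t γ) ∧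
      ∫ x : ℝ, integrand r t γ x = thimbleInt r U 0 (logCrit r α k t) := by
  have hct := critPt_pow (α := α) (k := k) hr ht
  have hs := h.isSteepBranch hr ht hct (direction_sq_mul hr) hO
  obtain ⟨ρ, hρ, e⟩ := orientation (α := α) (k := k) (t := t) hr
  obtain ⟨ρ', hρ', e'⟩ := hγ.2
  obtain ⟨h1, h2⟩ := hs.integral_thimble (phase_differentiable hr t)
    (phase_tendsto_cobounded hr ht hct) hγ.1 ⟨ρ' / ρ, div_pos hρ' hρ, by
      rw [e, e']
      have : (ρ : ℂ) ≠ 0 := by exact_mod_cast hρ.ne'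
      push_cast
      field_simp⟩
  set c := critPt r α k t with hc
  set μ := direction r α k t with hμ
  have hfc : phase r t c = nphase r 1 * Complex.exp (r * logCrit r α k t) := by
    have h3 := phase_mul hr hct 1
    rw [mul_one] at h3
    rw [h3, hc, critPt_eq hr, ← Complex.exp_nat_mul, mul_comm]
  have hderiv : ∀ v : ℝ, deriv (fun ξ => c * U (ξ * μ)) v = c * (deriv U (v * μ) * μ) := fun v => by
    have h4 := (h.diff.differentiableAt (h.isOpen.mem_nhds (hO v))).hasDerivAt
    have := ((h4.comp (v : ℂ) ((hasDerivAt_id (v : ℂ)).mul_const μ)).const_mul c).deriv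
    simpa [Function.comp_def] using this
  have e2 : (fun v : ℝ => Complex.exp (phase r t c - v ^ 2) * deriv (fun ξ => c * U (ξ * μ)) v)
      = fun v : ℝ => (c * Complex.exp (phase r t c)) *
        (Complex.exp (-(v : ℂ) ^ 2) * ((fun ζ => U ζ ^ 0 * deriv U ζ) (v * μ) * μ)) := by
    funext v
    rw [hderiv, sub_eq_add_neg, Complex.exp_add]
    simp only [pow_zero, one_mul]
    ring
  rw [e2] at h1 h2
  refine ⟨h1.mpr ((integrable_gauss_mul h.isOpen (h.differentiableOn_pow_mul_deriv 0)
    (h.polyBounded_pow_mul_deriv hr 0) hO).const_mul _), h2.trans ?_⟩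
  rw [MeasureTheory.integral_const_mul, thimbleInt, moment, hfc, hc, critPt_eq hr,
    ← Complex.exp_add, Nat.cast_zero, zero_add, one_mul]
  rfl

theorem IsBranch.hyperAiry_eq (h : IsBranch r O U) (hr : 3 ≤ r) (ht : t ≠ 0)
    (hO : ∀ v : ℝ, (v : ℂ) * direction r α k t ∈ O) :
    hyperAiry r α k t = thetaHalf r k / (2 * Real.pi * Complex.I) *
      thimbleInt r U 0 (logCrit r α k t) := by
  have hex : ∃ γ, IsOrientedThimble r α k t γ := ⟨_, h.isOrientedThimble hr ht hO⟩
  rw [hyperAiry, dif_pos hex, (h.integral_thimble hr ht hO hex.choose_spec).2]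

theorem IsBranch.hasDerivAt_thimbleInt_logCrit (h : IsBranch r O U) (hr : 3 ≤ r) {M : Set ℂ}
    (hM : IsOpen M) (hMO : ∀ μ ∈ M, ∀ v : ℝ, (v : ℂ) * μ ∈ O) (ht : t ∈ cutPlane α)
    (htM : direction r α k t ∈ M) (a : ℕ) :
    HasDerivAt (fun t => thimbleInt r U a (logCrit r α k t))
      (-thimbleInt r U (a + 1) (logCrit r α k t)) t := by
  have ht0 := ne_zero_of_mem_cutPlane ht
  have hrc := cast_sub_one_ne_zero hr
  have h1 := (h.hasDerivAt_thimbleInt hr a hM hMO htM).comp t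
    (hasDerivAt_logCrit (r := r) (k := k) ht)
  refine h1.congr_deriv ?_
  rw [exp_sub_one_mul_logCrit hr ht0]
  field_simp

theorem continuousAt_direction (ht : t ∈ cutPlane α) : ContinuousAt (direction r α k) t := by
  have := (hasDerivAt_logCrit (r := r) (k := k) ht).continuousAt
  unfold direction
  fun_prop

/-- One branch U represents the function on an open set of t, since only the direction of the line
varies. The formula can therefore be differentiated repeatedly. -/
theorem IsBranch.iteratedDeriv_hyperAiry (h : IsBranch r O U) (hr : 3 ≤ r) {M : Set ℂ}
    (hM : IsOpen M) (hMO : ∀ μ ∈ M, ∀ v : ℝ, (v : ℂ) * μ ∈ O) (a : ℕ) :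
    ∀ t ∈ cutPlane α, direction r α k t ∈ M → iteratedDeriv a (hyperAiry r α k) t
      = thetaHalf r k / (2 * Real.pi * Complex.I) * ((-1) ^ a *
        thimbleInt r U a (logCrit r α k t)) := by
  induction a with
  | zero =>
    intro t ht htM
    rw [iteratedDeriv_zero, h.hyperAiry_eq hr (ne_zero_of_mem_cutPlane ht) (hMO _ htM), pow_zero,
      one_mul]
  | succ a ih =>
    intro t ht htM
    have hev : iteratedDeriv a (hyperAiry r α k) =ᶠ[𝓝 t] fun t =>
        thetaHalf r k / (2 * Real.pi * Complex.I) * ((-1) ^ a *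
          thimbleInt r U a (logCrit r α k t)) := by
      filter_upwards [(isOpen_cutPlane α).mem_nhds ht,
        (continuousAt_direction ht).eventually (hM.mem_nhds htM)] with x hx hxM using ih x hx hxM
    rw [iteratedDeriv_succ, hev.deriv_eq, (((h.hasDerivAt_thimbleInt_logCrit hr hM hMO ht
      htM a).const_mul _).const_mul _).deriv]
    ring

theorem IsBranch.differentiableAt_hyperAiry (h : IsBranch r O U) (hr : 3 ≤ r) {M : Set ℂ}
    (hM : IsOpen M) (hMO : ∀ μ ∈ M, ∀ v : ℝ, (v : ℂ) * μ ∈ O) (ht : t ∈ cutPlane α)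
    (htM : direction r α k t ∈ M) : DifferentiableAt ℂ (hyperAiry r α k) t := by
  have h1 := ((h.hasDerivAt_thimbleInt_logCrit hr hM hMO ht htM 0).const_mul
    (thetaHalf r k / (2 * Real.pi * Complex.I))).differentiableAt
  refine h1.congr_of_eventuallyEq ?_
  filter_upwards [(isOpen_cutPlane α).mem_nhds ht,
    (continuousAt_direction ht).eventually (hM.mem_nhds htM)] with x hx hxM
  exact h.hyperAiry_eq hr (ne_zero_of_mem_cutPlane hx) (hMO _ hxM)

theorem IsBranch.thimbleInt_cycle (h : IsBranch r O U) (hr : 3 ≤ r) (ht : t ≠ 0)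
    (hO : ∀ v : ℝ, (v : ℂ) * direction r α k t ∈ O) :
    thimbleInt r U (r - 1) (logCrit r α k t) = t * thimbleInt r U 0 (logCrit r α k t) := by
  have hm := h.moment_cycle hr hO
  rw [direction] at hm
  conv_rhs => rw [← exp_sub_one_mul_logCrit (α := α) (k := k) hr ht]
  rw [thimbleInt, thimbleInt, hm, exp_sub_one_mul_logCrit hr ht, ← mul_assoc]
  congr 1
  conv_rhs => rw [← exp_sub_one_mul_logCrit (α := α) (k := k) hr ht]
  rw [← Complex.exp_add, exp_sub_one_mul_logCrit hr ht, Nat.cast_sub (by omega)]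
  congr 1
  push_cast
  ring

end

end

end HyperAiry

namespace HyperAiry
open Set Metric

/-! ### The asymptotic expansion -/

section
variable {r : ℕ} {α : ℝ} {k : ℕ} {t : ℂ}

theorem expansion_variable_eq (hr : 3 ≤ r) :
    (theta r ^ k)⁻¹ * (powBranch α t (-((r : ℂ) / ((r : ℂ) - 1))) / ((r : ℂ) - 1))
      = direction r α k t ^ 2 / ((r : ℂ) - 1) := by
  have hrc := cast_sub_one_ne_zero hr
  rw [← mul_div_assoc]
  congr 1
  have e : -(2 * Real.pi * Complex.I / ((r : ℂ) - 1) * k)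
      + -((r : ℂ) / ((r : ℂ) - 1)) * logBranch α t
      = k * (2 * Real.pi * Complex.I) + (2 : ℕ) * -(r * logCrit r α k t / 2) := by
    rw [logCrit]
    push_cast
    field_simp
    ring
  rw [theta, ← Complex.exp_nat_mul, ← Complex.exp_neg, powBranch, ← Complex.exp_add,
    mul_comm _ (_ / _),
    e, Complex.exp_add, Complex.exp_nat_mul, Complex.exp_two_pi_mul_I, one_pow, one_mul,
    Complex.exp_nat_mul, direction]

theorem kappa_mul_sqrt_pi (hr : 3 ≤ r) :
    kappa r * (Real.sqrt Real.pi : ℂ) / (2 * Real.pi * Complex.I)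
      = 1 / (Real.sqrt (2 * Real.pi * ((r : ℝ) - 1)) : ℂ) := by
  have hr1 : (0 : ℝ) < (r : ℝ) - 1 := by
    have : (3 : ℝ) ≤ r := by exact_mod_cast hr
    linarith
  have hpi := Real.pi_pos
  have h : Real.sqrt (2 / ((r : ℝ) - 1)) * Real.sqrt Real.pi *
      Real.sqrt (2 * Real.pi * ((r : ℝ) - 1))
      = 2 * Real.pi := by
    rw [← Real.sqrt_mul (by positivity), ← Real.sqrt_mul (by positivity),
      show 2 / ((r : ℝ) - 1) * Real.pi * (2 * Real.pi * ((r : ℝ) - 1)) = (2 * Real.pi) ^ 2 by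
        field_simp]
    exact Real.sqrt_sq (by positivity)
  have h0 : Real.sqrt (2 * Real.pi * ((r : ℝ) - 1)) ≠ 0 := (Real.sqrt_pos.mpr (by positivity)).ne'
  have h' : (Real.sqrt (2 / ((r : ℝ) - 1)) : ℂ) * (Real.sqrt Real.pi : ℂ) *
      (Real.sqrt (2 * Real.pi * ((r : ℝ) - 1)) : ℂ) = 2 * Real.pi := by exact_mod_cast h
  have h0' : (Real.sqrt (2 * Real.pi * ((r : ℝ) - 1)) : ℂ) ≠ 0 := by exact_mod_cast h0
  have hI := Complex.I_ne_zero
  have hpic : (Real.pi : ℂ) ≠ 0 := by exact_mod_cast hpi.ne'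
  rw [div_eq_div_iff (by simp [hpic]) h0', kappa, one_mul, ← h']
  ring

theorem exponential_prefactor_eq (hr : 3 ≤ r) :
    -(((r : ℂ) - 1) / r * theta r ^ k * powBranch α t ((r : ℂ) / ((r : ℂ) - 1)))
      = nphase r 1 * Complex.exp (r * logCrit r α k t) := by
  have hrc := cast_sub_one_ne_zero hr
  have hr0 : (r : ℂ) ≠ 0 := by exact_mod_cast (by omega : r ≠ 0)
  have e : r * logCrit r α k t = k * (2 * Real.pi * Complex.I) +
      (k * (2 * Real.pi * Complex.I / ((r : ℂ) - 1)) +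
        (r : ℂ) / ((r : ℂ) - 1) * logBranch α t) := by
    rw [logCrit]
    field_simp
    ring
  rw [e, Complex.exp_add, Complex.exp_nat_mul, Complex.exp_two_pi_mul_I, one_pow, one_mul,
    Complex.exp_add, theta, ← Complex.exp_nat_mul, powBranch, nphase, one_pow]
  field_simp
  ring

/-- Every factor is an exponential of log t with the chosen branch. The powers of θ combine with
those of t through Λ = (2πik + log t)/(r-1), so no branch ambiguity arises. -/
theorem prefactor_eq (hr : 3 ≤ r) (a : ℕ) :
    (-theta r ^ k) ^ a / (Real.sqrt (2 * Real.pi * ((r : ℝ) - 1)) : ℂ) *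
      Complex.exp (-(((r : ℂ) - 1) / r * theta r ^ k * powBranch α t ((r : ℂ) / ((r : ℂ) - 1)))) *
      powBranch α t (-(((r : ℂ) - 2 * a - 2) / (2 * ((r : ℂ) - 1))))
    = thetaHalf r k / (2 * Real.pi * Complex.I) * ((-1) ^ a *
      (Complex.exp ((a + 1) * logCrit r α k t + nphase r 1 * Complex.exp (r * logCrit r α k t)) *
        (kappa r * (Real.sqrt Real.pi : ℂ) * direction r α k t))) := by
  have hrc := cast_sub_one_ne_zero hr
  have e : Complex.exp (a * (k * (2 * Real.pi * Complex.I / ((r : ℂ) - 1)))) *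
      powBranch α t (-(((r : ℂ) - 2 * a - 2) / (2 * ((r : ℂ) - 1))))
      = thetaHalf r k * (Complex.exp ((a + 1) * logCrit r α k t) * direction r α k t) := by
    rw [powBranch, thetaHalf, direction, ← Complex.exp_add, ← Complex.exp_add, ← Complex.exp_add,
      logCrit]
    congr 1
    field_simp
    ring
  rw [exponential_prefactor_eq hr, neg_pow, theta, ← Complex.exp_nat_mul, ← Complex.exp_nat_mul,
    div_eq_mul_one_div, ← kappa_mul_sqrt_pi hr, Complex.exp_add]
  linear_combination ((-1) ^ a * (kappa r * (Real.sqrt Real.pi : ℂ) / (2 * Real.pi * Complex.I)) *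
    Complex.exp (nphase r 1 * Complex.exp (r * logCrit r α k t))) * e

/-- The modulus is ‖t‖^(-r/(2(r-1))). -/
theorem norm_direction_le_one (hr : 3 ≤ r) (ht : 1 ≤ ‖t‖) : ‖direction r α k t‖ ≤ 1 := by
  have hr1 : (3 : ℝ) ≤ r := by exact_mod_cast hr
  have hlog := Real.log_nonneg ht
  have e : -(r * logCrit r α k t / 2) = ((-(r * (Real.log ‖t‖ / ((r : ℝ) - 1)) / 2) : ℝ) : ℂ)
      + ((-(r * ((2 * Real.pi * k + argBranch α t) / ((r : ℝ) - 1)) / 2) : ℝ) : ℂ)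
        * Complex.I := by
    rw [logCrit, logBranch_eq]
    push_cast
    ring
  rw [direction, e, Complex.exp_add, norm_mul, Complex.norm_exp_ofReal_mul_I, mul_one,
    ← Complex.ofReal_exp, Complex.norm_real, Real.norm_of_nonneg (Real.exp_pos _).le,
    Real.exp_le_one_iff, Left.neg_nonpos_iff]
  have : 0 < (r : ℝ) - 1 := by linarith
  positivity

theorem direction_mem_of_conic (ht : t ≠ 0) {M : Set ℂ}
    (hM : ∀ s : ℝ, 0 < s → ∀ μ, (s : ℂ) * μ ∈ M → μ ∈ M)
    (h : direction r α k (Complex.exp (argBranch α t * Complex.I)) ∈ M) :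
    direction r α k t ∈ M := by
  have hn : 0 < ‖t‖ := norm_pos_iff.mpr ht
  refine hM (Real.exp (r * (Real.log ‖t‖ / ((r : ℝ) - 1)) / 2)) (Real.exp_pos _) _ ?_
  convert h using 1
  have e := logCrit_mul (r := r) (α := α) (k := k)
    (t := Complex.exp (argBranch α t * Complex.I)) (by simp [Complex.norm_exp_ofReal_mul_I]) hn
  rw [← eq_norm_mul_exp α ht] at e
  rw [direction, direction, e, Complex.ofReal_exp, ← Complex.exp_add]
  congr 1
  push_cast
  ring

theorem IsBranch.isBigO_hyperAiry {O : Set ℂ} {U : ℂ → ℂ} (h : IsBranch r O U) (hr : 3 ≤ r)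
    {M : Set ℂ} (hM : IsOpen M) (hMO : ∀ μ ∈ M, ∀ v : ℝ, (v : ℂ) * μ ∈ O) {S : Set ℂ}
    (hS : ∀ t ∈ S, t ∈ cutPlane α ∧ direction r α k t ∈ M) {a : ℕ} (ha : a ≤ r - 1) (N : ℕ)
    {p u : ℂ → ℂ} (hp : ∀ t, p t = thetaHalf r k / (2 * Real.pi * Complex.I) * ((-1) ^ a *
      (Complex.exp ((a + 1) * logCrit r α k t + nphase r 1 * Complex.exp (r * logCrit r α k t)) *
        (kappa r * (Real.sqrt Real.pi : ℂ) * direction r α k t))))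
    (hu : ∀ t, u t = direction r α k t ^ 2 / ((r : ℂ) - 1)) :
    Asymptotics.IsBigO (Bornology.cobounded ℂ ⊓ 𝓟 S)
      (fun t => iteratedDeriv a (hyperAiry r α k) t
        - p t * ∑ m ∈ Finset.range N, (ppz r m a : ℂ) * u t ^ m)
      (fun t => p t * u t ^ N) := by
  obtain ⟨C, hC⟩ := h.moment_expansion hr a ha N
  have hrc := cast_sub_one_ne_zero hr
  have hκ : kappa r * (Real.sqrt Real.pi : ℂ) ≠ 0 :=
    mul_ne_zero (kappa_ne_zero hr) (by exact_mod_cast (Real.sqrt_pos.mpr Real.pi_pos).ne')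
  refine Asymptotics.IsBigO.of_bound
    (C * (‖((r : ℂ) - 1) ^ N‖ / ‖kappa r * (Real.sqrt Real.pi : ℂ)‖)) ?_
  have hlarge : ∀ᶠ t : ℂ in Bornology.cobounded ℂ, 1 ≤ ‖t‖ :=
    tendsto_norm_cobounded_atTop.eventually_ge_atTop 1
  filter_upwards [hlarge.filter_mono inf_le_left, mem_inf_of_right (mem_principal_self S)]
    with t ht htS
  obtain ⟨htc, htM⟩ := hS t htS
  have hb := hC (direction r α k t) (norm_direction_le_one hr ht) (hMO _ htM)
  rw [h.iteratedDeriv_hyperAiry hr hM hMO a t htc htM, thimbleInt]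
  set μ := direction r α k t with hμ
  set E := thetaHalf r k / (2 * Real.pi * Complex.I) * ((-1) ^ a *
    Complex.exp ((a + 1) * logCrit r α k t + nphase r 1 * Complex.exp (r * logCrit r α k t)))
    with hE
  have e1 : p t = E * (kappa r * (Real.sqrt Real.pi : ℂ) * μ) := by rw [hp, hE]; ring
  have e2 : thetaHalf r k / (2 * Real.pi * Complex.I) * ((-1) ^ a *
      (Complex.exp ((a + 1) * logCrit r α k t + nphase r 1 * Complex.exp (r * logCrit r α k t)) *
        moment U a (Complex.exp (-(r * logCrit r α k t / 2))))) = E * moment U a μ := by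
    rw [hE, hμ, direction]; ring
  rw [e1, e2, mul_assoc E, ← mul_sub, hu]
  have e3 : E * (kappa r * (Real.sqrt Real.pi : ℂ) * μ * (μ ^ 2 / ((r : ℂ) - 1)) ^ N)
      = E * (μ * (μ ^ 2) ^ N) * (kappa r * (Real.sqrt Real.pi : ℂ) / ((r : ℂ) - 1) ^ N) := by
    rw [div_pow]; ring
  rw [mul_assoc E, e3, norm_mul, norm_mul _ (_ / _), norm_mul E, norm_div]
  refine (mul_le_mul_of_nonneg_left hb (norm_nonneg E)).trans (le_of_eq ?_)
  have h1 : ‖kappa r * (Real.sqrt Real.pi : ℂ)‖ ≠ 0 := norm_ne_zero_iff.mpr hκ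
  have h2 : ‖((r : ℂ) - 1) ^ N‖ ≠ 0 := norm_ne_zero_iff.mpr (pow_ne_zero _ hrc)
  field_simp

theorem hasAsymptoticExpansion_hyperAiry (hr : 3 ≤ r) {a : ℕ} (ha : a ≤ r - 1) {φ₁ φ₂ : ℝ}
    (h1 : α - Real.pi < φ₁) (h2 : φ₂ < α + Real.pi) (hsec : sector α φ₁ φ₂ ⊆ domain r α k)
    {p u : ℂ → ℂ} (hp : ∀ t, p t = thetaHalf r k / (2 * Real.pi * Complex.I) * ((-1) ^ a *
      (Complex.exp ((a + 1) * logCrit r α k t + nphase r 1 * Complex.exp (r * logCrit r α k t)) *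
        (kappa r * (Real.sqrt Real.pi : ℂ) * direction r α k t))))
    (hu : ∀ t, u t = direction r α k t ^ 2 / ((r : ℂ) - 1)) :
    HasAsymptoticExpansion (sector α φ₁ φ₂) (iteratedDeriv a (hyperAiry r α k)) p u
      (fun m => (ppz r m a : ℂ)) := by
  intro N
  -- Uniformity by compactness: the estimate is stable under finite unions of sets of arguments, and
  -- near each argument a single conic branch controls the error.
  refine isCompact_Icc.induction_on (p := fun A : Set ℝ => Asymptotics.IsBigO
    (Bornology.cobounded ℂ ⊓ 𝓟 {t | t ≠ 0 ∧ argBranch α t ∈ A}) _ _) ?_ ?_ ?_ ?_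
  · simp
  · intro A B hAB hB
    exact hB.mono (inf_le_inf_left _ (principal_mono.mpr fun t ht => ⟨ht.1, hAB ht.2⟩))
  · intro A B hA hB
    refine (hA.sup hB).mono ?_
    rw [← inf_sup_left, sup_principal]
    refine inf_le_inf_left _ (principal_mono.mpr ?_)
    rintro t ⟨ht, hA | hB⟩
    exacts [Or.inl ⟨ht, hA⟩, Or.inr ⟨ht, hB⟩]
  · intro φ hφ
    have hφ' : φ ∈ Ioo (α - Real.pi) (α + Real.pi) := ⟨h1.trans_le hφ.1, hφ.2.trans_lt h2⟩
    have hd : Complex.exp (φ * Complex.I) ∈ domain r α k :=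
      hsec ⟨Complex.exp_ne_zero _, by rwa [argBranch_exp hφ']⟩
    obtain ⟨M, O, U, hM, hcone, hmem, hMO, hU⟩ := exists_conic_branch hr hd
    have hc : ContinuousAt (fun ψ : ℝ => direction r α k (Complex.exp (ψ * Complex.I))) φ :=
      ContinuousAt.comp_of_eq (g := direction r α k) (f := fun ψ : ℝ => Complex.exp (ψ * Complex.I))
        (continuousAt_direction hd.1) (by fun_prop) rfl
    refine ⟨{ψ | direction r α k (Complex.exp (ψ * Complex.I)) ∈ M} ∩ Icc φ₁ φ₂,
      inter_mem (mem_nhdsWithin_of_mem_nhds (hc.eventually (hM.mem_nhds hmem)))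
        self_mem_nhdsWithin, ?_⟩
    refine hU.isBigO_hyperAiry hr hM hMO (fun t ht => ?_) ha N hp hu
    exact ⟨mem_cutPlane_of_argBranch_lt ht.1 (ht.2.2.2.trans_lt h2),
      direction_mem_of_conic ht.1 hcone ht.2.1⟩

end

end HyperAiry

theorem proposition3p4 (r : ℕ) (hr : 3 ≤ r) (α : ℝ) (k : ℕ) (hk : k ≤ r - 2) :
    -- only finitely many directions are Stokes rays, and the complementary set is open
    {φ : ℝ | φ ∈ Set.Ioo (α - Real.pi) (α + Real.pi) ∧
      HyperAiry.OnStokesRay r α k (Complex.exp (φ * Complex.I))}.Finite ∧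
    IsOpen (HyperAiry.domain r α k) ∧
    -- away from the Stokes rays the thimble exists and the integral over it is well defined
    (∀ t ∈ HyperAiry.domain r α k,
      (∃ γ, HyperAiry.IsOrientedThimble r α k t γ) ∧
      ∀ γ, HyperAiry.IsOrientedThimble r α k t γ →
        MeasureTheory.Integrable (HyperAiry.integrand r t γ) ∧
        HyperAiry.hyperAiry r α k t =
          HyperAiry.thetaHalf r k / (2 * Real.pi * Complex.I) *
            ∫ x : ℝ, HyperAiry.integrand r t γ x) ∧
    -- the differential equation
    DifferentiableOn ℂ (HyperAiry.hyperAiry r α k) (HyperAiry.domain r α k) ∧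
    (∀ t ∈ HyperAiry.domain r α k,
      iteratedDeriv (r - 1) (HyperAiry.hyperAiry r α k) t =
        (-1) ^ (r - 1) * t * HyperAiry.hyperAiry r α k t) ∧
    -- the asymptotic expansions of the function and its derivatives
    (∀ a : ℕ, a ≤ r - 1 → ∀ φ₁ φ₂ : ℝ, α - Real.pi < φ₁ → φ₂ < α + Real.pi →
      HyperAiry.sector α φ₁ φ₂ ⊆ HyperAiry.domain r α k →
      HyperAiry.HasAsymptoticExpansion (HyperAiry.sector α φ₁ φ₂)
        (iteratedDeriv a (HyperAiry.hyperAiry r α k))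
        (fun t => (-HyperAiry.theta r ^ k) ^ a / (Real.sqrt (2 * Real.pi * ((r : ℝ) - 1)) : ℂ) *
          Complex.exp (-(((r : ℂ) - 1) / r * HyperAiry.theta r ^ k *
            HyperAiry.powBranch α t ((r : ℂ) / ((r : ℂ) - 1)))) *
          HyperAiry.powBranch α t (-(((r : ℂ) - 2 * a - 2) / (2 * ((r : ℂ) - 1)))))
        (fun t => (HyperAiry.theta r ^ k)⁻¹ *
          (HyperAiry.powBranch α t (-((r : ℂ) / ((r : ℂ) - 1))) / ((r : ℂ) - 1)))
        (fun m => (HyperAiry.ppz r m a : ℂ))) := by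
  refine ⟨HyperAiry.finite_stokes hr α k, HyperAiry.isOpen_domain hr α k, fun t ht => ?_,
    fun t ht => ?_, fun t ht => ?_, fun a ha φ₁ φ₂ h1 h2 hsec => ?_⟩
  · obtain ⟨M, O, U, -, -, hmem, hMO, hU⟩ := HyperAiry.exists_conic_branch hr ht
    have ht0 := HyperAiry.ne_zero_of_mem_cutPlane (α := α) ht.1
    refine ⟨⟨_, hU.isOrientedThimble hr ht0 (hMO _ hmem)⟩, fun γ hγ => ?_⟩
    obtain ⟨hi, he⟩ := hU.integral_thimble hr ht0 (hMO _ hmem) hγ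
    exact ⟨hi, by rw [he, hU.hyperAiry_eq hr ht0 (hMO _ hmem)]⟩
  · obtain ⟨M, O, U, hM, -, hmem, hMO, hU⟩ := HyperAiry.exists_conic_branch hr ht
    exact (hU.differentiableAt_hyperAiry hr hM hMO ht.1 hmem).differentiableWithinAt
  · obtain ⟨M, O, U, hM, -, hmem, hMO, hU⟩ := HyperAiry.exists_conic_branch hr ht
    have ht0 := HyperAiry.ne_zero_of_mem_cutPlane (α := α) ht.1
    rw [hU.iteratedDeriv_hyperAiry hr hM hMO _ t ht.1 hmem,
      hU.thimbleInt_cycle hr ht0 (hMO _ hmem), hU.hyperAiry_eq hr ht0 (hMO _ hmem)]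
    ring
  · exact HyperAiry.hasAsymptoticExpansion_hyperAiry hr ha h1 h2 hsec
      (fun t => HyperAiry.prefactor_eq hr a) (fun t => HyperAiry.expansion_variable_eq hr)
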